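/- Work in second-order arithmetic. $\mathsf{RCA}_0$ consists of the basic axioms of arithmetic, $\Sigma^0_1$-induction and $\Delta^0_1$-comprehension; $\Pi^1_1\text{-}\mathsf{CA}_0$ is $\mathsf{RCA}_0$ plus $\Pi^1_1$-comprehension. The following notions are defined in $\mathsf{RCA}_0$. *Continuous maps.* Let $X,Y$ be coded spaces with countable bases of (codes of) basic open sets $Z,W$. A code of a continuous map from $X$ to $Y$ is a set $\Phi\subseteq\mathbb N\times W\times Z$; for points $x\in X$, $y\in Y$ one has $f(x)=y$ iff for all $V\in W$: $y\in V\leftrightarrow\exists n\,\exists U\in Z\,((n,V,U)\in\Phi\wedge x\in U)$. The map is total if every $x\in X$ has such a $y\in Y$. $X$ and $Y$ are homeomorphic if there are codes of total continuous maps $f:X\to Y$ and $g:Y\to X$ with $g(f(x))=x$ and $f(g(y))=y$ for all points $x\in X$, $y\in Y$. *UF spaces.* A poset is a set $P\subseteq\mathbb N$ with a preorder $\le$; $p<q$ means $p\le q$ and $q\not\le p$. Filters are represented by decreasing sequences $x_0\ge x_1\ge\cdots$ in $P$; such a sequence stands for $F=\{p\in P:\exists i\,(x_i\le p)\}$, and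 two sequences are equal as points if they generate the same filter. $F$ is unbounded if there is no $r\in P$ with $r<p$ for all $p\in F$. $\mathrm{UF}(P)$ is the space of unbounded filters, with basic open sets $N_p=\{F:p\in F\}$, $p\in P$. A UF space is a space of the form $\mathrm{UF}(P)$. *$\mathbf\Pi^0_2$-subspaces of $\mathcal P(\mathbb N)$.* A point of $\mathcal P(\mathbb N)$ is a sequence of finite sets $q_0\subseteq q_1\subseteq\cdots$ with $q_i\subseteq\{0,\dots,i\}$, standing for $\bigcup_i q_i$; the basic open sets are $N_p=\{x:p\subseteq x\}$ for finite $p\subseteq\mathbb N$. A $\mathbf\Pi^0_2$-subspace is $\bigcap_{i\in\mathbb N}(A_i\cup B_i)$ for a coded sequence of closed sets $A_i$ and open sets $B_i$ (each $B_i$, and each complement of an $A_i$, being given as a countable union of basic open sets), with the subspace topology. *Quasi-Polish spaces.* A code of a separable quasi-metric space $X_A$ is a nonempty set $A\subseteq\mathbb N$ with a function $d:A\times A\to\mathbb R$ such that $d(a,b)\ge0$, $d(a,a)=0$ and $d(a,c)\le d(a,b)+d(b,c)$. Its points are the sequences $\langle a_n\rangle$ in $A$ with $\max\{d(a_n,a_m),d(a_m,a_n)\}<2^{-n}$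 for all $n<m$; for points $x=\langle a_n\rangle$, $y=\langle b_n\rangle$ let $d(x,y)=\lim_n d(a_n,b_n)$, and $x=y$ iff $d(x,y)=d(y,x)=0$. The basic open sets are $\{y:d(a,y)<r\}$, $a\in A$, $r\in\mathbb Q_{>0}$. $X_A$ is Smyth-complete if for every sequence $\langle a_n\rangle$ in $A$ with $d(a_n,a_m)<2^{-n}$ for all $0<n<m$ there is a point $\langle b_n\rangle$ of $X_A$ with $d(a_{n+1},b_{n+1})<2^{-n}$ for all $n$ and $\lim_n d(b_n,a_n)=0$. A quasi-Polish space is a Smyth-complete $X_A$. **Theorem.** Over $\mathsf{RCA}_0$ (that is, in every model of $\mathsf{RCA}_0$) the following statements are equivalent: 1. $\Pi^1_1\text{-}\mathsf{CA}_0$; 2. every $\mathbf\Pi^0_2$-subspace of $\mathcal P(\mathbb N)$ is homeomorphic to a UF space; 3. every nonempty UF space is homeomorphic to a quasi-Polish space; 4. every nonempty $\mathbf\Pi^0_2$-subspace of $\mathcal P(\mathbb N)$ is homeomorphic to a quasi-Polish space. -/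

import Mathlib

/- An `L₂`-structure is a type `M` (numbers) with `0, 1, +, ·, <` together with a
collection `S : Set (Set M)` (sets).  Everything below is interpreted in `(M, S)`: number
quantifiers range over `M`, set quantifiers range over `S`. -/

namespace SOA

universe u

/-! ### The language of second-order arithmetic (de Bruijn indices) -/

inductive NTerm : Type
  | var : ℕ → NTerm
  | zero : NTerm
  | one : NTerm
  | add : NTerm → NTerm → NTerm
  | mul : NTerm → NTerm → NTerm

/-- Formulas.  `ball t φ` is the bounded quantifier `∀ x < t, φ`, with `t` read outside the
scope of `x`; `allN`, `allS` quantify over numbers and sets.  Number variables and set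
variables are indexed separately. -/
inductive Fml : Type
  | eq : NTerm → NTerm → Fml
  | lt : NTerm → NTerm → Fml
  | mem : NTerm → ℕ → Fml
  | neg : Fml → Fml
  | and : Fml → Fml → Fml
  | ball : NTerm → Fml → Fml
  | allN : Fml → Fml
  | allS : Fml → Fml

namespace Fml

/-- `∃ x, φ`. -/
def exN (φ : Fml) : Fml := neg (allN (neg φ))

/-- `Σ⁰₀` formulas: all quantifiers are bounded number quantifiers. -/
def Bounded : Fml → Prop
  | eq _ _ => True
  | lt _ _ => True
  | mem _ _ => True
  | neg φ => Bounded φ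
  | and φ ψ => Bounded φ ∧ Bounded ψ
  | ball _ φ => Bounded φ
  | allN _ => False
  | allS _ => False

/-- Arithmetical formulas: no set quantifiers. -/
def Arithmetical : Fml → Prop
  | eq _ _ => True
  | lt _ _ => True
  | mem _ _ => True
  | neg φ => Arithmetical φ
  | and φ ψ => Arithmetical φ ∧ Arithmetical ψ
  | ball _ φ => Arithmetical φ
  | allN φ => Arithmetical φ
  | allS _ => False

def IsSigma01 (φ : Fml) : Prop := ∃ θ : Fml, θ.Bounded ∧ φ = exN θ

def IsPi01 (φ : Fml) : Prop := ∃ θ : Fml, θ.Bounded ∧ φ = allN θ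

def IsPi11 (φ : Fml) : Prop := ∃ θ : Fml, θ.Arithmetical ∧ φ = allS θ

end Fml

/-- Extend an assignment by a new value for the variable with index `0`. -/
def push {α : Type u} (a : α) (e : ℕ → α) : ℕ → α
  | 0 => a
  | n + 1 => e n

section Model

variable {M : Type u} [Zero M] [One M] [Add M] [Mul M] [LT M]

def NTerm.val (e : ℕ → M) : NTerm → M
  | .var n => e n
  | .zero => 0
  | .one => 1
  | .add s t => s.val e + t.val e
  | .mul s t => s.val e * t.val e

/-- Satisfaction in `(M, S)` under assignments `e` (numbers) and `E` (sets). -/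
def Sat (S : Set (Set M)) : Fml → (ℕ → M) → (ℕ → Set M) → Prop
  | .eq s t, e, _ => s.val e = t.val e
  | .lt s t, e, _ => s.val e < t.val e
  | .mem t X, e, E => t.val e ∈ E X
  | .neg φ, e, E => ¬ Sat S φ e E
  | .and φ ψ, e, E => Sat S φ e E ∧ Sat S ψ e E
  | .ball t φ, e, E => ∀ x : M, x < t.val e → Sat S φ (push x e) E
  | .allN φ, e, E => ∀ x : M, Sat S φ (push x e) E
  | .allS φ, e, E => ∀ X ∈ S, Sat S φ e (push X E)

/-- `(M, S)` is a model of `RCA₀`: the basic axioms, `Σ⁰₁` induction and `Δ⁰₁` comprehension,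
the last two with arbitrary number and set parameters from the structure. -/
structure RCA0 (S : Set (Set M)) : Prop where
  sets_nonempty : S.Nonempty
  add_one_ne_zero : ∀ n : M, n + 1 ≠ 0
  add_one_inj : ∀ m n : M, m + 1 = n + 1 → m = n
  add_zero' : ∀ m : M, m + 0 = m
  add_succ' : ∀ m n : M, m + (n + 1) = (m + n) + 1
  mul_zero' : ∀ m : M, m * 0 = 0
  mul_succ' : ∀ m n : M, m * (n + 1) = m * n + m
  not_lt_zero' : ∀ m : M, ¬ m < 0
  lt_succ' : ∀ m n : M, m < n + 1 ↔ (m < n ∨ m = n)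
  sigma01_induction : ∀ φ : Fml, φ.IsSigma01 → ∀ (e : ℕ → M) (E : ℕ → Set M), (∀ i, E i ∈ S) →
    Sat S φ (push 0 e) E →
    (∀ n : M, Sat S φ (push n e) E → Sat S φ (push (n + 1) e) E) →
    ∀ n : M, Sat S φ (push n e) E
  delta01_comprehension : ∀ φ ψ : Fml, φ.IsSigma01 → ψ.IsPi01 →
    ∀ (e : ℕ → M) (E : ℕ → Set M), (∀ i, E i ∈ S) →
    (∀ n : M, Sat S φ (push n e) E ↔ Sat S ψ (push n e) E) →
    {n : M | Sat S φ (push n e) E} ∈ S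

/-- `(M, S)` is a model of `Π¹₁-CA₀`. -/
structure Pi11CA0 (S : Set (Set M)) : Prop extends RCA0 S where
  pi11_comprehension : ∀ φ : Fml, φ.IsPi11 →
    ∀ (e : ℕ → M) (E : ℕ → Set M), (∀ i, E i ∈ S) →
    {n : M | Sat S φ (push n e) E} ∈ S

/-! ### Coding of pairs, finite sets and functions -/

def pair (i j : M) : M := (i + j) * (i + j) + i

/-- `i` belongs to the finite set coded by `c`.  The code `(k, (m, n))` stands for
`{i < k : m(i+1)+1 divides n}`; in `RCA₀` every finite set has a code of this form.
A number that is not such a triple stands for `∅`. -/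
def FinMem (i c : M) : Prop :=
  ∃ k m n : M, c = pair k (pair m n) ∧ i < k ∧ ∃ t : M, n = (m * (i + 1) + 1) * t

def FinSub (c c' : M) : Prop := ∀ i : M, FinMem i c → FinMem i c'

/-- The function `f` is an element of the structure (its graph is). -/
def IsFun (S : Set (Set M)) (f : M → M) : Prop := {z : M | ∃ i : M, z = pair i (f i)} ∈ S

/-! ### Coded countably based spaces and continuous maps -/

/-- A countably based space: its points are certain functions of the structure, `eqv` is
equality of points, `basis` is the set of codes of basic open sets and `mem x w` says that
`x` lies in the basic open set coded by `w`.  Only the three kinds of spaces defined below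
are ever used. -/
structure Space (M : Type u) where
  pt : (M → M) → Prop
  eqv : (M → M) → (M → M) → Prop
  basis : Set M
  mem : (M → M) → M → Prop

def Space.Nonempty (X : Space M) : Prop := ∃ x : M → M, X.pt x

/-- `f(x) = y`, where `f` is the map from `X` to `Y` coded by the set `Φ` of triples
`(n, V, U)` with `V` a basic open set of `Y` and `U` a basic open set of `X`. -/
def MapsTo (X Y : Space M) (Φ : Set M) (x y : M → M) : Prop :=
  ∀ V ∈ Y.basis, ((∃ n U : M, U ∈ X.basis ∧ pair n (pair V U) ∈ Φ ∧ X.mem x U) ↔ Y.mem y V)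

def IsTotal (X Y : Space M) (Φ : Set M) : Prop :=
  ∀ x : M → M, X.pt x → ∃ y : M → M, Y.pt y ∧ MapsTo X Y Φ x y

/-- There are, in the structure, codes of total continuous maps `X → Y` and `Y → X` that are
inverse to each other. -/
def Homeomorphic (S : Set (Set M)) (X Y : Space M) : Prop :=
  ∃ Φ ∈ S, ∃ Ψ ∈ S, IsTotal X Y Φ ∧ IsTotal Y X Ψ ∧
    (∀ x y x' : M → M, X.pt x → Y.pt y → X.pt x' →
      MapsTo X Y Φ x y → MapsTo Y X Ψ y x' → X.eqv x' x) ∧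
    (∀ y x y' : M → M, Y.pt y → X.pt x → Y.pt y' →
      MapsTo Y X Ψ y x → MapsTo X Y Φ x y' → Y.eqv y' y)

/-! ### Spaces of unbounded filters -/

/-- A (countable) poset: a set of numbers with a preorder, both in the structure;
`rel` is the set of pairs `(p, q)` with `p ≤ q`. -/
structure PosetCode (S : Set (Set M)) where
  carrier : Set M
  rel : Set M
  carrier_mem : carrier ∈ S
  rel_mem : rel ∈ S
  refl : ∀ p ∈ carrier, pair p p ∈ rel
  trans : ∀ p ∈ carrier, ∀ q ∈ carrier, ∀ r ∈ carrier,
    pair p q ∈ rel → pair q r ∈ rel → pair p r ∈ rel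

namespace PosetCode

variable {S : Set (Set M)} (P : PosetCode S)

def Le (p q : M) : Prop := pair p q ∈ P.rel

def Lt (p q : M) : Prop := P.Le p q ∧ ¬ P.Le q p

/-- `p` belongs to the filter generated by the decreasing sequence `x`. -/
def InFilter (x : M → M) (p : M) : Prop := p ∈ P.carrier ∧ ∃ i : M, P.Le (x i) p

/-- The space `UF(P)` of unbounded filters on `P`.  Filters are represented by decreasing
sequences generating them. -/
def UF : Space M where
  pt x := IsFun S x ∧ (∀ i : M, x i ∈ P.carrier) ∧ (∀ i : M, P.Le (x (i + 1)) (x i)) ∧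
    ¬ ∃ r ∈ P.carrier, ∀ p : M, P.InFilter x p → P.Lt r p
  eqv x y := (∀ i : M, ∃ j : M, P.Le (y j) (x i)) ∧ (∀ j : M, ∃ i : M, P.Le (x i) (y j))
  basis := P.carrier
  mem x p := P.InFilter x p

end PosetCode

/-! ### The space `P(ℕ)` and its `Π⁰₂`-subspaces -/

/-- The space `P(ℕ)`.  A point is an increasing sequence `q₀ ⊆ q₁ ⊆ ⋯` of (codes of) finite
sets with `qᵢ ⊆ {0, …, i}`, standing for the union of the `qᵢ`.  The basic open sets are
`N_p = {x : p ⊆ x}` for finite sets `p`. -/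
def powerSpace (S : Set (Set M)) : Space M where
  pt q := IsFun S q ∧ (∀ i n : M, FinMem n (q i) → n < i + 1) ∧
    (∀ i j : M, i < j → FinSub (q i) (q j))
  eqv q q' := ∀ n : M, (∃ i : M, FinMem n (q i)) ↔ (∃ i : M, FinMem n (q' i))
  basis := Set.univ
  mem q p := ∃ i : M, FinSub p (q i)

/-- A code of a `Π⁰₂`-subspace `⋂ᵢ (Aᵢ ∪ Bᵢ)` of `P(ℕ)`: the open set `Bᵢ` is the union of the
`N_p` with `(i, (n, p)) ∈ op` for some `n`, and the closed set `Aᵢ` is the complement of the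
union of the `N_p` with `(i, (n, p)) ∈ cl` for some `n`. -/
structure Pi02Code (S : Set (Set M)) where
  op : Set M
  cl : Set M
  op_mem : op ∈ S
  cl_mem : cl ∈ S

namespace Pi02Code

variable {S : Set (Set M)} (C : Pi02Code S)

def InOpen (i : M) (x : M → M) : Prop :=
  ∃ n p : M, pair i (pair n p) ∈ C.op ∧ (powerSpace S).mem x p

def InClosed (i : M) (x : M → M) : Prop :=
  ¬ ∃ n p : M, pair i (pair n p) ∈ C.cl ∧ (powerSpace S).mem x p

def space : Space M where
  pt x := (powerSpace S).pt x ∧ ∀ i : M, C.InClosed i x ∨ C.InOpen i x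
  eqv := (powerSpace S).eqv
  basis := (powerSpace S).basis
  mem := (powerSpace S).mem

end Pi02Code

/-! ### Rational and real numbers -/

/-- The rational number `(pos - neg) / (den + 1)`. -/
structure Rat0 (M : Type u) where
  pos : M
  neg : M
  den : M

namespace Rat0

def zero : Rat0 M := ⟨0, 0, 0⟩

def add (q r : Rat0 M) : Rat0 M :=
  ⟨q.pos * (r.den + 1) + r.pos * (q.den + 1), q.neg * (r.den + 1) + r.neg * (q.den + 1),
    q.den * r.den + q.den + r.den⟩

def Lt (q r : Rat0 M) : Prop :=
  q.pos * (r.den + 1) + r.neg * (q.den + 1) < r.pos * (q.den + 1) + q.neg * (r.den + 1)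

def Le (q r : Rat0 M) : Prop := ¬ r.Lt q

def code (q : Rat0 M) : M := pair (pair q.pos q.neg) q.den

end Rat0

/-- `y = 2 ^ k`, exponentiation being defined by primitive recursion in the structure. -/
def IsTwoPow (S : Set (Set M)) (k y : M) : Prop :=
  ∃ f : M → M, IsFun S f ∧ f 0 = 1 ∧ (∀ n : M, f (n + 1) = f n + f n) ∧ f k = y

/-- `h = 2 ^ (-k)`. -/
def IsHalfPow (S : Set (Set M)) (k : M) (h : Rat0 M) : Prop :=
  ∃ y : M, IsTwoPow S k (y + 1) ∧ h = ⟨1, 0, y⟩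

/-- A real number is a sequence of rationals with `|u k - u (k + i)| ≤ 2 ^ (-k)`. -/
def IsReal (S : Set (Set M)) (u : M → Rat0 M) : Prop :=
  ∀ (k i : M) (h : Rat0 M), IsHalfPow S k h →
    (u k).Le ((u (k + i)).add h) ∧ (u (k + i)).Le ((u k).add h)

/-- `u ≤ v` as reals: `u k ≤ v k + 2 ^ (-k + 1)` for all `k`. -/
def RealLe (S : Set (Set M)) (u v : M → Rat0 M) : Prop :=
  ∀ (k : M) (h : Rat0 M), IsHalfPow S k h → (u k).Le ((v k).add (h.add h))

/-- `u < v` as reals: `u k + 2 ^ (-k + 1) < v k` for some `k`. -/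
def RealLt (S : Set (Set M)) (u v : M → Rat0 M) : Prop :=
  ∃ (k : M) (h : Rat0 M), IsHalfPow S k h ∧ ((u k).add (h.add h)).Lt (v k)

def RealEq (S : Set (Set M)) (u v : M → Rat0 M) : Prop := RealLe S u v ∧ RealLe S v u

def realAdd (u v : M → Rat0 M) : M → Rat0 M := fun k => (u (k + 1)).add (v (k + 1))

def realConst (q : Rat0 M) : M → Rat0 M := fun _ => q

/-! ### Quasi-Polish spaces -/

/-- A code `(A, d)` of a separable (bicomplete) quasi-metric space: `A` is a nonempty set and
`d` is a pseudo-quasi-metric on `A` with real values, both in the structure;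
`d a b k` is the `k`-th rational approximation of `d(a, b)`. -/
structure QMetCode (S : Set (Set M)) where
  A : Set M
  d : M → M → M → Rat0 M
  A_mem : A ∈ S
  d_mem : {z : M | ∃ a b k : M, z = pair (pair (pair a b) k) (d a b k).code} ∈ S
  A_nonempty : A.Nonempty
  d_real : ∀ a ∈ A, ∀ b ∈ A, IsReal S (d a b)
  d_nonneg : ∀ a ∈ A, ∀ b ∈ A, RealLe S (realConst Rat0.zero) (d a b)
  d_self : ∀ a ∈ A, RealEq S (d a a) (realConst Rat0.zero)
  d_triangle : ∀ a ∈ A, ∀ b ∈ A, ∀ c ∈ A, RealLe S (d a c) (realAdd (d a b) (d b c))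

namespace QMetCode

variable {S : Set (Set M)} (X : QMetCode S)

/-- The real number `d(x, y) = lim d(xₙ, yₙ)`.  The shift by two makes it a real number in the
sense of `IsReal`, when `x` and `y` are points. -/
def dist (x y : M → M) : M → Rat0 M :=
  fun k => X.d (x (k + 1 + 1)) (y (k + 1 + 1)) (k + 1 + 1)

/-- The space `X_A`.  Points are the sequences in `A` with
`max (d(aₙ, aₘ)) (d(aₘ, aₙ)) < 2 ^ (-n)` for `n < m`; the basic open sets are the balls
`{y : d(a, y) < r}` with `a ∈ A` and `r` a positive rational. -/
def space : Space M where
  pt x := IsFun S x ∧ (∀ n : M, x n ∈ X.A) ∧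
    ∀ (n m : M) (h : Rat0 M), n < m → IsHalfPow S n h →
      RealLt S (X.d (x n) (x m)) (realConst h) ∧ RealLt S (X.d (x m) (x n)) (realConst h)
  eqv x y := RealEq S (X.dist x y) (realConst Rat0.zero) ∧
    RealEq S (X.dist y x) (realConst Rat0.zero)
  basis := {w : M | ∃ (a : M) (r : Rat0 M), w = pair a r.code ∧ a ∈ X.A ∧ Rat0.zero.Lt r}
  mem y w := ∃ (a : M) (r : Rat0 M), w = pair a r.code ∧ a ∈ X.A ∧ Rat0.zero.Lt r ∧
    RealLt S (X.dist (fun _ => a) y) (realConst r)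

/-- Every effective left-Cauchy sequence `a` in `A` has a point `b` of `X_A` with
`d(aₙ₊₁, bₙ₊₁) < 2 ^ (-n)` for all `n` and `lim d(bₙ, aₙ) = 0`. -/
def SmythComplete : Prop :=
  ∀ a : M → M, IsFun S a → (∀ n : M, a n ∈ X.A) →
    (∀ (n m : M) (h : Rat0 M), 0 < n → n < m → IsHalfPow S n h →
      RealLt S (X.d (a n) (a m)) (realConst h)) →
    ∃ b : M → M, X.space.pt b ∧
      (∀ (n : M) (h : Rat0 M), IsHalfPow S n h →
        RealLt S (X.d (a (n + 1)) (b (n + 1))) (realConst h)) ∧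
      (∀ ε : Rat0 M, Rat0.zero.Lt ε →
        ∃ N : M, ∀ n : M, N < n → RealLt S (X.d (b n) (a n)) (realConst ε))

end QMetCode

end Model

end SOA

/-!
Fix a model `(M, S)` of `RCA₀`. Its numbers form an ordered semiring (`RCA0.nums`), finite sets have
codes (`exists_code`), and functions can be defined by primitive recursion (`exists_primrec`) and by
unbounded search (`exists_search`). That a set or the graph of a function belongs to `S` is
expressed by the classes `Dec` and `Rec`, so that most instances of comprehension are found by
instance search on the defining formula.

**The statements about spaces imply `Π¹₁-CA₀`.** Each of them yields `Hub S`: for every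
`Π⁰₂`-subspace `C` of `P(ℕ)`, the finite sets `c` whose basic open set meets `C` form a `Σ⁰₁` set of
the model. In a UF space every basic open set is nonempty, because a filter through a given element
can be built greedily (`PosetCode.exists_unboundedFilter`); in a quasi-metric space it contains its
center. If `C` is homeomorphic to such a space, then `N_c` meets `C` exactly if the code of the map
onto `C` sends some basic open set into `N_c`, which is a `Σ⁰₁` condition (`exists_hub_set`). For
the statement on UF spaces and quasi-Polish spaces, consider the poset of finite attempts to
construct a point of `C` in `N_c`, with additional dummies, some of which are below any given
attempt. The dummies alone generate an unbounded filter, and there is an unbounded filter avoiding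
them exactly if `N_c` meets `C`. In a quasi-metric, the existence of a second point, different from
the filter of the dummies, is witnessed by a positive distance between two centers of balls, again a
`Σ⁰₁` condition (`PathWitness`, `hub_of_UF_quasiPolish`).

`Hub S` in turn implies arithmetical comprehension (`Hub.aca`), for which a very simple `C`
suffices, and then `Π¹₁` comprehension (`Hub.pi11CA0`): a formula `∃ X ¬ θ(n, X)` with `θ`
arithmetical holds if and only if there is a Hintikka set containing the assertion `¬ θ(n, X)`,
and the Hintikka sets form a `Π⁰₂`-subspace of `P(ℕ)` (`hasHintikka_sat`), since each of their
closure conditions has the form "if this assertion is in `H`, then one of those is".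

**`Π¹₁-CA₀` implies the statements.** By comprehension, the finite initial segments of elements of
`C` form a set, and so every `Π⁰₂`-subspace `C` has a dense sequence of elements `D t`
(`Pi11CA0.exists_dense`). A space is *presented* by `C` (`Presents`) if its points correspond to the
elements of `C` and the topologies can be computed from each other; spaces presented by the same
code are homeomorphic. Besides the subspace itself, `C` presents a UF space, of the poset of finite
subsets of the sets `D t` which satisfy the clauses of `C` up to a stage (`presents_stagePoset`),
and, if `C` is nonempty, a quasi-Polish space on the indices `t` (`IsMatchMetric.presents`). Its
distance `d(s, t)` is small if `D t` contains the elements of `D s` below a large number and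
satisfies the clauses of `C` that apply to `D s` with witnesses no larger than those of `D s`
(`Match`). The bound on the witnesses makes the limit of a sequence which is Cauchy in the forward
direction only an element of `C`; this is Smyth-completeness (`IsMatchMetric.smythComplete`).
Finally every UF space is presented by a `Π⁰₂` code, because being an unbounded filter is a `Π⁰₂`
condition (`PosetCode.exists_filterCode`), so it is homeomorphic to a quasi-Polish space as well.
-/

-- Instance search follows the structure of the defining formulas, which can be large.
set_option synthInstance.maxSize 100000
set_option synthInstance.maxHeartbeats 200000
set_option linter.style.haveILetI false
set_option linter.unusedSectionVars false

namespace SOA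

universe u

/-! ### Arithmetic in a model of `RCA₀` -/

section Arithmetic

variable {M : Type u} [Zero M] [One M] [Add M] [Mul M] [LT M] {S : Set (Set M)}

theorem sat_exN (φ : Fml) (e : ℕ → M) (E : ℕ → Set M) :
    Sat S (Fml.exN φ) e E ↔ ∃ x : M, Sat S φ (push x e) E := by
  simp [Fml.exN, Sat]

namespace RCA0

/-- `Σ⁰₁` induction for a predicate given by a bounded formula `θ`, in which the quantified variable
has the index `0` and the induction variable the index `1`. -/
theorem induction_sat (hS : RCA0 S) (θ : Fml) (hθ : θ.Bounded) (e : ℕ → M) (E : ℕ → Set M)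
    (hE : ∀ i, E i ∈ S) {p : M → Prop}
    (hp : ∀ n, p n ↔ ∃ m, Sat S θ (push m (push n e)) E) (h0 : p 0)
    (hs : ∀ n, p n → p (n + 1)) (n : M) : p n := by
  have := hS.sigma01_induction (Fml.exN θ) ⟨θ, hθ, rfl⟩ e E hE
  simp only [sat_exN, ← hp] at this
  exact this h0 hs n

/-- Induction for bounded formulas without set parameters; the induction variable is the
variable with index `1`. -/
theorem induction_open (hS : RCA0 S) (θ : Fml) (hθ : θ.Bounded) (e : ℕ → M) {p : M → Prop}
    (hp : ∀ n, p n ↔ ∃ m, Sat S θ (push m (push n e)) (fun _ => hS.sets_nonempty.some)) (h0 : p 0)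
    (hs : ∀ n, p n → p (n + 1)) (n : M) : p n :=
  hS.induction_sat θ hθ e _ (fun _ => hS.sets_nonempty.some_mem) hp h0 hs n

open NTerm Fml

theorem zero_add' (hS : RCA0 S) (n : M) : 0 + n = n := by
  refine hS.induction_open (p := fun n => 0 + n = n) (.eq (.add .zero (.var 1)) (.var 1)) trivial
    (fun _ => 0) (fun n => ?_) ?_ ?_ n
  · simp [Sat, NTerm.val, push]
  · exact hS.add_zero' 0
  · intro n hn
    rw [hS.add_succ', hn]

theorem succ_add' (hS : RCA0 S) (m n : M) : m + 1 + n = m + n + 1 := by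
  refine hS.induction_open (p := fun n => m + 1 + n = m + n + 1)
    (.eq (.add (.add (.var 2) .one) (.var 1)) (.add (.add (.var 2) (.var 1)) .one)) trivial
    (fun _ => m) (fun n => ?_) ?_ ?_ n
  · simp [Sat, NTerm.val, push]
  · rw [hS.add_zero', hS.add_zero']
  · intro n hn
    rw [hS.add_succ', hn, hS.add_succ']

theorem add_comm' (hS : RCA0 S) (m n : M) : m + n = n + m := by
  refine hS.induction_open (p := fun n => m + n = n + m)
    (.eq (.add (.var 2) (.var 1)) (.add (.var 1) (.var 2))) trivial
    (fun _ => m) (fun n => ?_) ?_ ?_ n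
  · simp [Sat, NTerm.val, push]
  · rw [hS.add_zero', hS.zero_add']
  · intro n hn
    rw [hS.add_succ', hn, hS.succ_add']

theorem add_assoc' (hS : RCA0 S) (k m n : M) : k + m + n = k + (m + n) := by
  refine hS.induction_open (p := fun n => k + m + n = k + (m + n))
    (.eq (.add (.add (.var 2) (.var 3)) (.var 1)) (.add (.var 2) (.add (.var 3) (.var 1)))) trivial
    (push k fun _ => m) (fun n => ?_) ?_ ?_ n
  · simp [Sat, NTerm.val, push]
  · rw [hS.add_zero', hS.add_zero']
  · intro n hn
    rw [hS.add_succ', hn, hS.add_succ', hS.add_succ']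

theorem mul_add' (hS : RCA0 S) (k m n : M) : k * (m + n) = k * m + k * n := by
  refine hS.induction_open (p := fun n => k * (m + n) = k * m + k * n)
    (.eq (.mul (.var 2) (.add (.var 3) (.var 1)))
      (.add (.mul (.var 2) (.var 3)) (.mul (.var 2) (.var 1)))) trivial
    (push k fun _ => m) (fun n => ?_) ?_ ?_ n
  · simp [Sat, NTerm.val, push]
  · rw [hS.add_zero', hS.mul_zero', hS.add_zero']
  · intro n hn
    rw [hS.add_succ', hS.mul_succ', hn, hS.mul_succ', hS.add_assoc']

theorem mul_assoc' (hS : RCA0 S) (k m n : M) : k * m * n = k * (m * n) := by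
  refine hS.induction_open (p := fun n => k * m * n = k * (m * n))
    (.eq (.mul (.mul (.var 2) (.var 3)) (.var 1)) (.mul (.var 2) (.mul (.var 3) (.var 1)))) trivial
    (push k fun _ => m) (fun n => ?_) ?_ ?_ n
  · simp [Sat, NTerm.val, push]
  · simp only [hS.mul_zero']
  · intro n hn
    rw [hS.mul_succ', hn, hS.mul_succ', hS.mul_add']

theorem zero_mul' (hS : RCA0 S) (n : M) : 0 * n = 0 := by
  refine hS.induction_open (p := fun n => 0 * n = 0) (.eq (.mul .zero (.var 1)) .zero) trivial
    (fun _ => 0) (fun n => ?_) (hS.mul_zero' 0) ?_ n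
  · simp [Sat, NTerm.val, push]
  · intro n hn
    rw [hS.mul_succ', hn, hS.add_zero']

theorem one_mul' (hS : RCA0 S) (n : M) : 1 * n = n := by
  refine hS.induction_open (p := fun n => 1 * n = n) (.eq (.mul .one (.var 1)) (.var 1)) trivial
    (fun _ => 0) (fun n => ?_) (hS.mul_zero' 1) ?_ n
  · simp [Sat, NTerm.val, push]
  · intro n hn
    rw [hS.mul_succ', hn]

theorem succ_mul' (hS : RCA0 S) (m n : M) : (m + 1) * n = m * n + n := by
  refine hS.induction_open (p := fun n => (m + 1) * n = m * n + n)
    (.eq (.mul (.add (.var 2) .one) (.var 1)) (.add (.mul (.var 2) (.var 1)) (.var 1))) trivial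
    (fun _ => m) (fun n => ?_) ?_ ?_ n
  · simp [Sat, NTerm.val, push]
  · simp only [hS.mul_zero', hS.add_zero']
  · intro n hn
    rw [hS.mul_succ', hn, hS.mul_succ', hS.add_assoc', hS.add_assoc', hS.add_comm' m (n + 1),
      hS.succ_add', hS.add_comm' n (m + 1), hS.succ_add', hS.add_comm' n m]

theorem mul_comm' (hS : RCA0 S) (m n : M) : m * n = n * m := by
  refine hS.induction_open (p := fun n => m * n = n * m)
    (.eq (.mul (.var 2) (.var 1)) (.mul (.var 1) (.var 2))) trivial
    (fun _ => m) (fun n => ?_) ?_ ?_ n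
  · simp [Sat, NTerm.val, push]
  · rw [hS.mul_zero', hS.zero_mul']
  · intro n hn
    rw [hS.mul_succ', hn, hS.succ_mul']

theorem add_right_cancel' (hS : RCA0 S) (k m n : M) (h : k + n = m + n) : k = m := by
  refine hS.induction_open (p := fun n => k + n = m + n → k = m)
    (.neg (.and (.eq (.add (.var 2) (.var 1)) (.add (.var 3) (.var 1)))
      (.neg (.eq (.var 2) (.var 3))))) (by simp [Fml.Bounded])
    (push k fun _ => m) (fun n => ?_) ?_ ?_ n h
  · simp [Sat, NTerm.val, push]
  · simp only [hS.add_zero', imp_self]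
  · intro n hn h
    rw [hS.add_succ', hS.add_succ'] at h
    exact hn (hS.add_one_inj _ _ h)

theorem eq_zero_or_succ (hS : RCA0 S) (n : M) : n = 0 ∨ ∃ m, n = m + 1 := by
  refine hS.induction_open (p := fun n => n = 0 ∨ ∃ m, n = m + 1)
    (.neg (.and (.neg (.eq (.var 1) .zero)) (.neg (.eq (.var 1) (.add (.var 0) .one)))))
    (by simp [Fml.Bounded])
    (fun _ => 0) (fun n => ?_) (Or.inl rfl) (fun n _ => Or.inr ⟨n, rfl⟩) n
  simp only [Sat, NTerm.val, push]
  constructor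
  · rintro (h | ⟨m, h⟩)
    · exact ⟨0, fun h' => h'.1 h⟩
    · exact ⟨m, fun h' => h'.2 h⟩
  · rintro ⟨m, h⟩
    by_contra h'
    rw [not_or] at h'
    exact h ⟨h'.1, fun h'' => h'.2 ⟨m, h''⟩⟩

theorem lt_add_succ (hS : RCA0 S) (m c : M) : m < m + (c + 1) := by
  refine hS.induction_open (p := fun c => m < m + (c + 1))
    (.lt (.var 2) (.add (.var 2) (.add (.var 1) .one))) trivial
    (fun _ => m) (fun n => ?_) ?_ ?_ c
  · simp [Sat, NTerm.val, push]
  · rw [hS.add_succ', hS.add_zero', hS.lt_succ']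
    exact Or.inr rfl
  · intro c hc
    rw [hS.add_succ', hS.lt_succ']
    exact Or.inl hc

theorem lt_iff_exists (hS : RCA0 S) (m n : M) : m < n ↔ ∃ c, n = m + (c + 1) := by
  constructor
  · refine hS.induction_open (p := fun n => m < n → ∃ c, n = m + (c + 1))
      (.neg (.and (.lt (.var 2) (.var 1))
        (.neg (.eq (.var 1) (.add (.var 2) (.add (.var 0) .one)))))) (by simp [Fml.Bounded])
      (fun _ => m) (fun n => ?_) (fun h => (hS.not_lt_zero' _ h).elim) ?_ n
    · simp only [Sat, NTerm.val, push]
      constructor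
      · intro h
        by_cases hm : m < n
        · obtain ⟨c, hc⟩ := h hm
          exact ⟨c, fun h' => h'.2 hc⟩
        · exact ⟨0, fun h' => hm h'.1⟩
      · rintro ⟨c, hc⟩ hm
        exact ⟨c, not_not.1 fun h => hc ⟨hm, h⟩⟩
    · intro n hn h
      rcases (hS.lt_succ' _ _).1 h with h | h
      · obtain ⟨c, hc⟩ := hn h
        exact ⟨c + 1, by rw [hc, ← hS.add_succ']⟩
      · exact ⟨0, by rw [h, hS.zero_add']⟩
  · rintro ⟨c, rfl⟩
    exact hS.lt_add_succ m c

theorem lt_irrefl' (hS : RCA0 S) (n : M) : ¬ n < n := by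
  rw [hS.lt_iff_exists]
  rintro ⟨c, hc⟩
  refine hS.add_one_ne_zero c (hS.add_right_cancel' _ _ n ?_).symm
  rw [hS.zero_add', hS.add_comm' _ n]
  exact hc

theorem lt_trans' (hS : RCA0 S) {k m n : M} (h : k < m) (h' : m < n) : k < n := by
  rw [hS.lt_iff_exists] at *
  obtain ⟨c, rfl⟩ := h
  obtain ⟨d, rfl⟩ := h'
  exact ⟨c + 1 + d, by rw [hS.add_assoc', ← hS.add_assoc' (c + 1) d 1]⟩

theorem trichotomy (hS : RCA0 S) (m n : M) : m < n ∨ m = n ∨ n < m := by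
  have key : ∃ c, n = m + c ∨ m = n + c := by
    refine hS.induction_open (p := fun n => ∃ c, n = m + c ∨ m = n + c)
      (.neg (.and (.neg (.eq (.var 1) (.add (.var 2) (.var 0))))
        (.neg (.eq (.var 2) (.add (.var 1) (.var 0)))))) (by simp [Fml.Bounded])
      (fun _ => m) (fun n => ?_) ⟨m, Or.inr (hS.zero_add' m).symm⟩ ?_ n
    · simp only [Sat, NTerm.val, push, not_and_or, not_not]
    · rintro n ⟨c, h | h⟩
      · exact ⟨c + 1, Or.inl (by rw [h, hS.add_succ'])⟩
      · rcases hS.eq_zero_or_succ c with rfl | ⟨d, rfl⟩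
        · exact ⟨1, Or.inl (by rw [h, hS.add_zero'])⟩
        · exact ⟨d, Or.inr (by rw [h, hS.add_succ', hS.succ_add'])⟩
  rw [hS.lt_iff_exists, hS.lt_iff_exists n m]
  obtain ⟨c, h⟩ := key
  rcases hS.eq_zero_or_succ c with rfl | ⟨d, rfl⟩
  · rw [hS.add_zero', hS.add_zero'] at h
    exact Or.inr (Or.inl (h.elim Eq.symm id))
  · rcases h with h | h
    · exact Or.inl ⟨d, h⟩
    · exact Or.inr (Or.inr ⟨d, h⟩)

/-- The numbers of a model of `RCA₀` form a commutative semiring. -/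
abbrev commSemiring (hS : RCA0 S) : CommSemiring M where
  add_assoc := hS.add_assoc'
  zero_add := hS.zero_add'
  add_zero := hS.add_zero'
  nsmul := nsmulRec
  add_comm := hS.add_comm'
  left_distrib := hS.mul_add'
  right_distrib a b c := by
    rw [hS.mul_comm', hS.mul_add', hS.mul_comm' c a, hS.mul_comm' c b]
  zero_mul := hS.zero_mul'
  mul_zero := hS.mul_zero'
  mul_assoc := hS.mul_assoc'
  one_mul := hS.one_mul'
  mul_one a := by rw [hS.mul_comm', hS.one_mul']
  mul_comm := hS.mul_comm'

open Classical in
/-- The numbers of a model of `RCA₀` are linearly ordered. -/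
noncomputable abbrev linearOrder (hS : RCA0 S) : LinearOrder M where
  le a b := ¬ b < a
  lt := (· < ·)
  le_refl := hS.lt_irrefl'
  le_trans a b c hab hbc hca := by
    rcases hS.trichotomy a b with h | rfl | h
    · exact hbc (hS.lt_trans' hca h)
    · exact hbc hca
    · exact hab h
  lt_iff_le_not_ge a b :=
    ⟨fun h => ⟨fun h' => hS.lt_irrefl' _ (hS.lt_trans' h h'), fun h' => h' h⟩,
      fun h => not_not.1 h.2⟩
  le_antisymm a b hab hba := by
    rcases hS.trichotomy a b with h | h | h
    · exact (hba h).elim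
    · exact h
    · exact (hab h).elim
  le_total a b := by
    rw [← not_and_or]
    exact fun h => hS.lt_irrefl' _ (hS.lt_trans' h.1 h.2)
  toDecidableLE := Classical.decRel _

theorem isStrictOrderedRing (hS : RCA0 S) :
    letI := hS.commSemiring
    letI := hS.linearOrder
    IsStrictOrderedRing M := by
  letI := hS.commSemiring
  letI := hS.linearOrder
  have hlt : ∀ a b c : M, b < c → a + b < a + c := by
    intro a b c h
    obtain ⟨d, rfl⟩ := (hS.lt_iff_exists b c).1 h
    exact (hS.lt_iff_exists _ _).2 ⟨d, (add_assoc _ _ _).symm⟩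
  have hle : ∀ a b c : M, b ≤ c → a + b ≤ a + c := by
    intro a b c h
    rcases h.lt_or_eq with h | rfl
    · exact (hlt a b c h).le
    · exact le_rfl
  have hnt : (0 : M) ≠ 1 := by
    intro h
    have := hS.add_one_ne_zero 0
    rw [← h, hS.add_zero'] at this
    exact this rfl
  haveI : Nontrivial M := ⟨⟨0, 1, hnt⟩⟩
  haveI : IsOrderedCancelAddMonoid M :=
    { add_le_add_left := fun a b h c => by
        rw [add_comm a, add_comm b]
        exact hle c a b h
      le_of_add_le_add_left := fun a b c h => by
        by_contra h'
        exact not_lt_of_ge h (hlt a c b (not_le.1 h')) }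
  haveI : ZeroLEOneClass M := ⟨not_lt.1 (hS.not_lt_zero' 1)⟩
  have hmul : ∀ a b c : M, 0 < a → b < c → a * b < a * c := by
    intro a b c ha h
    obtain ⟨d, rfl⟩ := (hS.lt_iff_exists 0 a).1 ha
    obtain ⟨d', rfl⟩ := (hS.lt_iff_exists b c).1 h
    exact (hS.lt_iff_exists _ _).2 ⟨d * (d' + 1) + d', by ring⟩
  exact
    { mul_lt_mul_of_pos_left := fun a ha b c h => hmul a b c ha h
      mul_lt_mul_of_pos_right := fun a ha b c h => by
        change b * a < c * a
        rw [mul_comm b, mul_comm c]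
        exact hmul a b c ha h }

theorem canonicallyOrderedAdd (hS : RCA0 S) :
    letI := hS.commSemiring
    letI := hS.linearOrder
    CanonicallyOrderedAdd M := by
  letI := hS.commSemiring
  letI := hS.linearOrder
  haveI := hS.isStrictOrderedRing
  refine { exists_add_of_le := fun {a b} h => ?_, le_add_self := fun a b => ?_,
           le_self_add := fun a b => ?_ }
  · rcases h.lt_or_eq with h | rfl
    · obtain ⟨c, hc⟩ := (hS.lt_iff_exists _ _).1 h
      exact ⟨c + 1, hc⟩
    · exact ⟨0, (add_zero _).symm⟩
  · exact le_add_of_nonneg_left (not_lt.1 (hS.not_lt_zero' _))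
  · exact le_add_of_nonneg_right (not_lt.1 (hS.not_lt_zero' _))

end RCA0

end Arithmetic

/-! ### Decidable sets and functions of the structure -/

section Coding

/-- The algebraic and order structure carried by the numbers of a model of `RCA₀`: a discretely
ordered semiring in which smaller numbers can be subtracted. It extends the operations in terms of
which `RCA0` is stated, see `RCA0.nums`. -/
class Nums (M : Type u) extends CommSemiring M, LinearOrder M, IsStrictOrderedRing M,
  CanonicallyOrderedAdd M where
  lt_succ (m n : M) : m < n + 1 ↔ m ≤ n

/-- The structure `Nums` of a model of `RCA₀`. -/
noncomputable abbrev RCA0.nums {M : Type u} [Zero M] [One M] [Add M] [Mul M] [LT M]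
    {S : Set (Set M)} (hS : RCA0 S) : Nums M :=
  letI := hS.commSemiring
  letI := hS.linearOrder
  { toCommSemiring := hS.commSemiring
    toLinearOrder := hS.linearOrder
    toIsStrictOrderedRing := hS.isStrictOrderedRing
    toCanonicallyOrderedAdd := hS.canonicallyOrderedAdd
    lt_succ := fun m n => by rw [hS.lt_succ', le_iff_lt_or_eq] }

variable {M : Type u} [Nums M] {S : Set (Set M)}

theorem le_pair_left (i j : M) : i ≤ pair i j := le_add_self

theorem lt_add_one_iff {m n : M} : m < n + 1 ↔ m ≤ n := Nums.lt_succ m n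

theorem add_one_le_iff {m n : M} : m + 1 ≤ n ↔ m < n := by
  rw [← lt_add_one_iff, add_lt_add_iff_right]

theorem eq_zero_or_succ (n : M) : n = 0 ∨ ∃ m, n = m + 1 := by
  rcases eq_zero_or_pos n with h | h
  · exact Or.inl h
  · rw [← add_one_le_iff, zero_add] at h
    obtain ⟨m, rfl⟩ := exists_add_of_le h
    exact Or.inr ⟨m, add_comm _ _⟩

theorem succ_ne_zero (n : M) : n + 1 ≠ 0 := (zero_lt_one.trans_le le_add_self).ne'

theorem self_le_mul_self (n : M) : n ≤ n * n := by
  rcases eq_zero_or_succ n with rfl | ⟨m, rfl⟩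
  · simp
  · exact le_mul_of_one_le_left (zero_le) le_add_self

theorem le_pair_right (i j : M) : j ≤ pair i j :=
  (le_add_self.trans (self_le_mul_self (i + j))).trans le_self_add

theorem pair_inj {i j i' j' : M} : pair i j = pair i' j' ↔ i = i' ∧ j = j' := by
  refine ⟨fun h => ?_, fun h => by rw [h.1, h.2]⟩
  have key : ∀ {i j i' j' : M}, pair i j = pair i' j' → ¬ i + j < i' + j' := by
    intro i j i' j' h hlt
    have h1 : i + j + 1 ≤ i' + j' := add_one_le_iff.2 hlt
    have h2 : (i + j + 1) * (i + j + 1) ≤ (i' + j') * (i' + j') := mul_le_mul' h1 h1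
    have h3 : pair i j < (i + j + 1) * (i + j + 1) := by
      have : (i + j + 1) * (i + j + 1) = pair i j + (i + j + j + 1) := by unfold pair; ring
      rw [this]
      exact lt_add_of_pos_right _ (zero_lt_one.trans_le le_add_self)
    have h4 : (i' + j') * (i' + j') ≤ pair i' j' := le_self_add
    exact absurd h (h3.trans_le (h2.trans h4)).ne
  have hs : i + j = i' + j' := le_antisymm (not_lt.1 (key h.symm)) (not_lt.1 (key h))
  have hi : i = i' := by
    unfold pair at h
    rw [hs] at h
    exact add_left_cancel h
  subst hi
  exact ⟨rfl, add_left_cancel hs⟩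

open NTerm Fml

/-- `∃ x < t, φ`. -/
def Fml.bex (t : NTerm) (φ : Fml) : Fml := neg (ball t (neg φ))

/-- The term for `pair`. -/
def pairT (s t : NTerm) : NTerm := .add (.mul (.add s t) (.add s t)) s

/-- `∃ x y, v = pair x y ∧ φ` with bounded quantifiers, where `v` is the variable with index `k`;
in `φ` the variables `x` and `y` have the indices `1` and `0`. -/
def Fml.unpair (k : ℕ) (φ : Fml) : Fml :=
  bex (.add (.var k) .one) (bex (.add (.var (k + 1)) .one)
    (.and (.eq (.var (k + 2)) (pairT (.var 1) (.var 0))) φ))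

theorem Fml.Bounded.unpair {k : ℕ} {φ : Fml} (h : φ.Bounded) : (φ.unpair k).Bounded := ⟨trivial, h⟩

theorem sat_bex (t : NTerm) (φ : Fml) (e : ℕ → M) (E : ℕ → Set M) :
    Sat S (bex t φ) e E ↔ ∃ x < t.val e, Sat S φ (push x e) E := by
  simp [bex, Sat]

theorem sat_unpair [Fact (RCA0 S)] (k : ℕ) (φ : Fml) (e : ℕ → M) (E : ℕ → Set M) :
    Sat S (unpair k φ) e E ↔ ∃ x y, e k = pair x y ∧ Sat S φ (push y (push x e)) E := by
  simp only [unpair, sat_bex, NTerm.val, Sat, pairT, push, lt_add_one_iff]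
  constructor
  · rintro ⟨x, -, y, -, h⟩
    exact ⟨x, y, h⟩
  · rintro ⟨x, y, h, h'⟩
    exact ⟨x, h ▸ le_pair_left x y, y, h ▸ le_pair_right x y, h, h'⟩

/-- `Δ⁰₁` comprehension for a set given by its elements.  The quantified variable has the
index `0`, the element of the set the index `1`. -/
theorem mem_of_delta [hS : Fact (RCA0 S)] (θ₁ θ₂ : Fml) (h₁ : θ₁.Bounded) (h₂ : θ₂.Bounded)
    (e : ℕ → M) (E : ℕ → Set M) (hE : ∀ i, E i ∈ S) {X : Set M}
    (hX₁ : ∀ n, n ∈ X ↔ ∃ m, Sat S θ₁ (push m (push n e)) E)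
    (hX₂ : ∀ n, n ∈ X ↔ ∀ m, Sat S θ₂ (push m (push n e)) E) : X ∈ S := by
  have := hS.out.delta01_comprehension (exN θ₁) (allN θ₂) ⟨θ₁, h₁, rfl⟩ ⟨θ₂, h₂, rfl⟩ e E hE
    (fun n => by rw [sat_exN, ← hX₁, hX₂]; rfl)
  convert this using 1
  ext n
  rw [Set.mem_ofPred_eq, sat_exN, hX₁]

/-- Comprehension for a bounded formula. The variable with index `0` is a dummy, as the formula is
read in the scope of an unbounded quantifier; the element of the set has the index `1`. -/
theorem mem_of_bounded [hS : Fact (RCA0 S)] (θ : Fml) (h : θ.Bounded)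
    (e : ℕ → M) (E : ℕ → Set M) (hE : ∀ i, E i ∈ S) {X : Set M}
    (hX : ∀ n m, n ∈ X ↔ Sat S θ (push m (push n e)) E) : X ∈ S :=
  mem_of_delta θ θ h h e E hE
    (fun n => ⟨fun h => ⟨0, (hX n 0).1 h⟩, fun ⟨m, h⟩ => (hX n m).2 h⟩)
    (fun n => ⟨fun h m => (hX n m).1 h, fun h => (hX n 0).2 (h 0)⟩)

/-- The sequence of set parameters `A, B, C, C, …`; three parameters suffice for all uses of
comprehension for explicit formulas. -/
def params (A B C : Set M) : ℕ → Set M := push A (push B fun _ => C)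

theorem params_mem {A B C : Set M} (hA : A ∈ S) (hB : B ∈ S) (hC : C ∈ S) (i : ℕ) :
    params A B C i ∈ S := by
  rcases i with _ | _ | i
  exacts [hA, hB, hC]

/-- An encoding of the elements of `α` by numbers. -/
class Cod (S : Set (Set M)) (α : Type u) where
  enc : α → M
  inj : Function.Injective enc
  range_mem : Set.range enc ∈ S

/-- The set of codes of the elements satisfying `p` belongs to the structure. The instances
express that these predicates are closed under connectives, bounded quantifiers and substitution of
functions satisfying `Rec`, so that instance search verifies `Dec S p` from the form of `p`. -/
class Dec (S : Set (Set M)) {α : Type u} [Cod S α] (p : α → Prop) : Prop where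
  mem : {z | ∃ a : α, z = Cod.enc S a ∧ p a} ∈ S

/-- The graph of `f` belongs to the structure. This is the analogue of `Dec` for functions. -/
class Rec (S : Set (Set M)) {α β : Type u} [Cod S α] [Cod S β] (f : α → β) : Prop where
  mem : {z | ∃ a : α, z = pair (Cod.enc S a) (Cod.enc S (f a))} ∈ S

instance Cod.instSelf [hS : Fact (RCA0 S)] : Cod S M where
  enc := id
  inj := Function.injective_id
  range_mem := by
    obtain ⟨A, hA⟩ := hS.out.sets_nonempty
    exact mem_of_bounded (.eq (.var 1) (.var 1)) trivial (fun _ => 0) (fun _ => A) (fun _ => hA)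
      (fun n m => by simp [Sat])

@[simp] theorem enc_self [hS : Fact (RCA0 S)] (a : M) : Cod.enc S a = a := rfl

variable [hS : Fact (RCA0 S)] {α β γ : Type u} [Cod S α] [Cod S β] [Cod S γ]

instance Cod.instProd : Cod S (α × β) where
  enc x := pair (Cod.enc S x.1) (Cod.enc S x.2)
  inj x y h := by
    have := pair_inj.1 h
    exact Prod.ext (Cod.inj this.1) (Cod.inj this.2)
  range_mem := by
    refine mem_of_bounded (unpair 1 (.and (.mem (.var 1) 0) (.mem (.var 0) 1)))
      (.unpair ⟨trivial, trivial⟩) (fun _ => 0) _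
      (params_mem (Cod.range_mem (S := S) (α := α)) (Cod.range_mem (S := S) (α := β))
        (Cod.range_mem (S := S) (α := β))) fun n m => ?_
    simp only [sat_unpair, Sat, NTerm.val, push, params, Set.mem_range, Prod.exists]
    constructor
    · rintro ⟨a, b, rfl⟩
      exact ⟨_, _, rfl, ⟨a, rfl⟩, ⟨b, rfl⟩⟩
    · rintro ⟨_, _, rfl, ⟨a, rfl⟩, ⟨b, rfl⟩⟩
      exact ⟨a, b, rfl⟩

@[simp] theorem enc_mk (a : α) (b : β) : Cod.enc S (a, b) = pair (Cod.enc S a) (Cod.enc S b) := rfl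

/-- The set of codes of the elements satisfying `p`. -/
def codes (S : Set (Set M)) [Cod S α] (p : α → Prop) : Set M := {z | ∃ a : α, z = Cod.enc S a ∧ p a}

theorem enc_mem_codes {p : α → Prop} {a : α} : Cod.enc S a ∈ codes S p ↔ p a :=
  ⟨fun ⟨_, h, h'⟩ => Cod.inj h ▸ h', fun h => ⟨a, rfl, h⟩⟩

theorem Dec.codes_mem (p : α → Prop) [h : Dec S p] : codes S p ∈ S := h.mem

theorem Dec.setOf_mem (p : M → Prop) [h : Dec S p] : {n | p n} ∈ S := by
  convert h.mem using 1
  ext n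
  simp

theorem Dec.of_mem {X : Set M} (h : X ∈ S) : Dec S (fun n : M => n ∈ X) where
  mem := by simpa using h

theorem Dec.congr {p q : α → Prop} (h : Dec S p) (hpq : ∀ a, q a ↔ p a) : Dec S q := by
  rwa [show q = p from funext fun a => propext (hpq a)]

namespace Dec

instance (priority := 900) and (p q : α → Prop) [hp : Dec S p] [hq : Dec S q] :
    Dec S (fun a => p a ∧ q a) where
  mem := by
    refine mem_of_bounded (.and (.mem (.var 1) 0) (.mem (.var 1) 1)) ⟨trivial, trivial⟩
      (fun _ => 0) _ (params_mem hp.mem hq.mem hq.mem) fun n m => ?_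
    simp only [Sat, NTerm.val, push, params, Set.mem_ofPred_eq]
    constructor
    · rintro ⟨a, rfl, h, h'⟩
      exact ⟨⟨a, rfl, h⟩, ⟨a, rfl, h'⟩⟩
    · rintro ⟨⟨a, rfl, h⟩, ⟨b, hb, h'⟩⟩
      exact ⟨a, rfl, h, Cod.inj hb ▸ h'⟩

instance (priority := 900) not (p : α → Prop) [hp : Dec S p] : Dec S (fun a => ¬ p a) where
  mem := by
    refine mem_of_bounded (.and (.mem (.var 1) 0) (.neg (.mem (.var 1) 1))) ⟨trivial, trivial⟩
      (fun _ => 0) _ (params_mem (Cod.range_mem (S := S) (α := α)) hp.mem hp.mem) fun n m => ?_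
    simp only [Sat, NTerm.val, push, params, Set.mem_ofPred_eq, Set.mem_range]
    constructor
    · rintro ⟨a, rfl, h⟩
      refine ⟨⟨a, rfl⟩, ?_⟩
      rintro ⟨b, hb, h'⟩
      exact h (Cod.inj hb ▸ h')
    · rintro ⟨⟨a, rfl⟩, h⟩
      exact ⟨a, rfl, fun h' => h ⟨a, rfl, h'⟩⟩

instance (priority := 900) or (p q : α → Prop) [hp : Dec S p] [hq : Dec S q] :
    Dec S (fun a => p a ∨ q a) :=
  (inferInstance : Dec S fun a => ¬ (¬ p a ∧ ¬ q a)).congr fun a => by tauto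

instance (priority := 900) imp (p q : α → Prop) [hp : Dec S p] [hq : Dec S q] :
    Dec S (fun a => p a → q a) :=
  (inferInstance : Dec S fun a => ¬ (p a ∧ ¬ q a)).congr fun a => by tauto

instance (priority := 900) iff (p q : α → Prop) [hp : Dec S p] [hq : Dec S q] :
    Dec S (fun a => p a ↔ q a) :=
  (inferInstance : Dec S fun a => (p a → q a) ∧ (q a → p a)).congr fun a => by tauto

theorem const_true : Dec S (fun _ : α => True) where
  mem := by
    convert Cod.range_mem (S := S) (α := α) using 1
    ext n
    simp [eq_comm]

/-- A constant predicate is tried before the connectives, which would split it needlessly. -/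
instance (priority := 1100) const (p : Prop) : Dec S (fun _ : α => p) := by
  by_cases h : p
  · exact const_true.congr fun _ => by simpa using h
  · haveI := const_true (S := S) (α := α)
    exact (inferInstance : Dec S fun _ : α => ¬ True).congr fun _ => by simpa using h

/-- Membership in `S` of the preimage of a set under a function whose graph belongs to `S`. -/
theorem comp (p : β → Prop) (f : α → β) [hp : Dec S p] [hf : Rec S f] :
    Dec S (fun a => p (f a)) where
  mem := by
    refine mem_of_delta (.and (.mem (pairT (.var 1) (.var 0)) 0) (.mem (.var 0) 1))
      (.and (.mem (.var 1) 2) (.neg (.and (.mem (pairT (.var 1) (.var 0)) 0)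
        (.neg (.mem (.var 0) 1))))) ⟨trivial, trivial⟩ ⟨trivial, trivial, trivial⟩
      (fun _ => 0) _ (params_mem hf.mem hp.mem (Cod.range_mem (S := S) (α := α)))
      (fun n => ?_) (fun n => ?_)
    · simp only [Sat, NTerm.val, push, params, pairT, Set.mem_ofPred_eq]
      constructor
      · rintro ⟨a, rfl, h⟩
        exact ⟨_, ⟨a, rfl⟩, _, rfl, h⟩
      · rintro ⟨m, ⟨a, ha⟩, b, rfl, h⟩
        obtain ⟨rfl, hb⟩ := pair_inj.1 ha
        exact ⟨a, rfl, Cod.inj hb ▸ h⟩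
    · simp only [Sat, NTerm.val, push, params, pairT, Set.mem_ofPred_eq, Set.mem_range]
      constructor
      · rintro ⟨a, rfl, h⟩ m
        refine ⟨⟨a, rfl⟩, ?_⟩
        rintro ⟨⟨b, hb⟩, h'⟩
        obtain ⟨hab, rfl⟩ := pair_inj.1 hb
        cases Cod.inj hab
        exact h' ⟨_, rfl, h⟩
      · intro h
        obtain ⟨a, rfl⟩ := (h 0).1
        refine ⟨a, rfl, ?_⟩
        by_contra hpa
        refine (h (Cod.enc S (f a))).2 ⟨⟨a, rfl⟩, ?_⟩
        rintro ⟨b, hb, h'⟩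
        exact hpa (Cod.inj hb ▸ h')

end Dec

namespace Rec

instance (priority := 1100) id : Rec S (fun a : α => a) where
  mem := by
    refine mem_of_bounded (unpair 1 (.and (.eq (.var 1) (.var 0)) (.mem (.var 0) 1)))
      (.unpair ⟨trivial, trivial⟩) (fun _ => 0) (fun _ => _)
      (fun _ => Cod.range_mem (S := S) (α := α)) fun n m => ?_
    simp only [sat_unpair, Sat, NTerm.val, push, Set.mem_ofPred_eq, Set.mem_range]
    constructor
    · rintro ⟨a, rfl⟩
      exact ⟨_, _, rfl, rfl, a, rfl⟩
    · rintro ⟨_, _, rfl, rfl, a, rfl⟩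
      exact ⟨a, rfl⟩

instance (priority := 1200) const (b : β) : Rec S (fun _ : α => b) where
  mem := by
    refine mem_of_bounded (unpair 1 (.and (.eq (.var 0) (.var 4)) (.mem (.var 1) 1)))
      (.unpair ⟨trivial, trivial⟩) (fun _ => Cod.enc S b) (fun _ => _)
      (fun _ => Cod.range_mem (S := S) (α := α)) fun n m => ?_
    simp only [sat_unpair, Sat, NTerm.val, push, Set.mem_ofPred_eq, Set.mem_range]
    constructor
    · rintro ⟨a, rfl⟩
      exact ⟨_, _, rfl, rfl, a, rfl⟩
    · rintro ⟨_, _, rfl, rfl, a, rfl⟩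
      exact ⟨a, rfl⟩

theorem comp (g : β → γ) (f : α → β) [hg : Rec S g] [hf : Rec S f] :
    Rec S (fun a => g (f a)) where
  mem := by
    refine mem_of_delta
      (unpair 1 (.and (.mem (pairT (.var 1) (.var 2)) 0) (.mem (pairT (.var 2) (.var 0)) 1)))
      (unpair 1 (.and (.mem (.var 1) 2) (.neg (.and (.mem (pairT (.var 1) (.var 2)) 0)
        (.neg (.mem (pairT (.var 2) (.var 0)) 1)))))) (.unpair ⟨trivial, trivial⟩)
      (.unpair ⟨trivial, trivial, trivial⟩)
      (fun _ => 0) _ (params_mem hf.mem hg.mem (Cod.range_mem (S := S) (α := α)))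
      (fun n => ?_) (fun n => ?_)
    · simp only [sat_unpair, Sat, NTerm.val, push, params, pairT, Set.mem_ofPred_eq]
      constructor
      · rintro ⟨a, rfl⟩
        exact ⟨_, _, _, rfl, ⟨a, rfl⟩, ⟨_, rfl⟩⟩
      · rintro ⟨m, x, y, rfl, ⟨a, ha⟩, b, hb⟩
        obtain ⟨rfl, rfl⟩ := pair_inj.1 ha
        obtain ⟨hab, rfl⟩ := pair_inj.1 hb
        cases Cod.inj hab
        exact ⟨a, rfl⟩
    · simp only [sat_unpair, Sat, NTerm.val, push, params, pairT, Set.mem_ofPred_eq, Set.mem_range]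
      constructor
      · rintro ⟨a, rfl⟩ m
        refine ⟨_, _, rfl, ⟨a, rfl⟩, ?_⟩
        rintro ⟨⟨b, hb⟩, h'⟩
        obtain ⟨hab, rfl⟩ := pair_inj.1 hb
        cases Cod.inj hab
        exact h' ⟨_, rfl⟩
      · intro h
        obtain ⟨_, y, rfl, ⟨a, rfl⟩, -⟩ := h 0
        refine ⟨a, ?_⟩
        obtain ⟨x, y', hxy, -, h⟩ := h (Cod.enc S (f a))
        obtain ⟨rfl, rfl⟩ := pair_inj.1 hxy
        by_contra hpa
        refine h ⟨⟨a, rfl⟩, ?_⟩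
        rintro ⟨b, hb⟩
        obtain ⟨hab, rfl⟩ := pair_inj.1 hb
        cases Cod.inj hab
        exact hpa rfl

theorem fst_self : Rec S (fun x : α × β => x.1) where
  mem := by
    refine mem_of_bounded (unpair 1 (unpair 1 (.and (.eq (.var 1) (.var 2))
      (.and (.mem (.var 1) 0) (.mem (.var 0) 1)))))
      (.unpair (.unpair ⟨trivial, trivial, trivial⟩)) (fun _ => 0) _
      (params_mem (Cod.range_mem (S := S) (α := α)) (Cod.range_mem (S := S) (α := β))
        (Cod.range_mem (S := S) (α := β))) fun n m => ?_
    simp only [sat_unpair, Sat, NTerm.val, push, params, Set.mem_ofPred_eq, Set.mem_range]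
    constructor
    · rintro ⟨a, rfl⟩
      exact ⟨_, _, rfl, _, _, rfl, rfl, ⟨_, rfl⟩, ⟨_, rfl⟩⟩
    · rintro ⟨_, _, rfl, _, _, rfl, rfl, ⟨a, rfl⟩, ⟨b, rfl⟩⟩
      exact ⟨(a, b), rfl⟩

theorem snd_self : Rec S (fun x : α × β => x.2) where
  mem := by
    refine mem_of_bounded (unpair 1 (unpair 1 (.and (.eq (.var 0) (.var 2))
      (.and (.mem (.var 1) 0) (.mem (.var 0) 1)))))
      (.unpair (.unpair ⟨trivial, trivial, trivial⟩)) (fun _ => 0) _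
      (params_mem (Cod.range_mem (S := S) (α := α)) (Cod.range_mem (S := S) (α := β))
        (Cod.range_mem (S := S) (α := β))) fun n m => ?_
    simp only [sat_unpair, Sat, NTerm.val, push, params, Set.mem_ofPred_eq, Set.mem_range]
    constructor
    · rintro ⟨a, rfl⟩
      exact ⟨_, _, rfl, _, _, rfl, rfl, ⟨_, rfl⟩, ⟨_, rfl⟩⟩
    · rintro ⟨_, _, rfl, _, _, rfl, rfl, ⟨a, rfl⟩, ⟨b, rfl⟩⟩
      exact ⟨(a, b), rfl⟩

instance fst (f : α → β × γ) [Rec S f] : Rec S (fun a => (f a).1) :=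
  haveI := fst_self (S := S) (α := β) (β := γ)
  comp (fun x : β × γ => x.1) f

instance snd (f : α → β × γ) [Rec S f] : Rec S (fun a => (f a).2) :=
  haveI := snd_self (S := S) (α := β) (β := γ)
  comp (fun x : β × γ => x.2) f

instance prodMk (f : α → β) (g : α → γ) [hf : Rec S f] [hg : Rec S g] :
    Rec S (fun a => (f a, g a)) where
  mem := by
    refine mem_of_bounded (unpair 1 (unpair 0 (.and (.mem (pairT (.var 3) (.var 1)) 0)
      (.mem (pairT (.var 3) (.var 0)) 1))))
      (.unpair (.unpair ⟨trivial, trivial⟩)) (fun _ => 0) _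
      (params_mem hf.mem hg.mem hg.mem) fun n m => ?_
    simp only [sat_unpair, Sat, NTerm.val, push, params, pairT, Set.mem_ofPred_eq]
    constructor
    · rintro ⟨a, rfl⟩
      exact ⟨_, _, rfl, _, _, rfl, ⟨_, rfl⟩, ⟨_, rfl⟩⟩
    · rintro ⟨_, _, rfl, _, _, rfl, ⟨a, ha⟩, ⟨b, hb⟩⟩
      obtain ⟨rfl, rfl⟩ := pair_inj.1 ha
      obtain ⟨hab, rfl⟩ := pair_inj.1 hb
      cases Cod.inj hab
      exact ⟨a, rfl⟩

theorem add_self : Rec S (fun x : M × M => x.1 + x.2) where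
  mem := by
    refine mem_of_bounded (unpair 1 (unpair 1 (.eq (.add (.var 1) (.var 0)) (.var 2))))
      (.unpair (.unpair trivial)) (fun _ => 0) (fun _ => _)
      (fun _ => Cod.range_mem (S := S) (α := M)) fun n m => ?_
    simp only [sat_unpair, Sat, NTerm.val, push, Set.mem_ofPred_eq, Prod.exists]
    constructor
    · rintro ⟨a, b, rfl⟩
      exact ⟨_, _, rfl, a, b, rfl, rfl⟩
    · rintro ⟨_, _, rfl, a, b, rfl, rfl⟩
      exact ⟨a, b, rfl⟩

theorem mul_self : Rec S (fun x : M × M => x.1 * x.2) where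
  mem := by
    refine mem_of_bounded (unpair 1 (unpair 1 (.eq (.mul (.var 1) (.var 0)) (.var 2))))
      (.unpair (.unpair trivial)) (fun _ => 0) (fun _ => _)
      (fun _ => Cod.range_mem (S := S) (α := M)) fun n m => ?_
    simp only [sat_unpair, Sat, NTerm.val, push, Set.mem_ofPred_eq, Prod.exists]
    constructor
    · rintro ⟨a, b, rfl⟩
      exact ⟨_, _, rfl, a, b, rfl, rfl⟩
    · rintro ⟨_, _, rfl, a, b, rfl, rfl⟩
      exact ⟨a, b, rfl⟩

instance add (f g : α → M) [Rec S f] [Rec S g] : Rec S (fun a => f a + g a) :=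
  haveI := add_self (S := S)
  comp (fun x : M × M => x.1 + x.2) (fun a => (f a, g a))

instance mul (f g : α → M) [Rec S f] [Rec S g] : Rec S (fun a => f a * g a) :=
  haveI := mul_self (S := S)
  comp (fun x : M × M => x.1 * x.2) (fun a => (f a, g a))

instance pair (f g : α → M) [Rec S f] [Rec S g] : Rec S (fun a => pair (f a) (g a)) := by
  unfold SOA.pair
  infer_instance

end Rec

namespace Dec

theorem lt_self : Dec S (fun x : M × M => x.1 < x.2) where
  mem := by
    refine mem_of_bounded (unpair 1 (.lt (.var 1) (.var 0)))
      (.unpair trivial) (fun _ => 0) (fun _ => _)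
      (fun _ => Cod.range_mem (S := S) (α := M)) fun n m => ?_
    simp only [sat_unpair, Sat, NTerm.val, push, Set.mem_ofPred_eq, Prod.exists]
    rfl

theorem eq_self : Dec S (fun x : α × α => x.1 = x.2) where
  mem := by
    convert (Rec.id (S := S) (α := α)).mem using 1
    ext n
    simp only [Prod.exists, Set.mem_ofPred_eq, enc_mk]
    constructor
    · rintro ⟨a, b, rfl, rfl⟩
      exact ⟨a, rfl⟩
    · rintro ⟨a, rfl⟩
      exact ⟨a, a, rfl, rfl⟩

instance lt (f g : α → M) [Rec S f] [Rec S g] : Dec S (fun a => f a < g a) :=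
  haveI := lt_self (S := S)
  comp (fun x : M × M => x.1 < x.2) (fun a => (f a, g a))

instance le (f g : α → M) [Rec S f] [Rec S g] : Dec S (fun a => f a ≤ g a) :=
  (inferInstance : Dec S fun a => ¬ g a < f a).congr fun _ => not_lt.symm

instance eq (f g : α → β) [Rec S f] [Rec S g] : Dec S (fun a => f a = g a) :=
  haveI := eq_self (S := S) (α := β)
  comp (fun x : β × β => x.1 = x.2) (fun a => (f a, g a))

instance mem' (X : Set M) [h : Fact (X ∈ S)] (f : α → M) [Rec S f] : Dec S (fun a => f a ∈ X) :=
  haveI := of_mem h.out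
  comp (fun x : M => x ∈ X) f

theorem ball_self (p : α × M → Prop) [hp : Dec S p] :
    Dec S (fun y : α × M => ∀ x < y.2, p (y.1, x)) where
  mem := by
    refine mem_of_bounded (unpair 1 (.and (.mem (.var 1) 1)
      (.ball (.var 0) (.mem (pairT (.var 2) (.var 0)) 0))))
      (.unpair ⟨trivial, trivial⟩) (fun _ => 0) _
      (params_mem hp.mem (Cod.range_mem (S := S) (α := α)) hp.mem) fun n m => ?_
    simp only [sat_unpair, Sat, NTerm.val, push, params, pairT, Set.mem_ofPred_eq, Set.mem_range]
    constructor
    · rintro ⟨⟨a, b⟩, rfl, h⟩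
      exact ⟨_, _, rfl, ⟨a, rfl⟩, fun x hx => ⟨(a, x), rfl, h x hx⟩⟩
    · rintro ⟨_, b, rfl, ⟨a, rfl⟩, h⟩
      refine ⟨(a, b), rfl, fun x hx => ?_⟩
      obtain ⟨⟨a', x'⟩, h1, h2⟩ := h x hx
      obtain ⟨h3, h4⟩ := pair_inj.1 h1
      cases Cod.inj h3
      cases (show x = x' from h4)
      exact h2

instance ball (t : α → M) (p : α → M → Prop) [Rec S t] [Dec S fun y : α × M => p y.1 y.2] :
    Dec S (fun a => ∀ x, x < t a → p a x) :=
  haveI := ball_self (S := S) (fun y : α × M => p y.1 y.2)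
  comp (fun y : α × M => ∀ x < y.2, p y.1 x) (fun a => (a, t a))

instance bex (t : α → M) (p : α → M → Prop) [Rec S t] [Dec S fun y : α × M => p y.1 y.2] :
    Dec S (fun a => ∃ x, x < t a ∧ p a x) :=
  (inferInstance : Dec S fun a => ¬ ∀ x, x < t a → ¬ p a x).congr fun a => by simp

instance ballLe (t : α → M) (p : α → M → Prop) [Rec S t] [Dec S fun y : α × M => p y.1 y.2] :
    Dec S (fun a => ∀ x, x ≤ t a → p a x) :=
  (inferInstance : Dec S fun a => ∀ x, x < t a + 1 → p a x).congr fun a => by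
    simp only [lt_add_one_iff]

instance bexLe (t : α → M) (p : α → M → Prop) [Rec S t] [Dec S fun y : α × M => p y.1 y.2] :
    Dec S (fun a => ∃ x, x ≤ t a ∧ p a x) :=
  (inferInstance : Dec S fun a => ∃ x, x < t a + 1 ∧ p a x).congr fun a => by
    simp only [lt_add_one_iff]

/-- `Δ⁰₁` comprehension. -/
theorem of_delta {r : α → Prop} (p q : α → M → Prop) [hp : Dec S fun y : α × M => p y.1 y.2]
    [hq : Dec S fun y : α × M => q y.1 y.2] (h₁ : ∀ a, r a ↔ ∃ m, p a m)
    (h₂ : ∀ a, r a ↔ ∀ m, q a m) : Dec S r where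
  mem := by
    refine mem_of_delta (.mem (pairT (.var 1) (.var 0)) 0)
      (.mem (pairT (.var 1) (.var 0)) 1) trivial trivial
      (fun _ => 0) _ (params_mem hp.mem hq.mem hq.mem) (fun n => ?_) (fun n => ?_)
    · simp only [Sat, NTerm.val, push, params, pairT, Set.mem_ofPred_eq]
      constructor
      · rintro ⟨a, rfl, h⟩
        obtain ⟨m, hm⟩ := (h₁ a).1 h
        exact ⟨m, (a, m), rfl, hm⟩
      · rintro ⟨m, ⟨a, m'⟩, h, h'⟩
        obtain ⟨rfl, -⟩ := pair_inj.1 h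
        exact ⟨a, rfl, (h₁ a).2 ⟨m', h'⟩⟩
    · simp only [Sat, NTerm.val, push, params, pairT, Set.mem_ofPred_eq]
      constructor
      · rintro ⟨a, rfl, h⟩ m
        exact ⟨(a, m), rfl, (h₂ a).1 h m⟩
      · intro h
        obtain ⟨⟨a, m⟩, h1, -⟩ := h 0
        obtain ⟨rfl, -⟩ := pair_inj.1 h1
        refine ⟨a, rfl, (h₂ a).2 fun m => ?_⟩
        obtain ⟨⟨a', m'⟩, h2, h3⟩ := h m
        obtain ⟨h4, h5⟩ := pair_inj.1 h2
        cases Cod.inj h4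
        cases (show m = m' from h5)
        exact h3

end Dec

/-- A function belongs to the structure if its graph does as a predicate. -/
theorem Rec.of_graph (f : α → β) (h : Dec S fun x : α × β => x.2 = f x.1) : Rec S f where
  mem := by
    convert h.mem using 1
    ext n
    simp only [Set.mem_ofPred_eq, Prod.exists, enc_mk]
    constructor
    · rintro ⟨a, rfl⟩
      exact ⟨a, _, rfl, rfl⟩
    · rintro ⟨a, _, rfl, rfl⟩
      exact ⟨a, rfl⟩

theorem isFun_iff (f : M → M) : IsFun S f ↔ Rec S f := ⟨fun h => ⟨h⟩, fun h => h.mem⟩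

/-- Induction for `Σ⁰₁` predicates. -/
theorem sigma_induction {p : M → M → Prop} (hp : Dec S fun y : M × M => p y.1 y.2)
    (h0 : ∃ m, p 0 m) (hs : ∀ n, (∃ m, p n m) → ∃ m, p (n + 1) m) (n : M) : ∃ m, p n m := by
  refine hS.out.induction_sat (p := fun n => ∃ m, p n m) (.mem (pairT (.var 1) (.var 0)) 0) trivial
    (fun _ => 0) (fun _ => _) (fun _ => hp.mem) (fun n => ?_) h0 hs n
  simp only [Sat, NTerm.val, push, pairT, Set.mem_ofPred_eq, Prod.exists]
  constructor
  · rintro ⟨m, h⟩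
    exact ⟨m, n, m, rfl, h⟩
  · rintro ⟨m, a, b, h, h'⟩
    obtain ⟨rfl, rfl⟩ := pair_inj.1 h
    exact ⟨m, h'⟩

end Coding

/-! ### Named relations and functions -/

section Tools

variable {M : Type u} [Nums M] {S : Set (Set M)} [hS : Fact (RCA0 S)]
variable {α β γ : Type u} [Cod S α] [Cod S β] [Cod S γ]

/-- `Dec` for a named unary relation. Instances of this class provide `Dec` for all substitution
instances of the relation, and similarly for the four classes that follow. -/
class Rel1 (S : Set (Set M)) [Fact (RCA0 S)] (r : M → Prop) : Prop where
  dec : Dec S r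

/-- `Dec` for a named binary relation. -/
class Rel2 (S : Set (Set M)) [Fact (RCA0 S)] (r : M → M → Prop) : Prop where
  dec : Dec S fun y : M × M => r y.1 y.2

/-- `Dec` for a named ternary relation. -/
class Rel3 (S : Set (Set M)) [Fact (RCA0 S)] (r : M → M → M → Prop) : Prop where
  dec : Dec S fun y : M × M × M => r y.1 y.2.1 y.2.2

/-- `Rec` for a named unary function. -/
class Fn1 (S : Set (Set M)) [Fact (RCA0 S)] (f : M → M) : Prop where
  rec' : Rec S f

/-- `Rec` for a named binary function. -/
class Fn2 (S : Set (Set M)) [Fact (RCA0 S)] (f : M → M → M) : Prop where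
  rec' : Rec S fun y : M × M => f y.1 y.2

instance (priority := 800) Dec.rel1 (r : M → Prop) [h : Rel1 S r] (f : α → M) [Rec S f] :
    Dec S (fun a => r (f a)) :=
  haveI := h.dec
  Dec.comp r f

instance (priority := 800) Dec.rel2 (r : M → M → Prop) [h : Rel2 S r] (f g : α → M) [Rec S f]
    [Rec S g] : Dec S (fun a => r (f a) (g a)) :=
  haveI := h.dec
  Dec.comp (fun y : M × M => r y.1 y.2) (fun a => (f a, g a))

instance (priority := 800) Dec.rel3 (r : M → M → M → Prop) [h : Rel3 S r] (f g k : α → M) [Rec S f]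
    [Rec S g] [Rec S k] : Dec S (fun a => r (f a) (g a) (k a)) :=
  haveI := h.dec
  Dec.comp (fun y : M × M × M => r y.1 y.2.1 y.2.2) (fun a => (f a, g a, k a))

instance (priority := 800) Rec.fn1 (r : M → M) [h : Fn1 S r] (f : α → M) [Rec S f] :
    Rec S (fun a => r (f a)) :=
  haveI := h.rec'
  Rec.comp r f

instance (priority := 800) Rec.fn2 (r : M → M → M) [h : Fn2 S r] (f g : α → M) [Rec S f]
    [Rec S g] : Rec S (fun a => r (f a) (g a)) :=
  haveI := h.rec'
  Rec.comp (fun y : M × M => r y.1 y.2) (fun a => (f a, g a))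

instance (priority := 800) Rec.fn1_self (r : M → M) [h : Fn1 S r] : Rec S r := h.rec'

instance (priority := 800) Dec.rel1_self (r : M → Prop) [h : Rel1 S r] : Dec S r := h.dec

/-! Instance search eta-reduces its goals, so that partially applied functions need instances of
their own. -/

instance Rec.prodMk_self (c : α) : Rec S (Prod.mk c : β → α × β) :=
  Rec.prodMk (fun _ => c) (fun b => b)

instance (priority := 700) Rec.fn2_self (r : M → M → M) [h : Fn2 S r] (c : M) : Rec S (r c) :=
  haveI := h.rec'
  Rec.comp (fun y : M × M => r y.1 y.2) (fun a => (c, a))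

instance Rec.pair_self (c : M) : Rec S (SOA.pair c) :=
  Rec.pair (fun _ => c) (fun b => b)

instance Rec.add_const (c : M) : Rec S (HAdd.hAdd c : M → M) := Rec.add (fun _ => c) (fun b => b)

instance Dec.mem_self (X : Set M) [Fact (X ∈ S)] : Dec S (Membership.mem X) :=
  Dec.mem' X (fun b => b)

/-! ### Induction, least elements and bounding -/

/-- Induction for decidable predicates. -/
theorem ind (S : Set (Set M)) [Fact (RCA0 S)] {p : M → Prop} (hp : Dec S p) (h0 : p 0)
    (hs : ∀ n, p n → p (n + 1)) (n : M) : p n := by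
  haveI : Rel1 S p := ⟨hp⟩
  exact (sigma_induction (S := S) (p := fun n _ => p n) inferInstance ⟨0, h0⟩
    (fun n ⟨_, h⟩ => ⟨0, hs n h⟩) n).elim fun _ h => h

theorem exists_least (S : Set (Set M)) [Fact (RCA0 S)] {p : M → Prop} (hp : Dec S p)
    (h : ∃ n, p n) : ∃ n, p n ∧ ∀ m < n, ¬ p m := by
  haveI : Rel1 S p := ⟨hp⟩
  by_contra hcon
  have key := ind S (p := fun n => ∀ m, m < n → ¬ p m) inferInstance
    (fun m hm => (not_lt_zero hm).elim) (fun n hn m hm hpm => by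
      rcases (lt_add_one_iff.1 hm).lt_or_eq with h | rfl
      · exact hn m h hpm
      · exact hcon ⟨m, hpm, hn⟩)
  obtain ⟨n, hn⟩ := h
  exact key (n + 1) n (lt_add_one_iff.2 le_rfl) hn

theorem exists_greatest (S : Set (Set M)) [Fact (RCA0 S)] {p : M → Prop} (hp : Dec S p)
    (h : ∃ n, p n) (b : M) (hb : ∀ n, p n → n ≤ b) : ∃ n, p n ∧ ∀ m, p m → m ≤ n := by
  haveI : Rel1 S p := ⟨hp⟩
  obtain ⟨k, hk, hk'⟩ := exists_least S (p := fun k => ∀ m, m ≤ b → p m → m ≤ k) inferInstance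
    ⟨b, fun m hm _ => hm⟩
  refine ⟨k, ?_, fun m hm => hk m (hb m hm) hm⟩
  rcases eq_zero_or_succ k with rfl | ⟨j, rfl⟩
  · obtain ⟨n, hn⟩ := h
    have := hk n (hb n hn) hn
    rwa [nonpos_iff_eq_zero.1 this] at hn
  · have := hk' j (lt_add_one_iff.2 le_rfl)
    push Not at this
    obtain ⟨m, _, hm, hjm⟩ := this
    rwa [le_antisymm (hk m (hb m hm) hm) (add_one_le_iff.2 hjm)] at hm

/-- `Σ⁰₁` bounding. -/
theorem bounding (S : Set (Set M)) [Fact (RCA0 S)] {p : M → M → Prop}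
    (hp : Dec S fun y : M × M => p y.1 y.2) (k : M) (h : ∀ i < k, ∃ m, p i m) :
    ∃ b, ∀ i < k, ∃ m < b, p i m := by
  haveI : Rel2 S p := ⟨hp⟩
  have key := sigma_induction (S := S) (p := fun n b => ∀ i, i < n → i < k → ∃ m, m < b ∧ p i m)
    inferInstance ⟨0, fun i hi => (not_lt_zero hi).elim⟩ (by
      rintro n ⟨b, hb⟩
      by_cases hn : n < k
      · obtain ⟨m, hm⟩ := h n hn
        refine ⟨b + m + 1, fun i hi hik => ?_⟩
        rcases (lt_add_one_iff.1 hi).lt_or_eq with h | rfl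
        · obtain ⟨m', hm', hp'⟩ := hb i h hik
          exact ⟨m', hm'.trans_le (by rw [add_assoc]; exact le_self_add), hp'⟩
        · exact ⟨m, lt_add_one_iff.2 le_add_self, hm⟩
      · refine ⟨b, fun i hi hik => hb i ?_ hik⟩
        exact hik.trans_le (not_lt.1 hn)) k
  obtain ⟨b, hb⟩ := key
  exact ⟨b, fun i hi => hb i hi hi⟩

/-- Bounding for a relation that is upward closed in the second argument. -/
theorem bounding_mono (S : Set (Set M)) [Fact (RCA0 S)] {p : M → M → Prop}
    (hp : Dec S fun y : M × M => p y.1 y.2) (hmono : ∀ i m m', m ≤ m' → p i m → p i m')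
    (k : M) (h : ∀ i < k, ∃ m, p i m) : ∃ b, ∀ i < k, p i b := by
  obtain ⟨b, hb⟩ := bounding S hp k h
  refine ⟨b, fun i hi => ?_⟩
  obtain ⟨m, hm, h⟩ := hb i hi
  exact hmono i m b hm.le h

/-- A function with a `Σ⁰₁` graph belongs to the structure: its graph is `Δ⁰₁`, since `y ≠ f a`
holds if and only if some other number is the value. -/
theorem Rec.of_sigma {f : α → M} {q : α → M → M → Prop}
    (hq : Dec S fun y : (α × M) × M => q y.1.1 y.1.2 y.2)
    (h : ∀ a y, y = f a ↔ ∃ m, q a y m) : Rec S f := by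
  haveI : ∀ {δ : Type u} [Cod S δ] (u : δ → α) (v w : δ → M) [Rec S u] [Rec S v] [Rec S w],
      Dec S (fun d => q (u d) (v d) (w d)) := fun u v w =>
    Dec.comp (fun y : (α × M) × M => q y.1.1 y.1.2 y.2) (fun d => ((u d, v d), w d))
  refine Rec.of_graph f (Dec.of_delta (fun x m => q x.1 x.2 m)
    (fun x m => ∀ y, y ≤ m → ∀ m', m' ≤ m → q x.1 y m' → y = x.2) (fun x => h x.1 x.2)
    fun x => ⟨?_, ?_⟩)
  · rintro hx m y - m' - hq
    rw [hx]
    exact (h _ _).2 ⟨m', hq⟩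
  · intro hx
    obtain ⟨m, hm⟩ := (h x.1 (f x.1)).1 rfl
    exact (hx (f x.1 + m) _ le_self_add m le_add_self hm).symm

/-- Unbounded search. -/
theorem exists_search (S : Set (Set M)) [Fact (RCA0 S)] {α : Type u} [Cod S α] {p : α → M → Prop}
    (hp : Dec S fun y : α × M => p y.1 y.2) (h : ∀ a, ∃ m, p a m) :
    ∃ f : α → M, Rec S f ∧ ∀ a, p a (f a) ∧ ∀ m < f a, ¬ p a m := by
  have hp' : ∀ {δ : Type u} [Cod S δ] (u : δ → α) (v : δ → M) [Rec S u] [Rec S v],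
      Dec S (fun d => p (u d) (v d)) := fun u v =>
    Dec.comp (fun y : α × M => p y.1 y.2) (fun d => (u d, v d))
  choose f hf using fun a => exists_least S (p := p a) (hp' (fun _ => a) (fun m => m)) (h a)
  refine ⟨f, Rec.of_graph f ((inferInstance :
    Dec S fun x : α × M => p x.1 x.2 ∧ ∀ m, m < x.2 → ¬ p x.1 m).congr fun x => ?_), hf⟩
  constructor
  · intro h
    rw [h]
    exact hf _
  · rintro ⟨h, h'⟩
    rcases lt_trichotomy x.2 (f x.1) with h1 | h1 | h1
    · exact ((hf x.1).2 _ h1 h).elim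
    · exact h1
    · exact (h' _ h1 (hf x.1).1).elim

/-! ### Codes of finite sets -/

theorem one_le_mul_add_one (m i : M) : 1 ≤ m * (i + 1) + 1 := le_add_self

theorem dvd_iff_bounded {q n : M} (hq : 1 ≤ q) : q ∣ n ↔ ∃ t ≤ n, n = q * t := by
  constructor
  · rintro ⟨t, rfl⟩
    exact ⟨t, le_mul_of_one_le_left zero_le hq, rfl⟩
  · rintro ⟨t, -, h⟩
    exact ⟨t, h⟩

/-- Membership in a coded finite set is a bounded formula. -/
theorem finMem_iff {i c : M} : FinMem i c ↔ ∃ k ≤ c, ∃ m ≤ c, ∃ n ≤ c, c = pair k (pair m n) ∧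
    i < k ∧ ∃ t ≤ n, n = (m * (i + 1) + 1) * t := by
  constructor
  · rintro ⟨k, m, n, rfl, h, h'⟩
    exact ⟨k, le_pair_left _ _, m, (le_pair_left _ _).trans (le_pair_right _ _), n,
      (le_pair_right _ _).trans (le_pair_right _ _), rfl, h,
      (dvd_iff_bounded (one_le_mul_add_one m i)).1 h'⟩
  · rintro ⟨k, -, m, -, n, -, h, h', t, -, h''⟩
    exact ⟨k, m, n, h, h', t, h''⟩

instance rel2_finMem : Rel2 S (FinMem : M → M → Prop) where
  dec := (inferInstance : Dec S fun y : M × M => ∃ k ≤ y.2, ∃ m ≤ y.2, ∃ n ≤ y.2,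
    y.2 = pair k (pair m n) ∧ y.1 < k ∧ ∃ t ≤ n, n = (m * (y.1 + 1) + 1) * t).congr
    fun _ => finMem_iff

theorem FinMem.lt {i c : M} (h : FinMem i c) : i < c := by
  obtain ⟨k, m, n, rfl, h, -⟩ := h
  exact h.trans_le (le_pair_left _ _)

theorem finMem_pair {i k m n : M} : FinMem i (pair k (pair m n)) ↔
    i < k ∧ m * (i + 1) + 1 ∣ n := by
  constructor
  · rintro ⟨k', m', n', h, h1, h2⟩
    obtain ⟨rfl, h'⟩ := pair_inj.1 h
    obtain ⟨rfl, rfl⟩ := pair_inj.1 h'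
    exact ⟨h1, h2⟩
  · rintro ⟨h, h'⟩
    exact ⟨k, m, n, rfl, h, h'⟩

theorem dvd_of_dvd_add {a b c : M} (h : a ∣ b + c) (hb : a ∣ b) : a ∣ c := by
  obtain ⟨s, rfl⟩ := hb
  obtain ⟨t, ht⟩ := h
  rcases eq_zero_or_pos a with rfl | ha
  · simp at ht
    simp [ht]
  · have : a * s ≤ a * t := ht ▸ le_self_add
    obtain ⟨r, rfl⟩ := exists_add_of_le (le_of_mul_le_mul_left this ha)
    rw [mul_add] at ht
    exact ⟨r, add_left_cancel ht⟩

/-- The moduli `m (i + 1) + 1` are pairwise coprime when `m` is divisible by all small numbers. -/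
theorem dvd_of_dvd_mul_modulus {K m i j x : M} (hm : ∀ d < K, d + 1 ∣ m) (hi : i < K) (hj : j < K)
    (hij : i ≠ j) (h : m * (j + 1) + 1 ∣ x * (m * (i + 1) + 1)) : m * (j + 1) + 1 ∣ x := by
  have key : ∀ d, d < K → m * (j + 1) + 1 ∣ x * (d + 1) → m * (j + 1) + 1 ∣ x := by
    intro d hd h
    obtain ⟨t, ht⟩ := hm d hd
    have h1 : m * (j + 1) + 1 ∣ x * m * (j + 1) := by
      refine (h.mul_right (t * (j + 1))).trans (dvd_of_eq ?_)
      rw [ht]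
      ring
    refine dvd_of_dvd_add (b := x * m * (j + 1)) ⟨x, ?_⟩ h1
    ring
  rcases hij.lt_or_gt with hlt | hlt
  · obtain ⟨d, rfl⟩ := exists_add_of_le (add_one_le_iff.2 hlt)
    refine key d (lt_of_le_of_lt le_add_self hj) ?_
    refine dvd_of_dvd_add (b := (m * (i + 1 + d + 1) + 1) * (x * (i + 1))) ?_ ⟨_, rfl⟩
    refine (h.mul_right (i + 1 + d + 1)).trans (dvd_of_eq ?_)
    ring
  · obtain ⟨d, rfl⟩ := exists_add_of_le (add_one_le_iff.2 hlt)
    refine key d (lt_of_le_of_lt le_add_self hi) ?_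
    refine dvd_of_dvd_add (b := x * (m * (j + 1 + d + 1) + 1) * (j + 1)) ?_ (h.mul_right _)
    refine ⟨x * (j + 1 + d + 1), ?_⟩
    ring

/-- A replacement for the factorial. -/
theorem exists_common_multiple (S : Set (Set M)) [Fact (RCA0 S)] (K : M) :
    ∃ m : M, 0 < m ∧ ∀ d < K, d + 1 ∣ m := by
  have h1 : ∀ d : M, 1 ≤ d + 1 := fun d => le_add_self
  have key := sigma_induction (S := S)
    (p := fun K m : M => 0 < m ∧ ∀ d, d < K → ∃ t, t ≤ m ∧ m = (d + 1) * t)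
    inferInstance ⟨1, zero_lt_one, fun d hd => (not_lt_zero hd).elim⟩ (by
      rintro n ⟨m, hm, h⟩
      refine ⟨m * (n + 1), mul_pos hm (zero_lt_one.trans_le (h1 n)), fun d hd => ?_⟩
      rw [← dvd_iff_bounded (h1 d)]
      rcases (lt_add_one_iff.1 hd).lt_or_eq with h' | rfl
      · exact ((dvd_iff_bounded (h1 d)).2 (h d h')).mul_right _
      · exact dvd_mul_left _ _) K
  obtain ⟨m, hm, h⟩ := key
  exact ⟨m, hm, fun d hd => (dvd_iff_bounded (h1 d)).2 (h d hd)⟩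

/-- Every bounded set of the structure has a code: if `m` is divisible by all positive numbers up to
`K`, then the product of the moduli `m (i + 1) + 1` over the elements `i` of the set is divisible by
exactly these moduli. -/
theorem exists_code (S : Set (Set M)) [Fact (RCA0 S)] {p : M → Prop} (hp : Dec S p) (K : M) :
    ∃ c, ∀ i, FinMem i c ↔ i < K ∧ p i := by
  haveI : Rel1 S p := ⟨hp⟩
  obtain ⟨m, hm, hdvd⟩ := exists_common_multiple S K
  have key := sigma_induction (S := S)
    (p := fun k n : M => k ≤ K → 0 < n ∧ ∀ i, i < K →
      ((∃ t, t ≤ n ∧ n = (m * (i + 1) + 1) * t) ↔ i < k ∧ p i))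
    inferInstance ⟨1, fun _ => ⟨zero_lt_one, fun i _ => ?_⟩⟩ (by
      rintro k ⟨n, h⟩
      by_cases hk : k + 1 ≤ K
      swap
      · exact ⟨0, fun h => (hk h).elim⟩
      have hkK : k < K := add_one_le_iff.1 hk
      obtain ⟨hn, h⟩ := h hkK.le
      simp only [← dvd_iff_bounded (one_le_mul_add_one m _)] at h ⊢
      by_cases hpk : p k
      · refine ⟨n * (m * (k + 1) + 1), fun _ => ⟨mul_pos hn
          (zero_lt_one.trans_le (one_le_mul_add_one m k)), fun i hi => ?_⟩⟩
        by_cases hik : k = i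
        · subst hik
          simp only [dvd_mul_left, hpk, lt_add_one_iff, le_refl, and_self]
        · rw [lt_add_one_iff,
            show (m * (i + 1) + 1 ∣ n * (m * (k + 1) + 1)) ↔ m * (i + 1) + 1 ∣ n from
            ⟨dvd_of_dvd_mul_modulus hdvd hkK hi hik, fun h => h.mul_right _⟩, h i hi,
            (Ne.symm hik).le_iff_lt]
      · refine ⟨n, fun _ => ⟨hn, fun i hi => ?_⟩⟩
        rw [h i hi, lt_add_one_iff]
        refine and_congr_left fun hpi => ?_
        rw [Ne.le_iff_lt (fun h' : i = k => hpk (h' ▸ hpi))]) K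
  · obtain ⟨n, h⟩ := key
    obtain ⟨-, h⟩ := h le_rfl
    refine ⟨pair K (pair m n), fun i => ?_⟩
    rw [finMem_pair]
    refine and_congr_right fun hi => ?_
    rw [dvd_iff_bounded (one_le_mul_add_one m i), h i hi]
    exact and_iff_right hi
  · rw [← dvd_iff_bounded (one_le_mul_add_one m i)]
    refine iff_of_false (fun h => ?_) (fun h => not_lt_zero h.1)
    obtain ⟨t, ht⟩ := h
    have ht0 : 0 < t := by
      rcases eq_zero_or_pos t with rfl | h
      · simp at ht
      · exact h
    have h2 : (1 : M) < m * (i + 1) + 1 :=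
      lt_add_of_pos_left _ (mul_pos hm (zero_lt_one.trans_le le_add_self))
    have h3 : (1 : M) ≤ t := by rwa [← zero_add (1 : M), add_one_le_iff]
    exact absurd ht (h2.trans_le (le_mul_of_one_le_right zero_le h3)).ne

/-- Codes of the sets `{i < K a : p a i}` can be computed from `a`. That `c` is such a code is
decidable since the elements of the set coded by `c` are smaller than `c`. -/
theorem exists_code_fn (S : Set (Set M)) [Fact (RCA0 S)] {α : Type u} [Cod S α] {p : α → M → Prop}
    (hp : Dec S fun y : α × M => p y.1 y.2) (K : α → M)
    (hK : Rec S K := by infer_instance) :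
    ∃ f : α → M, Rec S f ∧ ∀ a i, FinMem i (f a) ↔ i < K a ∧ p a i := by
  haveI hp' : ∀ {δ : Type u} [Cod S δ] (u : δ → α) (v : δ → M) [Rec S u] [Rec S v],
      Dec S (fun d => p (u d) (v d)) := fun u v =>
    Dec.comp (fun y : α × M => p y.1 y.2) (fun d => (u d, v d))
  haveI : ∀ {δ : Type u} [Cod S δ] (u : δ → α) [Rec S u], Rec S (fun d => K (u d)) :=
    fun u => Rec.comp K u
  obtain ⟨f, hf, h⟩ := exists_search S
    (p := fun a c => ∀ i, i < K a + c → (FinMem i c ↔ i < K a ∧ p a i)) inferInstance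
    (fun a => by
      obtain ⟨c, hc⟩ := exists_code S (p := p a) (hp' (fun _ => a) (fun i => i)) (K a)
      exact ⟨c, fun i _ => hc i⟩)
  refine ⟨f, hf, fun a i => ?_⟩
  by_cases hi : i < K a + f a
  · exact (h a).1 i hi
  · exact iff_of_false (fun h' => hi (h'.lt.trans_le le_add_self))
      (fun h' => hi (h'.1.trans_le le_self_add))

/-! ### Primitive recursion -/

/-- `c` codes a finite set of pairs `(i, y)` each of which is justified, by the recursion
equations, by another element of `c`. -/
def RecStep (g : α → M) (h : α → M → M → M) (a : α) (c : M) : Prop :=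
  ∀ z, z < c → FinMem z c → ∃ i, i ≤ z ∧ ∃ y, y ≤ z ∧ z = pair i y ∧ ((i = 0 ∧ y = g a) ∨
    ∃ j, j < i ∧ i = j + 1 ∧ ∃ y', y' < c ∧ FinMem (pair j y') c ∧ y = h a j y')

/-- Primitive recursion: the value `f a n` is the number `y` such that `pair n y` belongs to a coded
finite set whose elements are justified by the recursion equations. -/
theorem exists_primrec (S : Set (Set M)) [Fact (RCA0 S)] {α : Type u} [Cod S α] (g : α → M)
    (h : α → M → M → M) [hg : Rec S g]
    [hh : Rec S fun y : (α × M) × M => h y.1.1 y.1.2 y.2] :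
    ∃ f : α → M → M, (Rec S fun y : α × M => f y.1 y.2) ∧
      ∀ a, f a 0 = g a ∧ ∀ n, f a (n + 1) = h a n (f a n) := by
  haveI : ∀ {δ : Type u} [Cod S δ] (u : δ → α) [Rec S u], Rec S (fun d => g (u d)) :=
    fun u => Rec.comp g u
  haveI : ∀ {δ : Type u} [Cod S δ] (u : δ → α) (v w : δ → M) [Rec S u] [Rec S v] [Rec S w],
      Rec S (fun d => h (u d) (v d) (w d)) := fun u v w =>
    Rec.comp (fun y : (α × M) × M => h y.1.1 y.1.2 y.2) (fun d => ((u d, v d), w d))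
  haveI hdec : ∀ {δ : Type u} [Cod S δ] (u : δ → α) (v : δ → M) [Rec S u] [Rec S v],
      Dec S (fun d => RecStep g h (u d) (v d)) := by
    intro δ _ u v _ _
    haveI : Dec S (fun y : α × M => RecStep g h y.1 y.2) := by
      unfold RecStep
      infer_instance
    exact Dec.comp (S := S) (fun y : α × M => RecStep g h y.1 y.2) (fun d => (u d, v d))
  -- two justified sets agree
  have huniq : ∀ a c c', RecStep g h a c → RecStep g h a c' → ∀ i y y', FinMem (pair i y) c →
      FinMem (pair i y') c' → y = y' := by
    intro a c c' hc hc' i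
    have := ind S (p := fun i => ∀ y, y < c → ∀ y', y' < c' → FinMem (pair i y) c →
      FinMem (pair i y') c' → y = y') inferInstance ?_ ?_ i
    · intro y y' h1 h2
      exact this y ((le_pair_right _ _).trans_lt h1.lt) y' ((le_pair_right _ _).trans_lt h2.lt)
        h1 h2
    · intro y _ y' _ h1 h2
      obtain ⟨i, -, z, -, he, hz⟩ := hc _ h1.lt h1
      obtain ⟨i', -, z', -, he', hz'⟩ := hc' _ h2.lt h2
      obtain ⟨rfl, rfl⟩ := pair_inj.1 he
      obtain ⟨rfl, rfl⟩ := pair_inj.1 he'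
      rcases hz with ⟨-, rfl⟩ | ⟨j, hj, -⟩
      · rcases hz' with ⟨-, rfl⟩ | ⟨j, hj, -⟩
        · rfl
        · exact (not_lt_zero hj).elim
      · exact (not_lt_zero hj).elim
    · intro n hn y _ y' _ h1 h2
      obtain ⟨i, -, z, -, he, hz⟩ := hc _ h1.lt h1
      obtain ⟨i', -, z', -, he', hz'⟩ := hc' _ h2.lt h2
      obtain ⟨rfl, rfl⟩ := pair_inj.1 he
      obtain ⟨rfl, rfl⟩ := pair_inj.1 he'
      rcases hz with ⟨h0, -⟩ | ⟨j, -, hj, x, hx, hxc, rfl⟩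
      · exact absurd h0 (succ_ne_zero _)
      · rcases hz' with ⟨h0, -⟩ | ⟨j', -, hj', x', hx', hxc', rfl⟩
        · exact absurd h0 (succ_ne_zero _)
        · cases add_right_cancel hj
          cases add_right_cancel hj'
          rw [hn x hx x' hx' hxc hxc']
  -- there are justified sets reaching arbitrarily far
  have hex : ∀ a n, ∃ c, RecStep g h a c ∧ ∃ y, y < c ∧ FinMem (pair n y) c := by
    intro a n
    refine sigma_induction (S := S)
      (p := fun n c => RecStep g h a c ∧ ∃ y, y < c ∧ FinMem (pair n y) c) inferInstance ?_ ?_ n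
    · obtain ⟨c, hc⟩ := exists_code S (p := fun z => z = pair 0 (g a)) inferInstance
        (pair 0 (g a) + 1)
      have hc' : FinMem (pair 0 (g a)) c := (hc _).2 ⟨lt_add_one_iff.2 le_rfl, rfl⟩
      refine ⟨c, fun z _ hz => ?_, g a, (le_pair_right _ _).trans_lt hc'.lt, hc'⟩
      obtain ⟨-, rfl⟩ := (hc z).1 hz
      exact ⟨0, le_pair_left _ _, g a, le_pair_right _ _, rfl, Or.inl ⟨rfl, rfl⟩⟩
    · rintro n ⟨c, hc, y, hyc, hy⟩
      obtain ⟨c', hc'⟩ := exists_code S (p := fun z => FinMem z c ∨ z = pair (n + 1) (h a n y))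
        inferInstance (c + pair (n + 1) (h a n y) + 1)
      have hsub : ∀ z, FinMem z c → FinMem z c' := fun z hz => (hc' z).2
        ⟨hz.lt.trans_le (by rw [add_assoc]; exact le_self_add), Or.inl hz⟩
      have hnew : FinMem (pair (n + 1) (h a n y)) c' :=
        (hc' _).2 ⟨lt_add_one_iff.2 le_add_self, Or.inr rfl⟩
      refine ⟨c', fun z _ hz => ?_, h a n y, (le_pair_right _ _).trans_lt hnew.lt, hnew⟩
      rcases ((hc' z).1 hz).2 with hz | rfl
      · obtain ⟨i, hi, y, hy, rfl, h | ⟨j, hj, rfl, y', hy', hyc, rfl⟩⟩ := hc z hz.lt hz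
        · exact ⟨i, hi, y, hy, rfl, Or.inl h⟩
        · have := hsub _ hyc
          exact ⟨_, hi, _, hy, rfl, Or.inr ⟨j, hj, rfl, y', (le_pair_right _ _).trans_lt this.lt,
            this, rfl⟩⟩
      · have := hsub _ hy
        exact ⟨_, le_pair_left _ _, _, le_pair_right _ _, rfl, Or.inr ⟨n,
          lt_add_one_iff.2 le_rfl, rfl, y, (le_pair_right _ _).trans_lt this.lt, this, rfl⟩⟩
  have hval : ∀ a n, ∃ y, ∃ c, RecStep g h a c ∧ FinMem (pair n y) c := fun a n => by
    obtain ⟨c, hc, y, -, hy⟩ := hex a n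
    exact ⟨y, c, hc, hy⟩
  choose f hf using hval
  have hfeq : ∀ a n y c, RecStep g h a c → FinMem (pair n y) c → y = f a n := by
    intro a n y c hc hy
    obtain ⟨c', hc', hy'⟩ := hf a n
    exact huniq a c c' hc hc' n _ _ hy hy'
  refine ⟨f, ?_, fun a => ⟨?_, fun n => ?_⟩⟩
  · refine Rec.of_sigma (q := fun x y c => RecStep g h x.1 c ∧ FinMem (pair x.2 y) c) inferInstance
      fun x y => ⟨?_, fun ⟨c, hc, hy⟩ => hfeq _ _ _ c hc hy⟩
    rintro rfl
    exact hf x.1 x.2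
  · obtain ⟨c, hc, hy⟩ := hf a 0
    obtain ⟨i, -, z, -, he, hz⟩ := hc _ hy.lt hy
    obtain ⟨rfl, he'⟩ := pair_inj.1 he
    rcases hz with ⟨-, hz⟩ | ⟨j, hj, -⟩
    · rw [he', hz]
    · exact (not_lt_zero hj).elim
  · obtain ⟨c, hc, hy⟩ := hf a (n + 1)
    obtain ⟨i, -, z, -, he, hz⟩ := hc _ hy.lt hy
    obtain ⟨rfl, he'⟩ := pair_inj.1 he
    rcases hz with ⟨h0, -⟩ | ⟨j, -, hj, x, hx, hxc, hz⟩
    · exact absurd h0 (succ_ne_zero _)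
    · cases add_right_cancel hj
      rw [he', hz, hfeq a n x c hc hxc]

end Tools

/-! ### Definition by cases -/

section Points

variable {M : Type u} [Nums M] {S : Set (Set M)} [hS : Fact (RCA0 S)]
variable {α β γ : Type u} [Cod S α] [Cod S β] [Cod S γ]

instance Rec.ite (p : α → Prop) [∀ a, Decidable (p a)] (f g : α → M) [Dec S p] [Rec S f]
    [Rec S g] :
    Rec S (fun a => if p a then f a else g a) := by
  haveI : ∀ {δ : Type u} [Cod S δ] (u : δ → α) [Rec S u], Dec S (fun d => p (u d)) :=
    fun u => Dec.comp p u
  haveI : ∀ {δ : Type u} [Cod S δ] (u : δ → α) [Rec S u], Rec S (fun d => f (u d)) :=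
    fun u => Rec.comp f u
  haveI : ∀ {δ : Type u} [Cod S δ] (u : δ → α) [Rec S u], Rec S (fun d => g (u d)) :=
    fun u => Rec.comp g u
  refine Rec.of_graph _ ((inferInstance : Dec S fun x : α × M =>
    (p x.1 ∧ x.2 = f x.1) ∨ (¬ p x.1 ∧ x.2 = g x.1)).congr fun x => ?_)
  by_cases h : p x.1 <;> simp [h]

/-! ### Projections of pairs -/

open Classical in
/-- The first component of a pair, and `0` for numbers that are not pairs. -/
noncomputable def left (z : M) : M := if h : ∃ i j, z = pair i j then h.choose else 0

open Classical in
/-- The second component of a pair, and `0` for numbers that are not pairs. -/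
noncomputable def right (z : M) : M := if h : ∃ i j, z = pair i j then h.choose_spec.choose else 0

@[simp] theorem left_pair (i j : M) : left (pair i j) = i := by
  have h : ∃ i' j', pair i j = pair i' j' := ⟨i, j, rfl⟩
  rw [left, dif_pos h]
  exact (pair_inj.1 h.choose_spec.choose_spec).1.symm

@[simp] theorem right_pair (i j : M) : right (pair i j) = j := by
  have h : ∃ i' j', pair i j = pair i' j' := ⟨i, j, rfl⟩
  rw [right, dif_pos h]
  exact (pair_inj.1 h.choose_spec.choose_spec).2.symm

theorem left_of_not {z : M} (h : ¬ ∃ i j, z = pair i j) : left z = 0 := dif_neg h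

theorem right_of_not {z : M} (h : ¬ ∃ i j, z = pair i j) : right z = 0 := dif_neg h

theorem exists_pair_iff {z : M} {p : M → M → Prop} :
    (∃ i j, z = pair i j ∧ p i j) ↔ ∃ i ≤ z, ∃ j ≤ z, z = pair i j ∧ p i j := by
  constructor
  · rintro ⟨i, j, rfl, h⟩
    exact ⟨i, le_pair_left _ _, j, le_pair_right _ _, rfl, h⟩
  · rintro ⟨i, -, j, -, h⟩
    exact ⟨i, j, h⟩

instance fn1_left : Fn1 S (left : M → M) where
  rec' := by
    refine Rec.of_graph _ ((inferInstance : Dec S fun x : M × M =>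
      (∃ i, i ≤ x.1 ∧ ∃ j, j ≤ x.1 ∧ x.1 = pair i j ∧ x.2 = i) ∨
      ((¬ ∃ i, i ≤ x.1 ∧ ∃ j, j ≤ x.1 ∧ x.1 = pair i j ∧ True) ∧ x.2 = 0)).congr fun x => ?_)
    rw [← exists_pair_iff, ← exists_pair_iff]
    by_cases h : ∃ i j, x.1 = pair i j
    · obtain ⟨i, j, h⟩ := h
      simp [h, pair_inj, eq_comm]
    · rw [left_of_not h]
      simp only [not_exists] at h
      simp [h]

instance fn1_right : Fn1 S (right : M → M) where
  rec' := by
    refine Rec.of_graph _ ((inferInstance : Dec S fun x : M × M =>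
      (∃ i, i ≤ x.1 ∧ ∃ j, j ≤ x.1 ∧ x.1 = pair i j ∧ x.2 = j) ∨
      ((¬ ∃ i, i ≤ x.1 ∧ ∃ j, j ≤ x.1 ∧ x.1 = pair i j ∧ True) ∧ x.2 = 0)).congr fun x => ?_)
    rw [← exists_pair_iff, ← exists_pair_iff]
    by_cases h : ∃ i j, x.1 = pair i j
    · obtain ⟨i, j, h⟩ := h
      simp [h, pair_inj, eq_comm]
    · rw [right_of_not h]
      simp only [not_exists] at h
      simp [h]

theorem right_le (z : M) : right z ≤ z := by
  by_cases h : ∃ i j, z = pair i j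
  · obtain ⟨i, j, rfl⟩ := h
    simpa using le_pair_right i j
  · simp [right_of_not h]

/-- `z` is the code of a pair. -/
def IsPair (z : M) : Prop := z = pair (left z) (right z)

instance rel1_isPair : Rel1 S (IsPair : M → Prop) where
  dec := by
    unfold IsPair
    infer_instance

@[simp] theorem isPair_pair (i j : M) : IsPair (pair i j) := by simp [IsPair]

/-! ### Points of `P(ℕ)` as sets -/

/-- The finite set coded by `p` is contained in `Z`. -/
def Sub (p : M) (Z : Set M) : Prop := ∀ j, FinMem j p → j ∈ Z

theorem Sub.mono {p : M} {Z Z' : Set M} (h : Sub p Z) (hZ : Z ⊆ Z') : Sub p Z' :=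
  fun j hj => hZ (h j hj)

/-- The set of elements of the finite set coded by `c`. -/
def fin (c : M) : Set M := {j | FinMem j c}

theorem mem_fin {j c : M} : j ∈ fin c ↔ FinMem j c := Iff.rfl

theorem finSub_iff {c c' : M} : FinSub c c' ↔ Sub c (fin c') := Iff.rfl

theorem sub_iff {p : M} {Z : Set M} : Sub p Z ↔ ∀ j < p, FinMem j p → j ∈ Z :=
  ⟨fun h j _ hj => h j hj, fun h j hj => h j hj.lt hj⟩

instance Dec.sub (Z : Set M) [Fact (Z ∈ S)] (f : α → M) [Rec S f] :
    Dec S (fun a => Sub (f a) Z) :=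
  haveI : Rel1 S fun p : M => Sub p Z := ⟨(inferInstance : Dec S fun p : M =>
    ∀ j, j < p → FinMem j p → j ∈ Z).congr fun _ => sub_iff⟩
  Dec.rel1 (fun p : M => Sub p Z) f

instance rel2_sub_fin : Rel2 S (fun p c : M => Sub p (fin c)) :=
  ⟨(inferInstance : Dec S fun y : M × M =>
    ∀ j, j < y.1 → FinMem j y.1 → FinMem j y.2).congr fun _ => sub_iff⟩

instance rel2_finSub : Rel2 S (FinSub : M → M → Prop) := rel2_sub_fin

/-- The set represented by a point of `P(ℕ)`. -/
def un (x : M → M) : Set M := {n | ∃ i, FinMem n (x i)}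

theorem mem_un {x : M → M} {n : M} : n ∈ un x ↔ ∃ i, FinMem n (x i) := Iff.rfl

theorem finMem_mono {x : M → M} (hx : (powerSpace S).pt x) {i j n : M} (hij : i ≤ j)
    (h : FinMem n (x i)) : FinMem n (x j) := by
  rcases hij.lt_or_eq with hij | rfl
  · exact hx.2.2 i j hij n h
  · exact h

theorem fn1_of_isFun {f : M → M} (h : IsFun S f) : Fn1 S f := ⟨(isFun_iff f).1 h⟩

/-- A finite subset of an increasing union of finite sets is contained in one of them. -/
theorem exists_sub_of_mono (S : Set (Set M)) [Fact (RCA0 S)] {s : M → M} [Fn1 S s]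
    (hs : ∀ i j, i ≤ j → FinSub (s i) (s j)) {c : M} (h : Sub c (un s)) :
    ∃ i, Sub c (fin (s i)) := by
  obtain ⟨b, hb⟩ := bounding_mono S (p := fun j i => FinMem j c → FinMem j (s i)) inferInstance
    (fun j m m' hm h hj => hs m m' hm j (h hj)) c (fun j _ => by
      by_cases hj : FinMem j c
      · obtain ⟨i, hi⟩ := h j hj
        exact ⟨i, fun _ => hi⟩
      · exact ⟨0, fun h => (hj h).elim⟩)
  exact ⟨b, fun j hj => hb j hj.lt hj⟩

/-- A point lies in a basic open set if and only if the set it represents contains the finite set.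
-/
theorem mem_powerSpace {x : M → M} (hx : (powerSpace S).pt x) (p : M) :
    (powerSpace S).mem x p ↔ Sub p (un x) := by
  constructor
  · rintro ⟨i, hi⟩ j hj
    exact ⟨i, hi j hj⟩
  · intro h
    haveI := fn1_of_isFun hx.1
    exact exists_sub_of_mono S (fun i j hij n hn => finMem_mono hx hij hn) h

theorem powerSpace_eqv {x y : M → M} : (powerSpace S).eqv x y ↔ un x = un y := by
  rw [Set.ext_iff]
  rfl

/-- A `Σ⁰₁` set is represented by a point of `P(ℕ)`. -/
theorem exists_point_of_sigma {p : M → M → Prop} (hp : Dec S fun y : M × M => p y.1 y.2) :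
    ∃ x, (powerSpace S).pt x ∧ un x = {n | ∃ m, p n m} := by
  haveI : Rel2 S p := ⟨hp⟩
  obtain ⟨x, hx, hx'⟩ := exists_code_fn S (α := M) (p := fun i n => ∃ m, m ≤ i ∧ p n m)
    inferInstance (fun i => i + 1)
  refine ⟨x, ⟨(isFun_iff x).2 hx, fun i n h => ((hx' i n).1 h).1, fun i j hij n hn => ?_⟩, ?_⟩
  · rw [hx'] at hn ⊢
    obtain ⟨h1, m, hm, h2⟩ := hn
    exact ⟨h1.trans (by simpa using hij), m, hm.trans hij.le, h2⟩
  · ext n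
    simp only [mem_un, hx', Set.mem_ofPred_eq]
    constructor
    · rintro ⟨i, -, m, -, h⟩
      exact ⟨m, h⟩
    · rintro ⟨m, h⟩
      exact ⟨n + m, lt_add_one_iff.2 le_self_add, m, le_add_self, h⟩

theorem exists_point_of_mem {Z : Set M} (hZ : Z ∈ S) : ∃ x, (powerSpace S).pt x ∧ un x = Z := by
  haveI := Fact.mk hZ
  obtain ⟨x, hx, h⟩ := exists_point_of_sigma (S := S) (p := fun n _ => n ∈ Z) inferInstance
  refine ⟨x, hx, h.trans ?_⟩
  ext n
  exact ⟨fun ⟨_, h⟩ => h, fun h => ⟨0, h⟩⟩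

/-- The set `Z`, as a point of `P(ℕ)`, belongs to the subspace coded by `C`. -/
def InY (C : Pi02Code S) (Z : Set M) : Prop :=
  ∀ i, (∃ n p, pair i (pair n p) ∈ C.cl ∧ Sub p Z) → ∃ n p, pair i (pair n p) ∈ C.op ∧ Sub p Z

theorem space_pt_iff (C : Pi02Code S) (x : M → M) :
    C.space.pt x ↔ (powerSpace S).pt x ∧ InY C (un x) := by
  refine and_congr_right fun hx => forall_congr' fun i => ?_
  simp only [Pi02Code.InClosed, Pi02Code.InOpen, mem_powerSpace hx, ← imp_iff_not_or]

theorem exists_singleton_code (S : Set (Set M)) [Fact (RCA0 S)] {α : Type u} [Cod S α]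
    (f : α → M) [Rec S f] : ∃ s : α → M, Rec S s ∧ ∀ a i, FinMem i (s a) ↔ i = f a := by
  haveI : ∀ {δ : Type u} [Cod S δ] (u : δ → α) [Rec S u], Rec S (fun d => f (u d)) :=
    fun u => Rec.comp f u
  obtain ⟨s, hs, h⟩ := exists_code_fn S (p := fun a i => i = f a) inferInstance (fun a => f a + 1)
  refine ⟨s, hs, fun a i => (h a i).trans ⟨fun h => h.2, ?_⟩⟩
  rintro rfl
  exact ⟨lt_add_one_iff.2 le_rfl, rfl⟩

/-- The subspace of the sets `Z` such that for all `i`, if some `p ⊆ Z` satisfies `γ i p`, then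
some `w ∈ Z` satisfies `β i w`. -/
def ruleCode (S : Set (Set M)) [Fact (RCA0 S)] (γ β : M → M → Prop)
    (hγ : Rel2 S γ) (hβ : Rel2 S β) : Pi02Code S where
  op := {z | ∃ i n p, z = pair i (pair n p) ∧ ∃ w, FinMem w p ∧ β i w}
  cl := {z | ∃ i n p, z = pair i (pair n p) ∧ γ i p}
  op_mem := by
    have := Dec.setOf_mem (S := S) fun z : M => IsPair z ∧ IsPair (right z) ∧
      ∃ w, w < right (right z) ∧ FinMem w (right (right z)) ∧ β (left z) w
    convert this using 1
    ext z
    constructor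
    · rintro ⟨i, n, p, rfl, w, hw, h⟩
      simpa using ⟨w, hw.lt, hw, h⟩
    · rintro ⟨h1, h2, w, -, h⟩
      refine ⟨left z, left (right z), right (right z), ?_, w, h⟩
      rw [← h2]
      exact h1
  cl_mem := by
    have := Dec.setOf_mem (S := S) fun z : M => IsPair z ∧ IsPair (right z) ∧
      γ (left z) (right (right z))
    convert this using 1
    ext z
    constructor
    · rintro ⟨i, n, p, rfl, h⟩
      simpa using h
    · rintro ⟨h1, h2, h⟩
      refine ⟨left z, left (right z), right (right z), ?_, h⟩
      rw [← h2]
      exact h1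

theorem inY_ruleCode {γ β : M → M → Prop} {hγ : Rel2 S γ} {hβ : Rel2 S β} {Z : Set M} :
    InY (ruleCode S γ β hγ hβ) Z ↔ ∀ i, (∃ p, γ i p ∧ Sub p Z) → ∃ w, β i w ∧ w ∈ Z := by
  refine forall_congr' fun i => imp_congr ?_ ?_
  · constructor
    · rintro ⟨n, p, ⟨i', n', p', h, h'⟩, hp⟩
      obtain ⟨rfl, h2⟩ := pair_inj.1 h
      obtain ⟨rfl, rfl⟩ := pair_inj.1 h2
      exact ⟨p, h', hp⟩
    · rintro ⟨p, h, hp⟩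
      exact ⟨0, p, ⟨i, 0, p, rfl, h⟩, hp⟩
  · constructor
    · rintro ⟨n, p, ⟨i', n', p', h, w, hw, h'⟩, hp⟩
      obtain ⟨rfl, h2⟩ := pair_inj.1 h
      obtain ⟨rfl, rfl⟩ := pair_inj.1 h2
      exact ⟨w, h', hp w hw⟩
    · rintro ⟨w, h, hw⟩
      obtain ⟨s, -, hs⟩ := exists_singleton_code S (fun _ : M => w)
      refine ⟨0, s 0, ⟨i, 0, s 0, rfl, w, (hs _ _).2 rfl, h⟩, fun j hj => ?_⟩
      rw [(hs _ _).1 hj]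
      exact hw

/-! ### Arithmetical comprehension -/

/-- Arithmetical comprehension, as closure of `S` under one number quantifier. -/
def ACA (S : Set (Set M)) [Fact (RCA0 S)] : Prop :=
  ∀ p : M → M → Prop, Rel2 S p → Dec S fun n : M => ∃ m, p n m

/-- With arithmetical comprehension, unbounded quantifiers are allowed in `Dec`. The low priority
gives precedence to bounded quantifiers. -/
instance (priority := 500) Dec.ex [h : Fact (ACA S)] (p : α → M → Prop)
    [hp : Dec S fun y : α × M => p y.1 y.2] : Dec S (fun a => ∃ x, p a x) where
  mem := by
    haveI := Fact.mk hp.mem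
    have := h.out (fun n m => pair n m ∈ {z | ∃ a : α × M, z = Cod.enc S a ∧ p a.1 a.2})
      ⟨inferInstance⟩
    have := this.setOf_mem
    convert this using 1
    ext n
    constructor
    · rintro ⟨a, rfl, x, hx⟩
      exact ⟨x, (a, x), rfl, hx⟩
    · rintro ⟨x, ⟨a, x'⟩, h, hx⟩
      obtain ⟨rfl, -⟩ := pair_inj.1 h
      exact ⟨a, rfl, x', hx⟩

instance (priority := 500) Dec.all [Fact (ACA S)] (p : α → M → Prop)
    [hp : Dec S fun y : α × M => p y.1 y.2] : Dec S (fun a => ∀ x, p a x) :=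
  (inferInstance : Dec S fun a => ¬ ∃ x, ¬ p a x).congr fun a => by simp

theorem un_mem [Fact (ACA S)] {x : M → M} (hx : IsFun S x) : un x ∈ S := by
  haveI := fn1_of_isFun hx
  exact Dec.setOf_mem (S := S) fun n : M => ∃ i, FinMem n (x i)

end Points

section Reversal

variable {M : Type u} [Nums M] {S : Set (Set M)} [hS : Fact (RCA0 S)]
variable {α β γ : Type u} [Cod S α] [Cod S β] [Cod S γ]

/-! ### From deciding nonempty basic open sets to arithmetical comprehension -/

/-- For every `Π⁰₂`-subspace `C` of `P(ℕ)` the set of (codes of) finite sets `c` for which `N_c`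
meets `C` is `Σ⁰₁`, up to the distinction between points of `P(ℕ)`, which are `Σ⁰₁` sets, and sets
of the structure. -/
def Hub (S : Set (Set M)) [Fact (RCA0 S)] : Prop :=
  ∀ C : Pi02Code S, ∃ R ∈ S, (∀ c m, pair c m ∈ R → ∃ x, C.space.pt x ∧ Sub c (un x)) ∧
    ∀ Z ∈ S, InY C Z → ∀ c, Sub c Z → ∃ m, pair c m ∈ R

/-- Arithmetical comprehension from `Hub S`. The subspace used consists of the sets `Z` which with
`pair n m` contain `pair n (m + 1)`, and only contain `pair n m` if `p n m` fails. It has an element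
containing `pair n 0` if and only if `p n m` fails for all `m`, which therefore is a `Σ⁰₁` condition
on `n`. -/
theorem Hub.aca (h : Hub S) : ACA S := by
  intro p hp
  obtain ⟨R, hR, hsound, hcompl⟩ := h (ruleCode S (fun i q => FinMem i q)
    (fun i w => IsPair i ∧ ¬ p (left i) (right i) ∧ w = pair (left i) (right i + 1))
    inferInstance ⟨inferInstance⟩)
  obtain ⟨s, hs, hs'⟩ := exists_singleton_code S (α := M) (fun n => pair n 0)
  haveI : Fn1 S s := ⟨hs⟩
  haveI := Fact.mk hR
  refine Dec.of_delta p (fun n k => pair (s n) k ∉ R) (fun _ => Iff.rfl) fun n => ⟨?_, ?_⟩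
  · rintro ⟨m, hm⟩ k hk
    obtain ⟨x, hx, hsub⟩ := hsound _ _ hk
    haveI := fn1_of_isFun hx.1.1
    rw [space_pt_iff, inY_ruleCode] at hx
    have step : ∀ i, i ∈ un x → IsPair i ∧ ¬ p (left i) (right i) ∧
        pair (left i) (right i + 1) ∈ un x := by
      intro i hi
      obtain ⟨c, -, hc⟩ := exists_singleton_code S (fun _ : M => i)
      obtain ⟨w, ⟨h1, h2, rfl⟩, h3⟩ := hx.2 i ⟨c 0, (hc _ _).2 rfl, fun j hj => by
        rwa [(hc _ _).1 hj]⟩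
      exact ⟨h1, h2, h3⟩
    -- induction is available as `un x` is `Σ⁰₁`, even if it does not belong to `S`
    have all : ∀ m, pair n m ∈ un x := fun m => sigma_induction (S := S)
      (p := fun m i => FinMem (pair n m) (x i)) inferInstance
      (hsub _ ((hs' _ _).2 rfl)) (fun m hm => by
        simpa [mem_un] using (step (pair n m) hm).2.2) m
    exact absurd hm (by simpa using (step _ (all m)).2.1)
  · intro hk
    by_contra hn
    have hZ := Dec.setOf_mem (S := S) fun z : M => IsPair z ∧ left z = n
    have hZC : InY (ruleCode S (fun i q => FinMem i q)
        (fun i w => IsPair i ∧ ¬ p (left i) (right i) ∧ w = pair (left i) (right i + 1))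
        inferInstance ⟨inferInstance⟩) {z : M | IsPair z ∧ left z = n} := by
      rw [inY_ruleCode]
      rintro i ⟨q, hq, hqZ⟩
      obtain ⟨h1, rfl⟩ := hqZ i hq
      exact ⟨_, ⟨h1, fun h => hn ⟨_, h⟩, rfl⟩, by simp⟩
    obtain ⟨m, hm⟩ := hcompl _ hZ hZC (s n) fun j hj => by
      rw [(hs' _ _).1 hj]
      simp
    exact hk m hm

/-! ### Hintikka sets for arithmetical formulas -/

/-- The condition `C` on `H` is a conjunction of rules "if `π i ∈ H`, then some `w ∈ H` satisfies
`β i w`". -/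
def RuleDef (S : Set (Set M)) [Fact (RCA0 S)] (C : Set M → Prop) : Prop :=
  ∃ (π : M → M) (β : M → M → Prop), Fn1 S π ∧ Rel2 S β ∧
    ∀ H, C H ↔ ∀ i, π i ∈ H → ∃ w, β i w ∧ w ∈ H

theorem RuleDef.mk (π : M → M) (β : M → M → Prop) (hπ : Rec S π := by infer_instance)
    (hβ : Dec S fun y : M × M => β y.1 y.2 := by infer_instance) :
    RuleDef S fun H => ∀ i, π i ∈ H → ∃ w, β i w ∧ w ∈ H :=
  ⟨π, β, ⟨hπ⟩, ⟨hβ⟩, fun _ => Iff.rfl⟩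

theorem RuleDef.and {C D : Set M → Prop} (hC : RuleDef S C) (hD : RuleDef S D) :
    RuleDef S fun H => C H ∧ D H := by
  classical
  obtain ⟨π, β, hπ, hβ, hC⟩ := hC
  obtain ⟨π', β', hπ', hβ', hD⟩ := hD
  refine ⟨fun i => if left i = 0 then π (right i) else π' (right i),
    fun i w => (left i = 0 ∧ β (right i) w) ∨ (¬ left i = 0 ∧ β' (right i) w),
    ⟨inferInstance⟩, ⟨inferInstance⟩, fun H => ?_⟩
  simp only [hC, hD]
  constructor
  · rintro ⟨h1, h2⟩ i
    by_cases hi : left i = 0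
    · simpa [hi] using h1 (right i)
    · simpa [hi] using h2 (right i)
  · intro h
    exact ⟨fun i => by simpa using h (pair 0 i), fun i => by simpa using h (pair 1 i)⟩

/-- A rule-defined condition may be imposed on a column of `H`. -/
theorem RuleDef.column {C : Set M → Prop} (hC : RuleDef S C) (k : M) :
    RuleDef S fun H => C {z | pair k z ∈ H} := by
  obtain ⟨π, β, hπ, hβ, hC⟩ := hC
  refine ⟨fun i => pair k (π i), fun i w => IsPair w ∧ left w = k ∧ β i (right w),
    ⟨inferInstance⟩, ⟨inferInstance⟩, fun H => ?_⟩
  simp only [hC]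
  refine forall_congr' fun i => imp_congr Iff.rfl ⟨?_, ?_⟩
  · rintro ⟨w, h, hw⟩
    exact ⟨pair k w, by simpa using h, hw⟩
  · rintro ⟨w, ⟨h1, rfl, h2⟩, hw⟩
    exact ⟨right w, h2, by rwa [h1] at hw⟩

/-- A predicate `p a X` has Hintikka sets if there is a rule-defined class of sets `H` in which
`pair 0 a ∈ H`, `pair 1 a ∈ H`, `pair 2 t ∈ H`, `pair 3 t ∈ H` assert `p a X`, `¬ p a X`, `t ∈ X`,
`t ∉ X`: the assertions about `p` in such an `H` follow from its assertions about membership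
in `X`, and for every `X` there is an `H` whose assertions are exactly the true ones. -/
structure HasHintikka (S : Set (Set M)) [Fact (RCA0 S)] (p : M → Set M → Prop) : Prop where
  dec : ∀ X ∈ S, Dec S fun a => p a X
  rules : ∃ C, RuleDef S C ∧
    (∀ H X, C H → (∀ t, pair 2 t ∈ H → t ∈ X) → (∀ t, pair 3 t ∈ H → t ∉ X) →
      ∀ a, (pair 0 a ∈ H → p a X) ∧ (pair 1 a ∈ H → ¬ p a X)) ∧
    ∀ X ∈ S, ∃ H ∈ S, C H ∧ ∀ a, (pair 0 a ∈ H ↔ p a X) ∧ (pair 1 a ∈ H ↔ ¬ p a X) ∧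
      (pair 2 a ∈ H ↔ a ∈ X) ∧ (pair 3 a ∈ H ↔ a ∉ X)

theorem HasHintikka.congr {p q : M → Set M → Prop} (h : HasHintikka S p)
    (hpq : ∀ a X, q a X ↔ p a X) : HasHintikka S q := by
  rwa [show q = p from funext fun a => funext fun X => propext (hpq a X)]

/-- The set of the true assertions about `q` and `X`, together with the elements of `G` with
another tag. -/
def trueAssertions (q : M → Prop) (X G : Set M) : Set M :=
  {z | IsPair z ∧ ((left z = 0 ∧ q (right z)) ∨ (left z = 1 ∧ ¬ q (right z)) ∨
    (left z = 2 ∧ right z ∈ X) ∨ (left z = 3 ∧ right z ∉ X) ∨ (3 < left z ∧ z ∈ G))}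

theorem trueAssertions_mem {q : M → Prop} (hq : Dec S q) {X G : Set M} (hX : X ∈ S) (hG : G ∈ S) :
    trueAssertions q X G ∈ S := by
  haveI := Fact.mk hX
  haveI := Fact.mk hG
  haveI : Rel1 S q := ⟨hq⟩
  exact Dec.setOf_mem _

section
variable (q : M → Prop) (X G : Set M) (a : M)

theorem trueAssertions_zero : pair 0 a ∈ trueAssertions q X G ↔ q a := by
  simp [trueAssertions]

theorem trueAssertions_one : pair 1 a ∈ trueAssertions q X G ↔ ¬ q a := by
  have : ¬ (3 : M) < 1 := by norm_num
  simp [trueAssertions, this]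

theorem trueAssertions_two : pair 2 a ∈ trueAssertions q X G ↔ a ∈ X := by
  have : ¬ (3 : M) < 2 := by norm_num
  simp [trueAssertions, this]

theorem trueAssertions_three : pair 3 a ∈ trueAssertions q X G ↔ a ∉ X := by
  simp [trueAssertions]

theorem trueAssertions_of_lt {k : M} (hk : 3 < k) :
    pair k a ∈ trueAssertions q X G ↔ pair k a ∈ G := by
  have h0 : k ≠ 0 := by rintro rfl; simp at hk
  have h1 : k ≠ 1 := by rintro rfl; norm_num at hk
  have h2 : k ≠ 2 := by rintro rfl; norm_num at hk
  have h3 : k ≠ 3 := by rintro rfl; simp at hk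
  simp [trueAssertions, h0, h1, h2, h3, hk]

end

/-- Predicates not depending on `X`. -/
theorem HasHintikka.atom {r : M → Prop} (hr : Dec S r) : HasHintikka S fun a _ => r a := by
  haveI : Rel1 S r := ⟨hr⟩
  refine ⟨fun _ _ => hr, _, (RuleDef.mk (fun a => pair 0 a) (fun a w => r a ∧ w = pair 0 a)).and
      (.mk (fun a => pair 1 a) (fun a w => ¬ r a ∧ w = pair 1 a)),
    fun H X hH _ _ a => ⟨fun h => ?_, fun h => ?_⟩, fun X hX =>
    ⟨_, trueAssertions_mem hr hX hX, ⟨fun a h => ?_, fun a h => ?_⟩, fun a =>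
      ⟨trueAssertions_zero _ _ _ _, trueAssertions_one _ _ _ _, trueAssertions_two _ _ _ _,
        trueAssertions_three _ _ _ _⟩⟩⟩
  · obtain ⟨_, h, -⟩ := hH.1 a h
    exact h.1
  · obtain ⟨_, h, -⟩ := hH.2 a h
    exact h.1
  · exact ⟨_, ⟨(trueAssertions_zero _ _ _ _).1 h, rfl⟩, h⟩
  · exact ⟨_, ⟨(trueAssertions_one _ _ _ _).1 h, rfl⟩, h⟩

/-- The rules replace an assertion of the predicate by the one on membership of `f a` in `X`. -/
theorem HasHintikka.memSet {f : M → M} (hf : Rec S f) : HasHintikka S fun a X => f a ∈ X := by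
  haveI : Fn1 S f := ⟨hf⟩
  have hdec : ∀ X ∈ S, Dec S fun a => f a ∈ X := fun X hX => by
    haveI := Fact.mk hX
    infer_instance
  refine ⟨hdec, _, (RuleDef.mk (fun a => pair 0 a) (fun a w => w = pair 2 (f a))).and
      (.mk (fun a => pair 1 a) (fun a w => w = pair 3 (f a))),
    fun H X hH h2 h3 a => ⟨fun h => ?_, fun h => ?_⟩, fun X hX =>
    ⟨_, trueAssertions_mem (hdec X hX) hX hX, ⟨fun a h => ?_, fun a h => ?_⟩, fun a =>
      ⟨trueAssertions_zero _ _ _ _, trueAssertions_one _ _ _ _, trueAssertions_two _ _ _ _,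
        trueAssertions_three _ _ _ _⟩⟩⟩
  · obtain ⟨_, rfl, h⟩ := hH.1 a h
    exact h2 _ h
  · obtain ⟨_, rfl, h⟩ := hH.2 a h
    exact h3 _ h
  · exact ⟨_, rfl, (trueAssertions_two _ _ _ _).2 ((trueAssertions_zero _ _ _ a).1 h)⟩
  · exact ⟨_, rfl, (trueAssertions_three _ _ _ _).2 ((trueAssertions_one _ _ _ a).1 h)⟩

/-- All connectives and quantifiers are instances of this one: the quantifier `∀ y` is vacuous if
`f y a` does not depend on `y`.  The Hintikka sets for `p₁` and `p₂` are kept in the columns `4`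
and `5`; the tag `6` marks witnesses. -/
theorem HasHintikka.nand [Fact (ACA S)] {p₁ p₂ : M → Set M → Prop} (h₁ : HasHintikka S p₁)
    (h₂ : HasHintikka S p₂) {f : M → M → M} (hf : Fn2 S f) :
    HasHintikka S fun a X => ∀ y, ¬ (p₁ (f y a) X ∧ p₂ (f y a) X) := by
  have hdec : ∀ X ∈ S, Dec S fun a => ∀ y, ¬ (p₁ (f y a) X ∧ p₂ (f y a) X) := by
    intro X hX
    haveI : Rel1 S fun a => p₁ a X := ⟨h₁.dec X hX⟩
    haveI : Rel1 S fun a => p₂ a X := ⟨h₂.dec X hX⟩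
    haveI : Dec S fun z : M × M => p₁ (f z.2 z.1) X := Dec.rel1 (fun a => p₁ a X) _
    haveI : Dec S fun z : M × M => p₂ (f z.2 z.1) X := Dec.rel1 (fun a => p₂ a X) _
    infer_instance
  obtain ⟨C, hC, sC, cC⟩ := h₁.rules
  obtain ⟨D, hD, sD, cD⟩ := h₂.rules
  -- an assertion of the universal statement is justified by refuting a conjunct for every `y`
  have R0 := RuleDef.mk (S := S) (fun i => pair 0 (left i)) (fun i w =>
    w = pair 4 (pair 1 (f (right i) (left i))) ∨ w = pair 5 (pair 1 (f (right i) (left i))))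
  -- its negation is justified by a `y`, marked by `pair 6 (pair y a)`, with both conjuncts true
  have R1 := RuleDef.mk (S := S) (fun i => pair 1 i)
    (fun i w => IsPair w ∧ left w = 6 ∧ IsPair (right w) ∧ right (right w) = i)
  have R4 := RuleDef.mk (S := S) (fun i => pair 6 (pair (left i) (right i)))
    (fun i w => w = pair 4 (pair 0 (f (left i) (right i))))
  have R5 := RuleDef.mk (S := S) (fun i => pair 6 (pair (left i) (right i)))
    (fun i w => w = pair 5 (pair 0 (f (left i) (right i))))
  -- assertions about `X` made in a column are also made in `H` itself
  have T : ∀ k l : M, RuleDef S fun H => ∀ t, pair k (pair l t) ∈ H →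
      ∃ w, w = pair l t ∧ w ∈ H := fun k l =>
    RuleDef.mk (S := S) (fun t => pair k (pair l t)) (fun t w => w = pair l t)
  refine ⟨hdec, _, ((R0.and R1).and (R4.and R5)).and ((((T 4 2).and (T 4 3)).and
    ((T 5 2).and (T 5 3))).and ((hC.column 4).and (hD.column 5))), ?_, ?_⟩
  · rintro H X ⟨⟨⟨r0, r1⟩, r4, r5⟩, ⟨⟨t42, t43⟩, t52, t53⟩, hC4, hD5⟩ h2 h3 a
    have sC := sC _ X hC4 (fun t h => by obtain ⟨_, rfl, h⟩ := t42 t h; exact h2 t h)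
      (fun t h => by obtain ⟨_, rfl, h⟩ := t43 t h; exact h3 t h)
    have sD := sD _ X hD5 (fun t h => by obtain ⟨_, rfl, h⟩ := t52 t h; exact h2 t h)
      (fun t h => by obtain ⟨_, rfl, h⟩ := t53 t h; exact h3 t h)
    refine ⟨fun h y hy => ?_, fun h => ?_⟩
    · obtain ⟨w, hw, hwH⟩ := r0 (pair a y) (by simpa using h)
      simp only [left_pair, right_pair] at hw
      rcases hw with rfl | rfl
      · exact (sC _).2 hwH hy.1
      · exact (sD _).2 hwH hy.2
    · obtain ⟨w, ⟨w1, w2, w3, w4⟩, hwH⟩ := r1 a h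
      rw [w1, w2, w3, w4] at hwH
      intro hall
      refine hall (left (right w)) ⟨(sC _).1 ?_, (sD _).1 ?_⟩
      · obtain ⟨_, rfl, h⟩ := r4 (pair (left (right w)) a) (by simpa using hwH)
        simpa using h
      · obtain ⟨_, rfl, h⟩ := r5 (pair (left (right w)) a) (by simpa using hwH)
        simpa using h
  · intro X hX
    obtain ⟨H, hH, hCH, hHa⟩ := cC X hX
    obtain ⟨K, hK, hDK, hKa⟩ := cD X hX
    haveI := Fact.mk hH
    haveI := Fact.mk hK
    have n4 : (3 : M) < 4 := by norm_num
    have n5 : (3 : M) < 5 := by norm_num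
    have n6 : (3 : M) < 6 := by norm_num
    set q : M → Prop := fun a => ∀ y, ¬ (p₁ (f y a) X ∧ p₂ (f y a) X) with hq
    set G := {z | (left z = 4 ∧ right z ∈ H) ∨ (left z = 5 ∧ right z ∈ K) ∨
      (left z = 6 ∧ IsPair (right z) ∧ pair 0 (f (left (right z)) (right (right z))) ∈ H ∧
        pair 0 (f (left (right z)) (right (right z))) ∈ K)} with hGdef
    have hG : G ∈ S := Dec.setOf_mem _
    have e4 : ∀ z, pair 4 z ∈ trueAssertions q X G ↔ z ∈ H := fun z => by
      rw [trueAssertions_of_lt _ _ _ _ n4]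
      simp [hGdef]
    have e5 : ∀ z, pair 5 z ∈ trueAssertions q X G ↔ z ∈ K := fun z => by
      rw [trueAssertions_of_lt _ _ _ _ n5]
      simp [hGdef]
    have e6 : ∀ y a, pair 6 (pair y a) ∈ trueAssertions q X G ↔
        p₁ (f y a) X ∧ p₂ (f y a) X := fun y a => by
      rw [trueAssertions_of_lt _ _ _ _ n6, ← (hHa _).1, ← (hKa _).1]
      simp [hGdef]
    refine ⟨_, trueAssertions_mem (hdec X hX) hX hG, ⟨⟨⟨fun i h => ?_, fun i h => ?_⟩,
      fun i h => ?_, fun i h => ?_⟩, ⟨⟨fun t h => ?_, fun t h => ?_⟩, fun t h => ?_,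
      fun t h => ?_⟩, ?_, ?_⟩, fun a => ⟨trueAssertions_zero _ _ _ _, trueAssertions_one _ _ _ _,
      trueAssertions_two _ _ _ _, trueAssertions_three _ _ _ _⟩⟩
    · have := (trueAssertions_zero _ _ _ _).1 h (right i)
      rw [not_and_or, ← (hHa _).2.1, ← (hKa _).2.1, ← e4, ← e5] at this
      rcases this with h | h
      · exact ⟨_, Or.inl rfl, h⟩
      · exact ⟨_, Or.inr rfl, h⟩
    · have := (trueAssertions_one _ _ _ _).1 h
      push Not at this
      obtain ⟨y, hy⟩ := this
      exact ⟨pair 6 (pair y i), by simp, (e6 y i).2 hy⟩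
    · exact ⟨_, rfl, (e4 _).2 ((hHa _).1.2 ((e6 _ _).1 h).1)⟩
    · exact ⟨_, rfl, (e5 _).2 ((hKa _).1.2 ((e6 _ _).1 h).2)⟩
    · exact ⟨_, rfl, (trueAssertions_two _ _ _ _).2 ((hHa _).2.2.1.1 ((e4 _).1 h))⟩
    · exact ⟨_, rfl, (trueAssertions_three _ _ _ _).2 ((hHa _).2.2.2.1 ((e4 _).1 h))⟩
    · exact ⟨_, rfl, (trueAssertions_two _ _ _ _).2 ((hKa _).2.2.1.1 ((e5 _).1 h))⟩
    · exact ⟨_, rfl, (trueAssertions_three _ _ _ _).2 ((hKa _).2.2.2.1 ((e5 _).1 h))⟩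
    · convert hCH
      ext z
      exact e4 z
    · convert hDK
      ext z
      exact e5 z

theorem HasHintikka.neg [Fact (ACA S)] {p : M → Set M → Prop} (h : HasHintikka S p) :
    HasHintikka S fun a X => ¬ p a X :=
  (h.nand h (f := fun _ a => a) ⟨inferInstance⟩).congr fun a X => by simp

theorem HasHintikka.and [Fact (ACA S)] {p q : M → Set M → Prop} (hp : HasHintikka S p)
    (hq : HasHintikka S q) : HasHintikka S fun a X => p a X ∧ q a X :=
  ((hp.nand hq (f := fun _ a => a) ⟨inferInstance⟩).neg).congr fun a X => by simp

theorem NTerm.rec_val (t : NTerm) {ε : α → ℕ → M} (hε : ∀ n, Rec S fun a => ε a n) :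
    Rec S fun a => t.val (ε a) := by
  induction t with
  | var n => exact hε n
  | zero => exact Rec.const _
  | one => exact Rec.const _
  | add s t hs ht => exact Rec.add _ _
  | mul s t hs ht => exact Rec.mul _ _

theorem rec_push {f : α → M} (hf : Rec S f) {ε : α → ℕ → M} (hε : ∀ n, Rec S fun a => ε a n)
    (n : ℕ) : Rec S fun a => push (f a) (ε a) n := by
  cases n with
  | zero => exact hf
  | succ n => exact hε n

/-- An arithmetical formula has Hintikka sets, with respect to the set variable `0`. The number
variables are functions of one parameter `a`, so that quantification over a number variable can be
expressed by pairing its value with `a`. -/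
theorem hasHintikka_sat [Fact (ACA S)] {φ : Fml} (hφ : φ.Arithmetical) {E : ℕ → Set M}
    (hE : ∀ i, E i ∈ S) (ε : M → ℕ → M) (hε : ∀ n, Rec S fun a => ε a n) :
    HasHintikka S fun a X => Sat S φ (ε a) (push X E) := by
  induction φ generalizing ε with
  | eq s t =>
    haveI := s.rec_val hε
    haveI := t.rec_val hε
    exact .atom (inferInstance : Dec S fun a => s.val (ε a) = t.val (ε a))
  | lt s t =>
    haveI := s.rec_val hε
    haveI := t.rec_val hε
    exact .atom (inferInstance : Dec S fun a => s.val (ε a) < t.val (ε a))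
  | mem t k =>
    haveI := t.rec_val hε
    cases k with
    | zero => exact .memSet (t.rec_val hε)
    | succ k =>
      haveI := Fact.mk (hE k)
      exact .atom (inferInstance : Dec S fun a => t.val (ε a) ∈ E k)
  | neg φ ih => exact (ih hφ ε hε).neg
  | and φ ψ ih₁ ih₂ => exact (ih₁ hφ.1 ε hε).and (ih₂ hφ.2 ε hε)
  | ball t φ ih =>
    have hε' : ∀ n, Rec S fun z => ε (right z) n := fun n =>
      haveI := hε n
      Rec.comp (fun a => ε a n) right
    haveI := t.rec_val hε'
    refine ((HasHintikka.atom (inferInstance : Dec S fun z => left z < t.val (ε (right z)))).nand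
      (ih hφ (fun z => push (left z) (ε (right z))) (rec_push inferInstance hε')).neg
      (f := pair) ⟨inferInstance⟩).congr fun a X => ?_
    simp [Sat]
  | allN φ ih =>
    have hε' : ∀ n, Rec S fun z => ε (right z) n := fun n =>
      haveI := hε n
      Rec.comp (fun a => ε a n) right
    have := (ih hφ (fun z => push (left z) (ε (right z))) (rec_push inferInstance hε')).neg
    refine (this.nand this (f := pair) ⟨inferInstance⟩).congr fun a X => ?_
    simp [Sat]
  | allS φ => exact hφ.elim

/-- The subspace used consists of the Hintikka sets for `θ` whose assertions about `X` are
consistent. The formula `∀ X θ(n, X)` fails if and only if one of them contains `pair 1 n`: the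
assertions of such a set about `X` determine an `X` with `¬ θ(n, X)`. -/
theorem Hub.pi11CA0 (h : Hub S) : Pi11CA0 S := by
  haveI := Fact.mk h.aca
  refine ⟨hS.out, ?_⟩
  rintro φ ⟨θ, hθ, rfl⟩ e E hE
  obtain ⟨hdec, C, ⟨π, β, hπ, hβ, hC⟩, sound, compl⟩ := hasHintikka_sat hθ hE
    (fun a => push a e) (rec_push inferInstance fun n => Rec.const _)
  set code := ruleCode S (fun i q => (left i = 0 ∧ FinMem (π (right i)) q) ∨
    (left i = 1 ∧ FinMem (pair 2 (right i)) q ∧ FinMem (pair 3 (right i)) q))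
    (fun i w => left i = 0 ∧ β (right i) w) ⟨by infer_instance⟩ ⟨by infer_instance⟩
  have hY : ∀ Z, InY code Z ↔ C Z ∧ ∀ t, ¬ (pair 2 t ∈ Z ∧ pair 3 t ∈ Z) := by
    intro Z
    rw [inY_ruleCode, hC]
    constructor
    · refine fun h => ⟨fun i hi => ?_, fun t ht => ?_⟩
      · obtain ⟨c, -, hc⟩ := exists_singleton_code S (fun _ : M => π i)
        have := h (pair 0 i) ⟨c 0, Or.inl (by simpa using (hc 0 _).2 rfl), fun j hj => by
          rwa [(hc _ _).1 hj]⟩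
        simpa using this
      · obtain ⟨c, hc⟩ := exists_code S (p := fun j => j = pair 2 t ∨ j = pair 3 t) inferInstance
          (pair 2 t + pair 3 t + 1)
        obtain ⟨w, hw, -⟩ := h (pair 1 t) ⟨c, Or.inr (by
            simp only [left_pair, right_pair, hc, lt_add_one_iff]
            simp), fun j hj => by
          rcases ((hc _).1 hj).2 with rfl | rfl
          exacts [ht.1, ht.2]⟩
        simp at hw
    · rintro ⟨h1, h2⟩ i ⟨q, ⟨hi, hq⟩ | ⟨hi, hq, hq'⟩, hqZ⟩
      · obtain ⟨w, hw, hwZ⟩ := h1 (right i) (hqZ _ hq)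
        exact ⟨w, ⟨hi, hw⟩, hwZ⟩
      · exact (h2 _ ⟨hqZ _ hq, hqZ _ hq'⟩).elim
  obtain ⟨R, hR, hsound, hcompl⟩ := h code
  haveI := Fact.mk hR
  obtain ⟨s, hs, hs'⟩ := exists_singleton_code S (α := M) (fun n => pair 1 n)
  haveI : Fn1 S s := ⟨hs⟩
  convert Dec.setOf_mem (S := S) fun n : M => ∀ m, pair (s n) m ∉ R using 1
  ext n
  constructor
  · intro hn m hm
    obtain ⟨x, hx, hsub⟩ := hsound _ _ hm
    have hx1 := un_mem hx.1.1
    rw [space_pt_iff, hY] at hx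
    haveI := Fact.mk hx1
    refine (sound _ {t | pair 2 t ∈ un x} hx.2.1 (fun t ht => ht)
      (fun t ht ht' => hx.2.2 t ⟨ht', ht⟩) n).2 (hsub _ ((hs' _ _).2 rfl)) ?_
    exact hn _ (Dec.setOf_mem _)
  · intro hn X hX
    by_contra hsat
    obtain ⟨H, hH, hCH, hHa⟩ := compl X hX
    obtain ⟨m, hm⟩ := hcompl H hH ((hY _).2 ⟨hCH, fun t ht =>
      (hHa t).2.2.2.1 ht.2 ((hHa t).2.2.1.1 ht.1)⟩) (s n) fun j hj => by
        rw [(hs' _ _).1 hj]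
        exact (hHa n).2.1.2 hsat
    exact hn m hm

end Reversal

section Reals

variable {M : Type u} [Nums M] {S : Set (Set M)} [hS : Fact (RCA0 S)]
variable {α β γ : Type u} [Cod S α] [Cod S β] [Cod S γ]

/-! ### The ordered field of fractions -/

open scoped TensorProduct

variable (M) in
/-- The ring of differences of numbers. -/
def Diff : Type u := ℤ ⊗[ℕ] M

noncomputable instance : CommRing (Diff M) := inferInstanceAs (CommRing (ℤ ⊗[ℕ] M))

/-- The embedding of the numbers into the ring of differences. -/
noncomputable def toDiff : M →+* Diff M :=
  (Algebra.TensorProduct.includeRight : M →ₐ[ℕ] ℤ ⊗[ℕ] M).toRingHom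

theorem toDiff_injective : Function.Injective (toDiff : M → Diff M) := by
  let G := Algebra.GrothendieckAddGroup M
  let ψ : ℤ ⊗[ℕ] M →ₗ[ℕ] G := TensorProduct.lift (LinearMap.mk₂ ℕ
    (fun (z : ℤ) (m : M) => z • (Algebra.GrothendieckAddGroup.of m : G))
    (fun _ _ _ => add_smul _ _ _)
    (fun c z m => by simp [mul_smul])
    (fun z m n => by simp) (fun c z m => by
      simp only [map_nsmul]
      rw [smul_comm]))
  have h : ∀ m, ψ (toDiff m) = Algebra.GrothendieckAddGroup.of m := fun m =>
    (TensorProduct.lift.tmul (1 : ℤ) m).trans (one_smul ℤ _)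
  intro m n hmn
  apply Algebra.GrothendieckAddGroup.of_injective (M := M)
  rw [← h, ← h, hmn]

theorem exists_eq_sub (z : Diff M) : ∃ m n : M, z = toDiff m - toDiff n := by
  refine TensorProduct.induction_on (motive := fun z => ∃ m n : M, z = toDiff m - toDiff n) z
    ⟨0, 0, by simp; rfl⟩ (fun z m => ?_) ?_
  · obtain ⟨a, b, rfl⟩ : ∃ a b : ℕ, z = a - b := ⟨z.toNat, (-z).toNat, by omega⟩
    refine ⟨a • m, b • m, ?_⟩
    have : ∀ a : ℕ, toDiff (a • m) = (a : ℤ) ⊗ₜ[ℕ] m := fun a => by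
      have : toDiff (a • m) = (1 : ℤ) ⊗ₜ[ℕ] (a • m) := rfl
      rw [this, TensorProduct.tmul_smul, TensorProduct.smul_tmul', nsmul_one]
    rw [this, this]
    exact TensorProduct.sub_tmul _ _ _
  · rintro _ _ ⟨m, n, rfl⟩ ⟨m', n', rfl⟩
    refine ⟨m + m', n + n', ?_⟩
    rw [map_add, map_add]
    exact sub_add_sub_comm _ _ _ _

theorem eq_or_eq_neg (z : Diff M) : ∃ p : M, z = toDiff p ∨ z = -toDiff p := by
  obtain ⟨m, n, rfl⟩ := exists_eq_sub z
  rcases le_total m n with h | h <;> obtain ⟨p, rfl⟩ := exists_add_of_le h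
  · exact ⟨p, Or.inr (by rw [map_add]; ring)⟩
  · exact ⟨p, Or.inl (by rw [map_add]; ring)⟩

theorem toDiff_eq_zero {m : M} : toDiff m = 0 ↔ m = 0 :=
  map_eq_zero_iff _ toDiff_injective

instance : IsDomain (Diff M) := by
  haveI : Nontrivial (Diff M) := toDiff_injective.nontrivial
  haveI : NoZeroDivisors (Diff M) := ⟨by
    intro x y h
    obtain ⟨p, hp⟩ := eq_or_eq_neg x
    obtain ⟨q, hq⟩ := eq_or_eq_neg y
    have : toDiff (p * q) = 0 := by
      rw [map_mul]
      rcases hp with rfl | rfl <;> rcases hq with rfl | rfl <;> simpa using h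
    rw [toDiff_eq_zero] at this
    rcases mul_eq_zero.1 this with rfl | rfl
    · left; simpa using hp
    · right; simpa using hq⟩
  exact NoZeroDivisors.to_isDomain _

variable (M) in
/-- The field of fractions of numbers. -/
def Frac : Type u := FractionRing (Diff M)

noncomputable instance : Field (Frac M) := inferInstanceAs (Field (FractionRing (Diff M)))

/-- The embedding of the numbers into their field of fractions. -/
noncomputable def toFrac : M →+* Frac M := (algebraMap (Diff M) (FractionRing (Diff M))).comp toDiff

theorem toFrac_injective : Function.Injective (toFrac : M → Frac M) :=
  (IsFractionRing.injective (Diff M) (FractionRing (Diff M))).comp toDiff_injective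

theorem toFrac_eq_zero {m : M} : toFrac m = 0 ↔ m = 0 := map_eq_zero_iff _ toFrac_injective

/-- The nonnegative fractions, as the positive cone of the ordering of the field. -/
noncomputable def fracCone : RingCone (Frac M) where
  carrier := {x | ∃ a b : M, b ≠ 0 ∧ x * toFrac b = toFrac a}
  mul_mem' := by
    rintro x y ⟨a, b, hb, h⟩ ⟨a', b', hb', h'⟩
    refine ⟨a * a', b * b', mul_ne_zero hb hb', ?_⟩
    rw [map_mul, map_mul, ← h, ← h']
    ring
  one_mem' := ⟨1, 1, one_ne_zero, by simp⟩
  add_mem' := by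
    rintro x y ⟨a, b, hb, h⟩ ⟨a', b', hb', h'⟩
    refine ⟨a * b' + a' * b, b * b', mul_ne_zero hb hb', ?_⟩
    simp only [map_mul, map_add, ← h, ← h']
    ring
  zero_mem' := ⟨0, 1, one_ne_zero, by simp⟩
  eq_zero_of_mem_of_neg_mem' := by
    rintro x ⟨a, b, hb, h⟩ ⟨a', b', hb', h'⟩
    have : toFrac (a * b' + a' * b) = 0 := by
      simp only [map_mul, map_add, ← h, ← h']
      ring
    rw [toFrac_eq_zero, add_eq_zero, mul_eq_zero, or_iff_left hb'] at this
    rw [this.1, map_zero] at h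
    exact (mul_eq_zero.1 h).resolve_right (mt toFrac_eq_zero.1 hb)

instance : HasMemOrNegMem (fracCone : RingCone (Frac M)) where
  mem_or_neg_mem x := by
    obtain ⟨y, z, hz, hx⟩ := IsFractionRing.div_surjective (A := Diff M)
      (show FractionRing (Diff M) from x)
    obtain ⟨p, hp⟩ := eq_or_eq_neg y
    obtain ⟨q, hq⟩ := eq_or_eq_neg z
    have hz0 : z ≠ 0 := nonZeroDivisors.ne_zero hz
    have hq0 : q ≠ 0 := by
      rintro rfl
      simp at hq
      exact hz0 hq
    have hq1 : (toFrac q : Frac M) ≠ 0 := mt toFrac_eq_zero.1 hq0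
    have hx' : x = toFrac p / toFrac q ∨ -x = toFrac p / toFrac q := by
      have e : ∀ m : M, algebraMap (Diff M) (FractionRing (Diff M)) (toDiff m) = toFrac m :=
        fun _ => rfl
      have hx2 : x = algebraMap (Diff M) (FractionRing (Diff M)) y /
        algebraMap (Diff M) (FractionRing (Diff M)) z := hx.symm
      rcases hp with rfl | rfl <;> rcases hq with rfl | rfl <;>
        simp only [map_neg, e] at hx2
      · exact Or.inl hx2
      · exact Or.inr (by rw [hx2]; exact (neg_eq_iff_eq_neg.2 (div_neg _)))
      · exact Or.inr (by rw [hx2]; exact (neg_eq_iff_eq_neg.2 (neg_div _ _)))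
      · exact Or.inl (by rw [hx2]; exact neg_div_neg_eq _ _)
    rcases hx' with h | h
    · exact Or.inl ⟨p, q, hq0, by rw [h, div_mul_cancel₀ _ hq1]⟩
    · exact Or.inr ⟨p, q, hq0, by rw [h, div_mul_cancel₀ _ hq1]⟩

open Classical in
noncomputable instance : LinearOrder (Frac M) := LinearOrder.mkOfAddGroupCone fracCone

instance : IsOrderedRing (Frac M) := IsOrderedRing.mkOfCone fracCone

instance : IsStrictOrderedRing (Frac M) := inferInstance

theorem toFrac_nonneg (m : M) : 0 ≤ (toFrac m : Frac M) :=
  show toFrac m - 0 ∈ fracCone from ⟨m, 1, one_ne_zero, by simp⟩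

theorem toFrac_lt {m n : M} : (toFrac m : Frac M) < toFrac n ↔ m < n := by
  have : StrictMono (toFrac : M → Frac M) := by
    intro m n h
    obtain ⟨p, rfl⟩ := exists_add_of_le h.le
    have hp : p ≠ 0 := by rintro rfl; simp at h
    rw [map_add]
    have := (toFrac_nonneg p).lt_of_ne' (mt toFrac_eq_zero.1 hp)
    linarith
  exact this.lt_iff_lt

theorem toFrac_le {m n : M} : (toFrac m : Frac M) ≤ toFrac n ↔ m ≤ n := by
  rw [← not_lt, toFrac_lt, not_lt]

/-! ### Rational and real numbers -/

/-- The rational number coded by `q`, as an element of the field of fractions. -/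
noncomputable def Rat0.val (q : Rat0 M) : Frac M :=
  (toFrac q.pos - toFrac q.neg) / toFrac (q.den + 1)

theorem toFrac_succ_pos (n : M) : (0 : Frac M) < toFrac (n + 1) := by
  rw [← map_zero toFrac, toFrac_lt]
  exact zero_lt_one.trans_le le_add_self

theorem Rat0.lt_iff {q r : Rat0 M} : q.Lt r ↔ q.val < r.val := by
  rw [Rat0.Lt, ← toFrac_lt, Rat0.val, Rat0.val,
    div_lt_div_iff₀ (toFrac_succ_pos _) (toFrac_succ_pos _)]
  simp only [map_add, map_mul]
  constructor <;> intro h <;> linarith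

theorem Rat0.le_iff {q r : Rat0 M} : q.Le r ↔ q.val ≤ r.val := by
  rw [Rat0.Le, Rat0.lt_iff, not_lt]

@[simp] theorem Rat0.val_add (q r : Rat0 M) : (q.add r).val = q.val + r.val := by
  have h1 := (toFrac_succ_pos q.den).ne'
  have h2 := (toFrac_succ_pos r.den).ne'
  have e : (q.add r).den + 1 = (q.den + 1) * (r.den + 1) := by
    simp only [Rat0.add]
    ring
  rw [Rat0.val, e, map_mul, Rat0.val, Rat0.val, div_add_div _ _ h1 h2]
  congr 1
  simp only [Rat0.add, map_add, map_mul]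
  ring

@[simp] theorem Rat0.val_zero : (Rat0.zero : Rat0 M).val = 0 := by
  simp [Rat0.val, Rat0.zero]

theorem Rat0.code_inj {q r : Rat0 M} (h : q.code = r.code) : q = r := by
  obtain ⟨h1, h2⟩ := pair_inj.1 h
  obtain ⟨h3, h4⟩ := pair_inj.1 h1
  cases q
  cases r
  simp_all

theorem exists_pow (S : Set (Set M)) [Fact (RCA0 S)] : ∃ f : M → M, Rec S f ∧ f 0 = 1 ∧
    ∀ n, f (n + 1) = f n + f n := by
  obtain ⟨f, hf, h⟩ := exists_primrec S (fun _ : M => 1) (fun _ _ y => y + y)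
  exact ⟨f 0, Rec.comp (fun y : M × M => f y.1 y.2) (fun n => (0, n)), (h 0).1, (h 0).2⟩

/-- The powers of two. -/
noncomputable def pw (S : Set (Set M)) [Fact (RCA0 S)] : M → M := (exists_pow S).choose

instance : Fn1 S (pw S) := ⟨(exists_pow S).choose_spec.1⟩

@[simp] theorem pw_zero : pw S 0 = 1 := (exists_pow S).choose_spec.2.1

theorem pw_succ (n : M) : pw S (n + 1) = pw S n + pw S n := (exists_pow S).choose_spec.2.2 n

theorem lt_pw (n : M) : n < pw S n := by
  refine ind S (p := fun n => n < pw S n) inferInstance (by simp) (fun n hn => ?_) n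
  rw [pw_succ]
  exact add_lt_add_of_lt_of_le hn (by simpa using add_one_le_iff.2 (zero_le.trans_lt hn))

theorem pw_pos (n : M) : 0 < pw S n := zero_le.trans_lt (lt_pw n)

theorem isTwoPow_iff {k y : M} : IsTwoPow S k y ↔ y = pw S k := by
  constructor
  · rintro ⟨f, hf, h0, hs, rfl⟩
    haveI := fn1_of_isFun hf
    exact ind S (p := fun k => f k = pw S k) inferInstance (by simpa using h0)
      (fun n hn => by rw [hs, pw_succ, hn]) k
  · rintro rfl
    exact ⟨pw S, (isFun_iff _).2 inferInstance, pw_zero, pw_succ, rfl⟩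

theorem exists_pw_pred (S : Set (Set M)) [Fact (RCA0 S)] :
    ∃ f : M → M, Rec S f ∧ ∀ n, f n + 1 = pw S n := by
  obtain ⟨f, hf, h⟩ := exists_search S (p := fun n y : M => y + 1 = pw S n) (by infer_instance)
    (fun n => by
      rcases eq_zero_or_succ (pw S n) with h | ⟨m, hm⟩
      · exact absurd h (pw_pos n).ne'
      · exact ⟨m, hm.symm⟩)
  exact ⟨f, hf, fun n => (h n).1⟩

/-- `2 ^ k - 1`. -/
noncomputable def pwPred (S : Set (Set M)) [Fact (RCA0 S)] : M → M := (exists_pw_pred S).choose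

instance : Fn1 S (pwPred S) := ⟨(exists_pw_pred S).choose_spec.1⟩

theorem pwPred_add_one (n : M) : pwPred S n + 1 = pw S n := (exists_pw_pred S).choose_spec.2 n

/-- The rational number `2 ^ (-k)`. -/
noncomputable def halfPow (S : Set (Set M)) [Fact (RCA0 S)] (k : M) : Rat0 M := ⟨1, 0, pwPred S k⟩

theorem isHalfPow_iff {k : M} {h : Rat0 M} : IsHalfPow S k h ↔ h = halfPow S k := by
  simp only [IsHalfPow, isTwoPow_iff, ← pwPred_add_one, add_left_inj, halfPow]
  constructor
  · rintro ⟨y, rfl, rfl⟩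
    rfl
  · rintro rfl
    exact ⟨_, rfl, rfl⟩

/-- `2 ^ (-k)` as an element of the field of fractions. -/
noncomputable def hp (S : Set (Set M)) [Fact (RCA0 S)] (k : M) : Frac M := (toFrac (pw S k))⁻¹

@[simp] theorem val_halfPow (k : M) : (halfPow S k).val = hp S k := by
  simp [Rat0.val, halfPow, pwPred_add_one, hp]

theorem toFrac_pw_pos (k : M) : (0 : Frac M) < toFrac (pw S k) := by
  rw [← pwPred_add_one]
  exact toFrac_succ_pos _

theorem hp_pos (k : M) : 0 < hp S k := inv_pos.2 (toFrac_pw_pos k)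

theorem hp_succ (k : M) : hp S (k + 1) = hp S k / 2 := by
  rw [hp, hp, pw_succ, map_add, ← two_mul, mul_inv, div_eq_inv_mul]

theorem pw_mono {k l : M} (h : k ≤ l) : pw S k ≤ pw S l := by
  obtain ⟨d, rfl⟩ := exists_add_of_le h
  refine ind S (p := fun d => pw S k ≤ pw S (k + d)) inferInstance (by simp) (fun n hn => ?_) d
  rw [← add_assoc, pw_succ]
  exact hn.trans le_self_add

theorem hp_anti {k l : M} (h : k ≤ l) : hp S l ≤ hp S k :=
  inv_anti₀ (toFrac_pw_pos k) (toFrac_le.2 (pw_mono h))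

theorem lt_of_hp_lt {k l : M} (h : hp S l < hp S k) : k < l := by
  by_contra hkl
  exact absurd (hp_anti (S := S) (not_lt.1 hkl)) (not_le.2 h)

theorem exists_hp_lt (S : Set (Set M)) [Fact (RCA0 S)] {x : Frac M} (hx : 0 < x) :
    ∃ k, hp S k < x := by
  obtain ⟨a, b, hb, h⟩ : x - 0 ∈ fracCone := hx.le
  rw [sub_zero] at h
  have hb' : (0 : Frac M) < toFrac b := by
    rw [← map_zero toFrac, toFrac_lt]
    exact pos_iff_ne_zero.2 hb
  have ha : (1 : Frac M) ≤ toFrac a := by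
    rw [← map_one toFrac, toFrac_le, ← zero_add (1 : M), add_one_le_iff, ← toFrac_lt, map_zero, ← h]
    exact mul_pos hx hb'
  refine ⟨b, ?_⟩
  rw [hp, inv_lt_iff_one_lt_mul₀ (toFrac_pw_pos b)]
  exact ha.trans_lt (h ▸ mul_lt_mul_of_pos_left (toFrac_lt.2 (lt_pw b)) hx)

/-- The definitions concerning reals are rephrased in the ordered field of fractions, where linear
arithmetic is available. -/
theorem isReal_iff {u : M → Rat0 M} : IsReal S u ↔
    ∀ k i, (u k).val ≤ (u (k + i)).val + hp S k ∧ (u (k + i)).val ≤ (u k).val + hp S k := by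
  simp only [IsReal, isHalfPow_iff, forall_eq, Rat0.le_iff, Rat0.val_add, val_halfPow]

theorem IsReal.le {u : M → Rat0 M} (h : IsReal S u) {k m : M} (hkm : k ≤ m) :
    (u k).val ≤ (u m).val + hp S k ∧ (u m).val ≤ (u k).val + hp S k := by
  obtain ⟨i, rfl⟩ := exists_add_of_le hkm
  exact isReal_iff.1 h k i

theorem realLe_iff {u v : M → Rat0 M} : RealLe S u v ↔
    ∀ k, (u k).val ≤ (v k).val + 2 * hp S k := by
  simp only [RealLe, isHalfPow_iff, forall_eq, Rat0.le_iff, Rat0.val_add, val_halfPow, two_mul]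

theorem realLt_iff {u v : M → Rat0 M} : RealLt S u v ↔
    ∃ k, (u k).val + 2 * hp S k < (v k).val := by
  simp only [RealLt, isHalfPow_iff, exists_eq_left, Rat0.lt_iff, Rat0.val_add, val_halfPow, two_mul]

namespace QMetCode

variable (X : QMetCode S)

/-- `d(a, b) < r`, for `r` in the field of fractions. All computations with the distance use this
`Σ⁰₁` relation instead of the real number `d(a, b)`. -/
def DLt (a b : M) (r : Frac M) : Prop := ∃ k, (X.d a b k).val + 2 * hp S k < r

variable {X} {a b c : M} {r s : Frac M}

theorem DLt.mono (h : X.DLt a b r) (hrs : r ≤ s) : X.DLt a b s := by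
  obtain ⟨k, hk⟩ := h
  exact ⟨k, hk.trans_le hrs⟩

theorem dLt_self_add (k : M) : X.DLt a b ((X.d a b k).val + 3 * hp S k) :=
  ⟨k, by linarith [hp_pos (S := S) k]⟩

theorem DLt.eventually (ha : a ∈ X.A) (hb : b ∈ X.A) (h : X.DLt a b r) :
    ∃ k, ∀ m, k ≤ m → (X.d a b m).val + hp S k < r := by
  obtain ⟨k, hk⟩ := h
  exact ⟨k, fun m hm => by linarith [((X.d_real a ha b hb).le hm).2]⟩

theorem DLt.val_lt (ha : a ∈ X.A) (hb : b ∈ X.A) (h : X.DLt a b r) (m : M) :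
    (X.d a b m).val < r + hp S m := by
  obtain ⟨k, hk⟩ := h
  have hpk := hp_pos (S := S) k
  have hpm := hp_pos (S := S) m
  rcases le_total k m with hkm | hkm
  · linarith [((X.d_real a ha b hb).le hkm).2]
  · linarith [((X.d_real a ha b hb).le hkm).1]

theorem DLt.pos (ha : a ∈ X.A) (hb : b ∈ X.A) (h : X.DLt a b r) : 0 < r := by
  obtain ⟨k, hk⟩ := h
  have := realLe_iff.1 (X.d_nonneg a ha b hb) k
  simp only [realConst, Rat0.val_zero] at this
  linarith

theorem DLt.trans (ha : a ∈ X.A) (hb : b ∈ X.A) (hc : c ∈ X.A) (h : X.DLt a b r)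
    (h' : X.DLt b c s) : X.DLt a c (r + s) := by
  obtain ⟨k, hk⟩ := h.eventually ha hb
  obtain ⟨l, hl⟩ := h'.eventually hb hc
  have e : hp S (k + l + 1) ≤ hp S k / 2 := by
    rw [← hp_succ]
    exact hp_anti (by rw [add_right_comm]; exact le_self_add)
  have e' : hp S (k + l + 1) ≤ hp S l / 2 := by
    rw [← hp_succ]
    exact hp_anti (by rw [add_assoc]; exact le_add_self)
  refine ⟨k + l + 1, ?_⟩
  have h1 := hk (k + l + 1 + 1) (by rw [add_assoc, add_assoc]; exact le_self_add)
  have h2 := hl (k + l + 1 + 1) (by rw [add_assoc, add_comm k, add_assoc]; exact le_self_add)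
  have h3 := realLe_iff.1 (X.d_triangle a ha b hb c hc) (k + l + 1)
  simp only [realAdd, Rat0.val_add] at h3
  have h4 := hp_pos (S := S) k
  have h5 := hp_pos (S := S) l
  linarith

theorem DLt.exists_sub (ha : a ∈ X.A) (hb : b ∈ X.A) (h : X.DLt a b r) :
    ∃ k, X.DLt a b (r - hp S k) := by
  obtain ⟨k, hk⟩ := h.eventually ha hb
  refine ⟨k + 1, k + 1 + 1, ?_⟩
  have := hk (k + 1 + 1) (by rw [add_assoc]; exact le_self_add)
  rw [hp_succ, hp_succ]
  linarith

theorem dLt_self (ha : a ∈ X.A) (k : M) : X.DLt a a (hp S k) := by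
  have := realLe_iff.1 (X.d_self a ha).1 (k + 1 + 1 + 1)
  simp only [realConst, Rat0.val_zero] at this
  refine (dLt_self_add (k + 1 + 1 + 1)).mono ?_
  simp only [hp_succ] at this ⊢
  linarith [hp_pos (S := S) k]

variable (X) in
theorem pt_iff {x : M → M} : X.space.pt x ↔ IsFun S x ∧ (∀ n, x n ∈ X.A) ∧
    ∀ n m, n < m → X.DLt (x n) (x m) (hp S n) ∧ X.DLt (x m) (x n) (hp S n) := by
  simp only [space, isHalfPow_iff, forall_eq_apply_imp_iff, realLt_iff, DLt, realConst]
  refine and_congr_right fun _ => and_congr_right fun _ => forall_congr' fun n =>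
    forall_congr' fun m => ?_
  rw [val_halfPow]

theorem pt_const (ha : a ∈ X.A) : X.space.pt fun _ => a :=
  X.pt_iff.2 ⟨(isFun_iff _).2 inferInstance, fun _ => ha,
    fun n _ _ => ⟨dLt_self ha n, dLt_self ha n⟩⟩

theorem dLt_of_le {x : M → M} (hx : X.space.pt x) {n m : M} (h : n ≤ m) :
    X.DLt (x n) (x m) (hp S n) ∧ X.DLt (x m) (x n) (hp S n) := by
  obtain ⟨-, hA, hx⟩ := X.pt_iff.1 hx
  rcases h.lt_or_eq with h | rfl
  · exact hx n m h
  · exact ⟨dLt_self (hA n) n, dLt_self (hA n) n⟩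

/-- Membership in a ball in terms of an approximation to the point: since `d(x k, x)` is at most
`2 ^ (-k)`, it suffices that `x k` lies in the ball with the radius diminished by this number. -/
theorem mem_ball {x : M → M} (hx : X.space.pt x) {q : Rat0 M} :
    X.space.mem x (pair a q.code) ↔
      a ∈ X.A ∧ 0 < q.val ∧ ∃ k, X.DLt a (x k) (q.val - hp S k) := by
  obtain ⟨-, hA, -⟩ := X.pt_iff.1 hx
  have key : X.space.mem x (pair a q.code) ↔
      a ∈ X.A ∧ 0 < q.val ∧ ∃ k, (X.d a (x (k + 1 + 1)) (k + 1 + 1)).val + 2 * hp S k < q.val := by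
    simp only [space, realLt_iff, Rat0.lt_iff, Rat0.val_zero, dist, realConst]
    constructor
    · rintro ⟨a', q', h, h'⟩
      obtain ⟨rfl, hq⟩ := pair_inj.1 h
      cases Rat0.code_inj hq
      exact h'
    · exact fun h => ⟨a, q, rfl, h⟩
  rw [key]
  refine and_congr_right fun ha => and_congr_right fun hq => ⟨?_, ?_⟩
  · rintro ⟨k, hk⟩
    refine ⟨k + 1 + 1, (dLt_self_add (k + 1 + 1)).mono ?_⟩
    simp only [hp_succ]
    linarith [hp_pos (S := S) k]
  · rintro ⟨k, hk⟩
    obtain ⟨l, hl⟩ := hk.exists_sub ha (hA k)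
    set j := k + l + 1 + 1 with hj
    have e : hp S j ≤ hp S l / 4 := by
      have : hp S j ≤ hp S (l + 1 + 1) := hp_anti (by
        rw [hj, add_assoc k, add_assoc k]; exact le_add_self)
      simp only [hp_succ] at this
      linarith
    have h1 := hl.trans ha (hA k) (hA (j + 1 + 1 + 1 + 1)) (dLt_of_le hx (n := k)
      (m := j + 1 + 1 + 1 + 1) (by simp only [hj, add_assoc]; exact le_self_add)).1
    have h2 := h1.val_lt ha (hA _) (j + 1 + 1 + 1 + 1)
    refine ⟨j + 1 + 1, ?_⟩
    simp only [hp_succ] at h2 ⊢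
    linarith [hp_pos (S := S) j]

theorem mem_ball_const {q : Rat0 M} (hb : X.space.pt fun _ => b)
    (h : X.space.mem (fun _ => b) (pair a q.code)) : X.DLt a b q.val := by
  obtain ⟨-, -, k, hk⟩ := (mem_ball hb).1 h
  exact hk.mono (by linarith [hp_pos (S := S) k])

/-- The distance of two points is zero if and only if their terms become arbitrarily close. -/
theorem realEq_dist_iff {x y : M → M} (hx : X.space.pt x) (hy : X.space.pt y) :
    RealEq S (X.dist x y) (realConst Rat0.zero) ↔ ∀ k, ∃ j, k ≤ j ∧ X.DLt (x j) (y j) (hp S k) := by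
  have hxA := (X.pt_iff.1 hx).2.1
  have hyA := (X.pt_iff.1 hy).2.1
  simp only [RealEq, realLe_iff, realConst, Rat0.val_zero, dist]
  constructor
  · rintro ⟨h, -⟩ k
    refine ⟨k + 1 + 1 + 1 + 1 + 1, by simp only [add_assoc]; exact le_self_add,
      (dLt_self_add (k + 1 + 1 + 1 + 1 + 1)).mono ?_⟩
    have := h (k + 1 + 1 + 1)
    simp only [hp_succ] at this ⊢
    linarith [hp_pos (S := S) k]
  · refine fun h => ⟨fun k => ?_, fun k => ?_⟩
    · obtain ⟨j, hj, h⟩ := h (k + 1 + 1)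
      have h1 := (((dLt_of_le hx hj).1.trans (hxA _) (hxA _) (hyA _) h).trans (hxA _) (hyA _)
        (hyA _) (dLt_of_le hy hj).2).val_lt (hxA _) (hyA _) (k + 1 + 1)
      simp only [hp_succ] at h1 ⊢
      linarith [hp_pos (S := S) k]
    · have := realLe_iff.1 (X.d_nonneg _ (hxA (k + 1 + 1)) _ (hyA (k + 1 + 1))) (k + 1 + 1)
      simp only [realConst, Rat0.val_zero, hp_succ] at this
      linarith [hp_pos (S := S) k]

/-- One half of the transitivity of equality of points. -/
theorem eqv_trans_half {x y z : M → M} (hx : X.space.pt x) (hy : X.space.pt y)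
    (hz : X.space.pt z) (h : RealEq S (X.dist x y) (realConst Rat0.zero))
    (h' : RealEq S (X.dist y z) (realConst Rat0.zero)) :
    RealEq S (X.dist x z) (realConst Rat0.zero) := by
  have hxA := (X.pt_iff.1 hx).2.1
  have hyA := (X.pt_iff.1 hy).2.1
  have hzA := (X.pt_iff.1 hz).2.1
  rw [realEq_dist_iff hx hy] at h
  rw [realEq_dist_iff hy hz] at h'
  rw [realEq_dist_iff hx hz]
  intro k
  obtain ⟨i, hi, h⟩ := h (k + 1 + 1)
  obtain ⟨j, hj, h'⟩ := h' (k + 1 + 1)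
  refine ⟨i, le_trans (by rw [add_assoc]; exact le_self_add) hi, ?_⟩
  have hyy : X.DLt (y i) (y j) (hp S (k + 1 + 1)) := by
    rcases le_total i j with hij | hij
    · exact (dLt_of_le hy hij).1.mono (hp_anti hi)
    · exact (dLt_of_le hy hij).2.mono (hp_anti hj)
  have hzz : X.DLt (z j) (z i) (hp S (k + 1 + 1)) := by
    rcases le_total i j with hij | hij
    · exact (dLt_of_le hz hij).2.mono (hp_anti hi)
    · exact (dLt_of_le hz hij).1.mono (hp_anti hj)
  refine (((h.trans (hxA _) (hyA _) (hyA _) hyy).trans (hxA _) (hyA _) (hzA _) h').trans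
    (hxA _) (hzA _) (hzA _) hzz).mono ?_
  simp only [hp_succ]
  linarith [hp_pos (S := S) k]

variable (X) in
theorem basis_mem : X.space.basis ∈ S := by
  haveI := Fact.mk X.A_mem
  convert Dec.setOf_mem (S := S) fun w : M => IsPair w ∧ left w ∈ X.A ∧ IsPair (right w) ∧
    IsPair (left (right w)) ∧ right (left (right w)) < left (left (right w)) using 1
  ext w
  have hlt : ∀ q : Rat0 M, Rat0.zero.Lt q ↔ q.neg < q.pos := fun q => by
    simp [Rat0.Lt, Rat0.zero]
  constructor
  · rintro ⟨a, q, rfl, ha, hq⟩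
    rw [hlt] at hq
    simpa [Rat0.code] using ⟨ha, hq⟩
  · rintro ⟨h1, h2, h3, h4, h5⟩
    refine ⟨left w, ⟨left (left (right w)), right (left (right w)), right (right w)⟩, ?_, h2,
      (hlt _).2 h5⟩
    rw [Rat0.code, ← h4, ← h3, ← h1]

/-- A ball contains its center. -/
theorem mem_center {w : M} (hw : w ∈ X.space.basis) : ∃ x, X.space.pt x ∧ X.space.mem x w := by
  obtain ⟨a, q, rfl, ha, hq⟩ := hw
  rw [Rat0.lt_iff, Rat0.val_zero] at hq
  obtain ⟨k, hk⟩ := exists_hp_lt S hq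
  refine ⟨_, pt_const ha, (mem_ball (pt_const ha)).2 ⟨ha, hq, k + 1, (dLt_self ha (k + 1)).mono ?_⟩⟩
  rw [hp_succ]
  linarith

end QMetCode

end Reals

section HubSpaces

variable {M : Type u} [Nums M] {S : Set (Set M)} [hS : Fact (RCA0 S)]
variable {α β γ : Type u} [Cod S α] [Cod S β] [Cod S γ]

/-! ### Spaces whose basic open sets are all nonempty -/

/-- If `C` is homeomorphic to a space whose basic open sets are all nonempty, then it is a `Σ⁰₁`
condition that `N_c` meets `C`: the homeomorphism onto `C` has to send some basic open set
into `N_c`. -/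
theorem exists_hub_set {C : Pi02Code S} {X : Space M} (hb : X.basis ∈ S)
    (hne : ∀ U ∈ X.basis, ∃ y, X.pt y ∧ X.mem y U) (h : Homeomorphic S C.space X) :
    ∃ R ∈ S, (∀ c m, pair c m ∈ R → ∃ x, C.space.pt x ∧ Sub c (un x)) ∧
      ∀ Z ∈ S, InY C Z → ∀ c, Sub c Z → ∃ m, pair c m ∈ R := by
  obtain ⟨Φ, hΦ, Ψ, hΨ, tΦ, tΨ, h1, h2⟩ := h
  haveI := Fact.mk hb
  haveI := Fact.mk hΨ
  have key : ∀ c m, pair c m ∈ codes S (fun y : M × M => right y.2 ∈ X.basis ∧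
      pair (left y.2) (pair y.1 (right y.2)) ∈ Ψ) ↔
      right m ∈ X.basis ∧ pair (left m) (pair c (right m)) ∈ Ψ := fun c m =>
    enc_mem_codes (S := S) (a := (c, m))
  refine ⟨codes S (fun y : M × M => right y.2 ∈ X.basis ∧
    pair (left y.2) (pair y.1 (right y.2)) ∈ Ψ), Dec.codes_mem _, fun c m hcm => ?_,
    fun Z hZ hZC c hc => ?_⟩
  · obtain ⟨hU, hm⟩ := (key _ _).1 hcm
    obtain ⟨y, hy, hyU⟩ := hne _ hU
    obtain ⟨x, hx, hxy⟩ := tΨ y hy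
    exact ⟨x, hx, (mem_powerSpace hx.1 c).1 ((hxy c trivial).1 ⟨_, _, hU, hm, hyU⟩)⟩
  · obtain ⟨x, hx, rfl⟩ := exists_point_of_mem hZ
    have hx' : C.space.pt x := (space_pt_iff C x).2 ⟨hx, hZC⟩
    obtain ⟨y, hy, hxy⟩ := tΦ x hx'
    obtain ⟨x', hx1, hyx⟩ := tΨ y hy
    have e := powerSpace_eqv (S := S).1 (h1 x y x' hx' hy hx1 hxy hyx)
    obtain ⟨n, U, hU, hm, -⟩ := (hyx c trivial).2 ((mem_powerSpace hx1.1 c).2 (e ▸ hc))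
    exact ⟨pair n U, (key _ _).2 (by simpa using ⟨hU, hm⟩)⟩

/-- The poset given by a decidable preorder `r` on the numbers satisfying `G`. -/
def PosetCode.ofRel (S : Set (Set M)) [Fact (RCA0 S)] (G : M → Prop) (r : M → M → Prop)
    (hG : Dec S G) (hr : Rel2 S r) (refl : ∀ p, r p p) (trans : ∀ p q s, r p q → r q s → r p s) :
    PosetCode S where
  carrier := {p | G p}
  rel := codes S fun y : M × M => r y.1 y.2
  carrier_mem := Dec.setOf_mem _
  rel_mem := hr.dec.codes_mem
  refl p _ := (enc_mem_codes (S := S) (a := (p, p))).2 (refl p)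
  trans p _ q _ s _ h h' := (enc_mem_codes (S := S) (a := (p, s))).2 (trans p q s
    ((enc_mem_codes (S := S) (a := (p, q))).1 h) ((enc_mem_codes (S := S) (a := (q, s))).1 h'))

theorem PosetCode.ofRel_le {G : M → Prop} {r : M → M → Prop} {hG : Dec S G} {hr : Rel2 S r}
    {refl : ∀ p, r p p} {trans : ∀ p q s, r p q → r q s → r p s} {p q : M} :
    (PosetCode.ofRel S G r hG hr refl trans).Le p q ↔ r p q :=
  enc_mem_codes (S := S) (a := (p, q))

/-- A sequence representing a filter is decreasing. -/
theorem PosetCode.anti {P : PosetCode S} {y : M → M} (hy : P.UF.pt y) {i j : M} (hij : i ≤ j) :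
    P.Le (y j) (y i) := by
  haveI := fn1_of_isFun hy.1
  haveI := Fact.mk P.rel_mem
  obtain ⟨d, rfl⟩ := exists_add_of_le hij
  refine ind S (p := fun d => pair (y (i + d)) (y i) ∈ P.rel) inferInstance
    (by simpa using P.refl _ (hy.2.1 i)) (fun n hn => ?_) d
  have := hy.2.2.1 (i + n)
  rw [add_assoc] at this
  exact P.trans _ (hy.2.1 _) _ (hy.2.1 _) _ (hy.2.1 _) this hn

/-- Every element of a poset belongs to an unbounded filter. The filter is generated by the sequence
which at stage `n` moves to `n` if this is below the
current element. -/
theorem PosetCode.exists_unboundedFilter (P : PosetCode S) {p : M} (hp : p ∈ P.carrier) :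
    ∃ y, P.UF.pt y ∧ P.UF.mem y p := by
  classical
  haveI := Fact.mk P.carrier_mem
  haveI := Fact.mk P.rel_mem
  obtain ⟨f, hf, hf'⟩ := exists_primrec S (fun a : M => a)
    (fun _ n y => if n ∈ P.carrier ∧ pair n y ∈ P.rel ∧ pair y n ∉ P.rel then n else y)
  obtain ⟨h0, hs⟩ := hf' p
  have hA : ∀ n, f p n ∈ P.carrier := fun n => by
    haveI : Fn1 S (f p) := ⟨Rec.comp (fun y : M × M => f y.1 y.2) (fun n => (p, n))⟩
    refine ind S (p := fun n => f p n ∈ P.carrier) inferInstance (h0.symm ▸ hp) (fun n hn => ?_) n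
    rw [hs]
    split_ifs with h
    exacts [h.1, hn]
  refine ⟨f p, ⟨(isFun_iff _).2 (Rec.comp (fun y : M × M => f y.1 y.2) (fun n => (p, n))), hA,
    fun n => ?_, ?_⟩, hp, 0, h0.symm ▸ P.refl p hp⟩
  · rw [hs]
    split_ifs with h
    exacts [h.2.1, P.refl _ (hA n)]
  · rintro ⟨r, hr, hlt⟩
    -- a lower bound `r` would have been chosen at stage `r`
    have h1 := hlt (f p r) ⟨hA r, r, P.refl _ (hA r)⟩
    have h2 : f p (r + 1) = r := by
      rw [hs, if_pos ⟨hr, h1.1, h1.2⟩]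
    have h3 := hlt r ⟨hr, r + 1, h2.symm ▸ P.refl r hr⟩
    exact h3.2 h3.1

theorem hub_of_UF (h : ∀ Y : Pi02Code S, ∃ P : PosetCode S, Homeomorphic S Y.space P.UF) : Hub S :=
  fun C => by
    obtain ⟨P, hP⟩ := h C
    exact exists_hub_set (X := P.UF) P.carrier_mem (fun p hp => P.exists_unboundedFilter hp) hP

/-- An empty subspace `C` is treated separately; no basic open set meets it. -/
theorem hub_of_quasiPolish (h : ∀ Y : Pi02Code S, Y.space.Nonempty →
    ∃ X : QMetCode S, X.SmythComplete ∧ Homeomorphic S Y.space X.space) : Hub S := fun C => by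
  by_cases hC : C.space.Nonempty
  · obtain ⟨X, -, hX⟩ := h C hC
    exact exists_hub_set X.basis_mem (fun w hw => X.mem_center hw) hX
  · refine ⟨∅, Dec.setOf_mem (fun _ : M => False), fun _ _ h => h.elim, fun Z hZ hZC => ?_⟩
    obtain ⟨x, hx, rfl⟩ := exists_point_of_mem hZ
    exact (hC ⟨x, (space_pt_iff C x).2 ⟨hx, hZC⟩⟩).elim

/-! ### Witnesses for the clauses of a `Π⁰₂` code -/

/-- `v` witnesses that `Z` is not in the `i`-th closed set of `C`. -/
def CWit (C : Pi02Code S) (i v : M) (Z : Set M) : Prop :=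
  pair i v ∈ C.cl ∧ IsPair v ∧ Sub (right v) Z

/-- `w` witnesses that `Z` is in the `i`-th open set of `C`. -/
def OWit (C : Pi02Code S) (i w : M) (Z : Set M) : Prop :=
  pair i w ∈ C.op ∧ IsPair w ∧ Sub (right w) Z

theorem CWit.mono {C : Pi02Code S} {i v : M} {Z Z' : Set M} (h : CWit C i v Z) (hZ : Z ⊆ Z') :
    CWit C i v Z' := ⟨h.1, h.2.1, h.2.2.mono hZ⟩

theorem OWit.mono {C : Pi02Code S} {i w : M} {Z Z' : Set M} (h : OWit C i w Z) (hZ : Z ⊆ Z') :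
    OWit C i w Z' := ⟨h.1, h.2.1, h.2.2.mono hZ⟩

/-- The `i`-th clause of `C` *applies* to a set having a `CWit`, and requires it to have an
`OWit`. -/
theorem inY_iff {C : Pi02Code S} {Z : Set M} :
    InY C Z ↔ ∀ i, (∃ v, CWit C i v Z) → ∃ w, OWit C i w Z := by
  have key : ∀ (X : Set M) (i : M), (∃ n p, pair i (pair n p) ∈ X ∧ Sub p Z) ↔
      ∃ v, pair i v ∈ X ∧ IsPair v ∧ Sub (right v) Z := by
    intro X i
    constructor
    · rintro ⟨n, p, h, hp⟩
      exact ⟨pair n p, h, by simp, by simpa using hp⟩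
    · rintro ⟨v, h, hv, hp⟩
      exact ⟨left v, right v, hv ▸ h, hp⟩
  exact forall_congr' fun i => imp_congr (key _ _) (key _ _)

instance Dec.cwit_fin (C : Pi02Code S) (f g h : α → M) [Rec S f] [Rec S g] [Rec S h] :
    Dec S fun a => CWit C (f a) (g a) (fin (h a)) :=
  haveI := Fact.mk C.cl_mem
  (inferInstance : Dec S fun a => pair (f a) (g a) ∈ C.cl ∧ IsPair (g a) ∧
    FinSub (right (g a)) (h a))

instance Dec.cwit (C : Pi02Code S) (Z : Set M) [Fact (Z ∈ S)] (f g : α → M) [Rec S f] [Rec S g] :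
    Dec S fun a => CWit C (f a) (g a) Z :=
  haveI := Fact.mk C.cl_mem
  (inferInstance : Dec S fun a => pair (f a) (g a) ∈ C.cl ∧ IsPair (g a) ∧ Sub (right (g a)) Z)

instance Dec.owit_fin (C : Pi02Code S) (f g h : α → M) [Rec S f] [Rec S g] [Rec S h] :
    Dec S fun a => OWit C (f a) (g a) (fin (h a)) :=
  haveI := Fact.mk C.op_mem
  (inferInstance : Dec S fun a => pair (f a) (g a) ∈ C.op ∧ IsPair (g a) ∧
    FinSub (right (g a)) (h a))

instance Dec.owit (C : Pi02Code S) (Z : Set M) [Fact (Z ∈ S)] (f g : α → M) [Rec S f] [Rec S g] :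
    Dec S fun a => OWit C (f a) (g a) Z :=
  haveI := Fact.mk C.op_mem
  (inferInstance : Dec S fun a => pair (f a) (g a) ∈ C.op ∧ IsPair (g a) ∧ Sub (right (g a)) Z)

/-- Elements of a coded finite set are smaller than the code. -/
theorem sub_of_lt {p k : M} {Z : Set M} (h : Sub p Z) (hp : p ≤ k) : Sub p {i | i < k ∧ i ∈ Z} :=
  fun j hj => ⟨hj.lt.trans_le hp, h j hj⟩

/-- For `Z ∈ C` the clauses below `k` which apply to `Z` because of a witness below `k` are
satisfied by an initial segment of `Z`. -/
theorem exists_segment {C : Pi02Code S} {Z : Set M} (hZ : Z ∈ S) (hC : InY C Z) (k b : M) :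
    ∃ k', k < k' ∧ b ≤ k' ∧ ∀ i < k, (∃ v < k, CWit C i v Z) →
      ∃ w < k', OWit C i w {j | j < k' ∧ j ∈ Z} := by
  haveI := Fact.mk hZ
  obtain ⟨B, hB⟩ := bounding S (p := fun i w => (∃ v, v < k ∧ CWit C i v Z) → OWit C i w Z)
    inferInstance k (fun i _ => by
      by_cases h : ∃ v, v < k ∧ CWit C i v Z
      · obtain ⟨v, -, hv⟩ := h
        obtain ⟨w, hw⟩ := inY_iff.1 hC i ⟨v, hv⟩
        exact ⟨w, fun _ => hw⟩
      · exact ⟨0, fun h' => (h h').elim⟩)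
  refine ⟨k + B + b + 1, lt_add_one_iff.2 (by rw [add_assoc]; exact le_self_add),
    by rw [add_assoc, add_comm b, ← add_assoc]; exact le_add_self, fun i hi h => ?_⟩
  obtain ⟨w, hw, hw'⟩ := hB i hi
  have hle : B ≤ k + B + b + 1 := by
    rw [add_assoc, add_assoc, add_left_comm]
    exact le_self_add
  have ho := hw' h
  exact ⟨w, hw.trans_le hle, ho.1, ho.2.1, sub_of_lt ho.2.2 ((right_le w).trans (hw.le.trans hle))⟩

/-- Initial segments of an element `Z` of `C`, each of which satisfies the clauses of `C` below the
length of the preceding one. -/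
theorem exists_segments {C : Pi02Code S} {Z : Set M} (hZ : Z ∈ S) (hC : InY C Z) (b : M) :
    ∃ t L : M → M, Fn1 S t ∧ Fn1 S L ∧ (∀ k, fin (t k) = {i | i < k ∧ i ∈ Z}) ∧ L 0 = 0 ∧
      (∀ j, j ≤ L j) ∧ ∀ j, L j < L (j + 1) ∧ b ≤ L (j + 1) ∧
        ∀ i < L j, (∃ v < L j, CWit C i v Z) →
          ∃ w < L (j + 1), OWit C i w (fin (t (L (j + 1)))) := by
  haveI := Fact.mk hZ
  obtain ⟨t, ht, htZ⟩ := exists_code_fn S (α := M) (p := fun _ i => i ∈ Z) inferInstance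
    (fun k => k)
  haveI : Fn1 S t := ⟨ht⟩
  have hfin : ∀ k, fin (t k) = {i | i < k ∧ i ∈ Z} := fun k => Set.ext fun i => htZ k i
  obtain ⟨g, hg, hgood⟩ := exists_search S (p := fun k k' => k < k' ∧ b ≤ k' ∧ ∀ i, i < k →
    (∃ v, v < k ∧ CWit C i v Z) → ∃ w, w < k' ∧ OWit C i w (fin (t k'))) inferInstance (fun k => by
      obtain ⟨k', h1, h2, h3⟩ := exists_segment hZ hC k b
      refine ⟨k', h1, h2, fun i hi ⟨v, hv, hv'⟩ => ?_⟩
      rw [hfin]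
      exact h3 i hi ⟨v, hv, hv'⟩)
  haveI : Fn1 S g := ⟨hg⟩
  obtain ⟨K, hK, hKs⟩ := exists_primrec S (fun _ : M => (0 : M)) (fun _ _ k => g k)
  obtain ⟨hK0, hKs⟩ := hKs 0
  haveI : Fn1 S (K 0) := ⟨Rec.comp (fun y : M × M => K y.1 y.2) (fun n => (0, n))⟩
  refine ⟨t, K 0, inferInstance, inferInstance, hfin, hK0, fun j => ?_, fun j => ?_⟩
  · refine ind S (p := fun j => j ≤ K 0 j) inferInstance zero_le (fun j hj => ?_) j
    rw [hKs]
    exact add_one_le_iff.2 (hj.trans_lt (hgood _).1.1)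
  · rw [hKs]
    exact (hgood _).1

end HubSpaces

section HubUF

variable {M : Type u} [Nums M] {S : Set (Set M)} [hS : Fact (RCA0 S)]
variable {α β γ : Type u} [Cod S α] [Cod S β] [Cod S γ]

/-! ### Computing with the distances of a quasi-metric space -/

/-- The rational number with code `z`. -/
noncomputable def ratOf (z : M) : Rat0 M := ⟨left (left z), right (left z), right z⟩

@[simp] theorem ratOf_code (q : Rat0 M) : ratOf q.code = q := by
  simp [ratOf, Rat0.code]

namespace QMetCode

variable {X : QMetCode S}

theorem basis_eq {w : M} (hw : w ∈ X.space.basis) : w = pair (left w) (ratOf (right w)).code ∧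
    left w ∈ X.A ∧ 0 < (ratOf (right w)).val := by
  obtain ⟨a, r, rfl, ha, hr⟩ := hw
  rw [Rat0.lt_iff, Rat0.val_zero] at hr
  simpa using ⟨ha, hr⟩

theorem mem_const_iff {w a : M} (hw : w ∈ X.space.basis) (ha : a ∈ X.A) :
    X.space.mem (fun _ => a) w ↔ X.DLt (left w) a (ratOf (right w)).val := by
  obtain ⟨e, hA, hr⟩ := basis_eq hw
  rw [e]
  constructor
  · intro h
    simpa using mem_ball_const (pt_const ha) h
  · intro h
    simp only [left_pair, right_pair, ratOf_code] at h
    exact (mem_ball (pt_const ha)).2 ⟨hA, hr, h.exists_sub hA ha⟩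

theorem rec_code (X : QMetCode S) : Rec S fun y : (M × M) × M => (X.d y.1.1 y.1.2 y.2).code where
  mem := by
    convert X.d_mem using 1
    ext z
    constructor
    · rintro ⟨⟨⟨a, b⟩, k⟩, rfl⟩
      exact ⟨a, b, k, rfl⟩
    · rintro ⟨a, b, k, rfl⟩
      exact ⟨((a, b), k), rfl⟩

instance dec_lt (X : QMetCode S) (f g k r : α → M) [Rec S f] [Rec S g] [Rec S k] [Rec S r] :
    Dec S fun a => (X.d (f a) (g a) (k a)).val + 2 * hp S (k a) < (ratOf (r a)).val := by
  haveI := X.rec_code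
  haveI h : Rec S fun a => (X.d (f a) (g a) (k a)).code :=
    Rec.comp (fun y : (M × M) × M => (X.d y.1.1 y.1.2 y.2).code) fun a => ((f a, g a), k a)
  haveI : Rec S fun a => left (left (X.d (f a) (g a) (k a)).code) := inferInstance
  haveI : Rec S fun a => right (left (X.d (f a) (g a) (k a)).code) := inferInstance
  haveI : Rec S fun a => right (X.d (f a) (g a) (k a)).code := inferInstance
  have key : Dec S fun a => Rat0.Lt ((ratOf (X.d (f a) (g a) (k a)).code).add
      ((halfPow S (k a)).add (halfPow S (k a)))) (ratOf (r a)) := by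
    simp only [Rat0.Lt, Rat0.add, ratOf, halfPow]
    infer_instance
  refine key.congr fun a => ?_
  rw [ratOf_code, Rat0.lt_iff, Rat0.val_add, Rat0.val_add, val_halfPow, two_mul]

instance dec_gt (X : QMetCode S) (f g k : α → M) [Rec S f] [Rec S g] [Rec S k] :
    Dec S fun a => 2 * hp S (k a) < (X.d (f a) (g a) (k a)).val := by
  haveI := X.rec_code
  haveI h : Rec S fun a => (X.d (f a) (g a) (k a)).code :=
    Rec.comp (fun y : (M × M) × M => (X.d y.1.1 y.1.2 y.2).code) fun a => ((f a, g a), k a)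
  haveI : Rec S fun a => left (left (X.d (f a) (g a) (k a)).code) := inferInstance
  haveI : Rec S fun a => right (left (X.d (f a) (g a) (k a)).code) := inferInstance
  haveI : Rec S fun a => right (X.d (f a) (g a) (k a)).code := inferInstance
  have key : Dec S fun a => Rat0.Lt ((halfPow S (k a)).add (halfPow S (k a)))
      (ratOf (X.d (f a) (g a) (k a)).code) := by
    simp only [Rat0.Lt, Rat0.add, ratOf, halfPow]
    infer_instance
  refine key.congr fun a => ?_
  rw [ratOf_code, Rat0.lt_iff, Rat0.val_add, val_halfPow, two_mul]

end QMetCode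

/-! ### The poset of attempts to find a point of a `Π⁰₂`-subspace -/

section Attempts

/-- Kind of an attempt: `0` for a proper attempt, anything else for a dummy. -/
noncomputable def aKind (u : M) : M := left (left u)

/-- The code of the finite set which the attempt intends to extend to a point. -/
noncomputable def aGoal (u : M) : M := right (left u)

/-- The stage of an attempt. -/
noncomputable def aStage (u : M) : M := left (right u)

/-- The code of the finite set constructed by an attempt. -/
noncomputable def aSet (u : M) : M := right (right u)

instance : Fn1 S (aKind : M → M) := ⟨by unfold aKind; infer_instance⟩
instance : Fn1 S (aGoal : M → M) := ⟨by unfold aGoal; infer_instance⟩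
instance : Fn1 S (aStage : M → M) := ⟨by unfold aStage; infer_instance⟩
instance : Fn1 S (aSet : M → M) := ⟨by unfold aSet; infer_instance⟩

/-- The attempt with the given components. -/
def attempt (f n k c : M) : M := pair (pair f n) (pair k c)

@[simp] theorem aKind_attempt (f n k c : M) : aKind (attempt f n k c) = f := by
  simp [aKind, attempt]
@[simp] theorem aGoal_attempt (f n k c : M) : aGoal (attempt f n k c) = n := by
  simp [aGoal, attempt]
@[simp] theorem aStage_attempt (f n k c : M) : aStage (attempt f n k c) = k := by
  simp [aStage, attempt]
@[simp] theorem aSet_attempt (f n k c : M) : aSet (attempt f n k c) = c := by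
  simp [aSet, attempt]

variable (C : Pi02Code S)

/-- The proper attempt `u'` is a later stage of the proper attempt `u`. -/
def Extends (u' u : M) : Prop :=
  aStage u < aStage u' ∧ FinSub (aSet u) (aSet u') ∧ FinSub (aGoal u) (aSet u') ∧
    ∀ i, i < aStage u → (∃ v, v < aStage u ∧ CWit C i v (fin (aSet u'))) →
      ∃ w, w < aStage u' ∧ OWit C i w (fin (aSet u'))

/-- The ordering of attempts. Below every attempt there are dummies of the same goal, but no proper
attempt is below a dummy. Dummies are compared by their stages only, so that every two of them with
the same goal are comparable. -/
def ALe (u' u : M) : Prop :=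
  u' = u ∨ (aGoal u' = aGoal u ∧ ((aKind u' = 0 ∧ aKind u = 0 ∧ Extends C u' u) ∨
    (aKind u' ≠ 0 ∧ aStage u ≤ aStage u')))

theorem Extends.trans {C : Pi02Code S} {u v w : M} (huv : Extends C u v) (hvw : Extends C v w) :
    Extends C u w := by
  refine ⟨hvw.1.trans huv.1, fun j hj => huv.2.1 j (hvw.2.1 j hj),
    fun j hj => huv.2.1 j (hvw.2.2.1 j hj), fun i hi ⟨v, hv, h⟩ => ?_⟩
  exact huv.2.2.2 i (hi.trans hvw.1) ⟨v, hv.trans hvw.1, h⟩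

theorem ALe.trans {C : Pi02Code S} {u v w : M} (huv : ALe C u v) (hvw : ALe C v w) :
    ALe C u w := by
  rcases huv with rfl | ⟨hg, h⟩
  · exact hvw
  rcases hvw with rfl | ⟨hg', h'⟩
  · exact Or.inr ⟨hg, h⟩
  refine Or.inr ⟨hg.trans hg', ?_⟩
  rcases h with ⟨h1, h2, h3⟩ | ⟨h1, h2⟩
  · rcases h' with ⟨h4, h5, h6⟩ | ⟨h4, h5⟩
    · exact Or.inl ⟨h1, h5, h3.trans h6⟩
    · exact (h4 h2).elim
  · rcases h' with ⟨h4, h5, h6⟩ | ⟨h4, h5⟩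
    · exact Or.inr ⟨h1, h6.1.le.trans h2⟩
    · exact Or.inr ⟨h1, h5.trans h2⟩

instance rel2_ALe : Rel2 S (ALe C) := ⟨by
  unfold ALe Extends
  infer_instance⟩

/-- The poset of attempts to extend finite sets to points of `C`. -/
def attempts : PosetCode S :=
  .ofRel S (fun _ => True) (ALe C) inferInstance inferInstance (fun _ => Or.inl rfl)
    fun _ _ _ => ALe.trans

variable {C}

theorem attempts_le {u v : M} : (attempts C).Le u v ↔ ALe C u v := PosetCode.ofRel_le

theorem attempts_mem {y : M → M} {u : M} : (attempts C).UF.mem y u ↔ ∃ i, ALe C (y i) u := by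
  simp only [PosetCode.UF, PosetCode.InFilter, attempts_le]
  exact and_iff_right trivial

theorem attempts_lt {u v : M} : (attempts C).Lt u v ↔ ALe C u v ∧ ¬ ALe C v u := by
  simp only [PosetCode.Lt, attempts_le]

theorem attempts_anti {y : M → M} (hy : (attempts C).UF.pt y) {i j : M} (hij : i ≤ j) :
    ALe C (y j) (y i) :=
  attempts_le.1 (PosetCode.anti hy hij)

theorem ALe.goal_eq {u v : M} (h : ALe C u v) : aGoal u = aGoal v := by
  rcases h with rfl | h
  exacts [rfl, h.1]

theorem ALe.stage_le {u v : M} (h : ALe C u v) : aStage v ≤ aStage u := by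
  rcases h with rfl | ⟨-, ⟨-, -, h⟩ | ⟨-, h⟩⟩
  exacts [le_rfl, h.1.le, h]

theorem goal_eq_of_pt {y : M → M} (hy : (attempts C).UF.pt y) (i : M) :
    aGoal (y i) = aGoal (y 0) := (attempts_anti hy (zero_le (a := i))).goal_eq

/-- The stages of the elements of an unbounded filter are unbounded, since a dummy of a higher
stage would be a lower bound otherwise. -/
theorem exists_stage_gt {y : M → M} (hy : (attempts C).UF.pt y) (K : M) :
    ∃ i, K < aStage (y i) := by
  by_contra! hK
  refine hy.2.2.2 ⟨attempt 1 (aGoal (y 0)) (K + 1) 0, trivial, fun u hu => ?_⟩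
  obtain ⟨i, hi⟩ := attempts_mem.1 hu
  have h1 : ALe C (attempt 1 (aGoal (y 0)) (K + 1) 0) (y i) := by
    refine Or.inr ⟨by simp [goal_eq_of_pt hy i], Or.inr ⟨by simp, ?_⟩⟩
    rw [aStage_attempt]
    exact (hK i).trans le_self_add
  refine attempts_lt.2 ⟨h1.trans hi, fun h2 => ?_⟩
  have := (hi.trans h2).stage_le
  rw [aStage_attempt] at this
  exact absurd (add_one_le_iff.1 this) (not_lt.2 (hK i))

/-- An unbounded filter containing a dummy consists of all attempts with the same goal. -/
theorem mem_iff_of_dummy {y : M → M} (hy : (attempts C).UF.pt y) {i : M} (hi : aKind (y i) ≠ 0)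
    (u : M) : (attempts C).UF.mem y u ↔ aGoal u = aGoal (y 0) := by
  rw [attempts_mem]
  constructor
  · rintro ⟨j, hj⟩
    rw [← hj.goal_eq, goal_eq_of_pt hy]
  · intro hu
    obtain ⟨j, hj⟩ := exists_stage_gt hy (aStage u)
    rcases le_total i j with hij | hij
    · refine ⟨j, Or.inr ⟨by rw [hu, goal_eq_of_pt hy], Or.inr ⟨fun h0 => ?_, hj.le⟩⟩⟩
      rcases attempts_anti hy hij with h | ⟨-, ⟨-, h, -⟩ | ⟨h, -⟩⟩
      · exact hi (h ▸ h0)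
      · exact hi h
      · exact h h0
    · exact ⟨i, Or.inr ⟨by rw [hu, goal_eq_of_pt hy], Or.inr ⟨hi,
        hj.le.trans (attempts_anti hy hij).stage_le⟩⟩⟩

/-- An unbounded filter without dummies yields a point of `C`. -/
theorem exists_point_of_path {y : M → M} (hy : (attempts C).UF.pt y) (h0 : ∀ i, aKind (y i) = 0) :
    ∃ x, C.space.pt x ∧ Sub (aGoal (y 0)) (un x) := by
  haveI := fn1_of_isFun hy.1
  obtain ⟨x, hx, hun⟩ := exists_point_of_sigma (S := S) (p := fun n m => FinMem n (aSet (y m)))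
    inferInstance
  have hfin : ∀ i, fin (aSet (y i)) ⊆ un x := fun i n hn => by
    rw [hun]
    exact ⟨i, hn⟩
  have ext : ∀ i K, ∃ j, i ≤ j ∧ K < aStage (y j) ∧ Extends C (y j) (y i) := by
    intro i K
    obtain ⟨j, hj⟩ := exists_stage_gt hy (K + aStage (y i))
    have hij : i ≤ j := by
      by_contra hij
      exact absurd ((attempts_anti hy (le_of_not_ge hij)).stage_le.trans le_add_self)
        (not_le.2 hj)
    refine ⟨j, hij, lt_of_le_of_lt le_self_add hj, ?_⟩
    rcases attempts_anti hy hij with h | ⟨-, ⟨-, -, h⟩ | ⟨h, -⟩⟩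
    · rw [h] at hj
      exact absurd le_add_self (not_le.2 hj)
    · exact h
    · exact (h (h0 j)).elim
  refine ⟨x, (space_pt_iff C x).2 ⟨hx, inY_iff.2 ?_⟩, ?_⟩
  · rintro i ⟨v, hv1, hv2, hv3⟩
    have hset : ∀ l m, l ≤ m → FinSub (aSet (y l)) (aSet (y m)) := by
      intro l m hlm
      rcases attempts_anti hy hlm with h | ⟨-, ⟨-, -, h⟩ | ⟨h, -⟩⟩
      · exact fun j hj => h ▸ hj
      · exact h.2.1
      · exact (h (h0 m)).elim
    haveI : Fn1 S fun m => aSet (y m) := ⟨inferInstance⟩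
    rw [hun] at hv3
    obtain ⟨B, hB⟩ := exists_sub_of_mono S hset hv3
    obtain ⟨j, hBj, hj, -⟩ := ext B (i + v)
    obtain ⟨j', hj', -, hext⟩ := ext j 0
    obtain ⟨w, -, hw⟩ := hext.2.2.2 i (lt_of_le_of_lt le_self_add hj)
      ⟨v, lt_of_le_of_lt le_add_self hj, hv1, hv2, hB.mono (hset B j' (hBj.trans hj'))⟩
    exact ⟨w, hw.mono (hfin _)⟩
  · obtain ⟨j, -, -, hext⟩ := ext 0 0
    exact fun n hn => hfin j (hext.2.2.1 n hn)

/-- The filter of all attempts with goal `n`. -/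
theorem pt_dummies (C : Pi02Code S) (n : M) : (attempts C).UF.pt fun i => attempt 1 n i 0 := by
  refine ⟨(isFun_iff _).2 (by unfold attempt; infer_instance), fun _ => trivial, fun i => ?_, ?_⟩
  · rw [attempts_le]
    exact Or.inr ⟨by simp, Or.inr ⟨by simp, by simp⟩⟩
  · rintro ⟨r, -, hr⟩
    have h1 : ALe C r (attempt 1 n 0 0) := (attempts_lt.1 (hr _ (attempts_mem.2 ⟨0, Or.inl rfl⟩))).1
    have h2 : (attempts C).UF.mem (fun i => attempt 1 n i 0) r :=
      attempts_mem.2 ⟨aStage r, Or.inr ⟨by simpa using h1.goal_eq.symm, Or.inr ⟨by simp, by simp⟩⟩⟩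
    have := attempts_lt.1 (hr _ h2)
    exact this.2 this.1

/-- A point of `C` above a finite set yields an unbounded filter without dummies. -/
theorem exists_path {Z : Set M} (hZ : Z ∈ S) (hC : InY C Z) {n : M} (hn : Sub n Z) :
    ∃ y, (attempts C).UF.pt y ∧ (∀ i, aKind (y i) = 0) ∧
      (attempts C).UF.mem y (attempt 0 n 0 0) := by
  obtain ⟨t, L, ht, hL, hfin, hL0, hge, hgood⟩ := exists_segments hZ hC n
  have hstep : ∀ j, Extends C (attempt 0 n (L (j + 1)) (t (L (j + 1))))
      (attempt 0 n (L j) (t (L j))) := fun j => by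
    obtain ⟨h1, h2, h3⟩ := hgood j
    simp only [Extends, aStage_attempt, aSet_attempt, aGoal_attempt]
    refine ⟨h1, fun i hi => ?_, ?_, ?_⟩
    · rw [← mem_fin, hfin] at hi ⊢
      exact ⟨hi.1.trans h1, hi.2⟩
    · rw [finSub_iff, hfin]
      exact sub_of_lt hn h2
    · rintro i hi ⟨v, hv, hv'⟩
      refine h3 i hi ⟨v, hv, hv'.mono ?_⟩
      rw [hfin]
      exact fun j hj => hj.2
  refine ⟨fun j => attempt 0 n (L j) (t (L j)), ⟨(isFun_iff _).2 ?_, fun _ => trivial,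
    fun j => ?_, ?_⟩, fun j => by simp, ?_⟩
  · unfold attempt
    infer_instance
  · rw [attempts_le]
    exact Or.inr ⟨by simp, Or.inl ⟨by simp, by simp, hstep _⟩⟩
  · rintro ⟨r, -, hr⟩
    have hle : ∀ j, (attempts C).Lt r (attempt 0 n (L j) (t (L j))) := fun j =>
      hr _ (attempts_mem.2 ⟨j, Or.inl rfl⟩)
    have := (attempts_lt.1 (hle (aStage r + 1))).1.stage_le
    rw [aStage_attempt] at this
    exact absurd ((hge _).trans this) (not_le.2 (lt_add_one_iff.2 le_rfl))
  · refine attempts_mem.2 ⟨1, Or.inr ⟨by simp, Or.inl ⟨by simp, by simp, ?_⟩⟩⟩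
    have h := hstep 0
    rw [zero_add, hL0] at h
    refine ⟨by simpa using h.1, fun j hj => ?_, by simpa using h.2.2.1, fun i hi => ?_⟩
    · rw [aSet_attempt] at hj
      exact (not_lt_zero hj.lt).elim
    · rw [aStage_attempt] at hi
      exact (not_lt_zero hi).elim

/-- Points of a UF space which are equal belong to the same basic open sets. -/
theorem UF_mem_of_eqv {P : PosetCode S} {x y : M → M} (hx : P.UF.pt x) (hy : P.UF.pt y)
    (h : P.UF.eqv x y) {p : M} (hp : P.UF.mem x p) : P.UF.mem y p := by
  obtain ⟨hpA, i, hi⟩ := hp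
  obtain ⟨j, hj⟩ := h.1 i
  exact ⟨hpA, j, P.trans _ (hy.2.1 j) _ (hx.2.1 i) _ hpA hj hi⟩

/-- The data which witness that the attempts with goal `n` have an unbounded filter without
dummies: `m` codes a number `a` of the space `X`, two basic open sets `w₁`, `w₂` and numbers
verifying that the filter `g(a)` contains `attempt 0 n 0 0`, because `a ∈ w₁`, and that the distance
of `a` from the center of `w₂` is positive, whereas `g` maps `w₂` to dummies. -/
def PathWitness (X : QMetCode S) (Ψ : Set M) (n m : M) : Prop :=
  let a := left (left (left m))
  let w₁ := right (left (left m))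
  let w₂ := left (right (left m))
  let m₁ := right (right (left m))
  let m₂ := left (left (right m))
  let k₁ := right (left (right m))
  let k₂ := right (right m)
  a ∈ X.A ∧ w₁ ∈ X.space.basis ∧ w₂ ∈ X.space.basis ∧ pair m₁ (pair (attempt 0 n 0 0) w₁) ∈ Ψ ∧
    pair m₂ (pair (attempt 1 n 0 0) w₂) ∈ Ψ ∧
    (X.d (left w₁) a k₁).val + 2 * hp S k₁ < (ratOf (right w₁)).val ∧
    2 * hp S k₂ < (X.d (left w₂) a k₂).val

theorem exists_pathWitness {X : QMetCode S} {Ψ : Set M} {n a w₁ w₂ m₁ m₂ k₁ k₂ : M} (ha : a ∈ X.A)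
    (hw₁ : w₁ ∈ X.space.basis) (hw₂ : w₂ ∈ X.space.basis)
    (h₁ : pair m₁ (pair (attempt 0 n 0 0) w₁) ∈ Ψ) (h₂ : pair m₂ (pair (attempt 1 n 0 0) w₂) ∈ Ψ)
    (hk₁ : (X.d (left w₁) a k₁).val + 2 * hp S k₁ < (ratOf (right w₁)).val)
    (hk₂ : 2 * hp S k₂ < (X.d (left w₂) a k₂).val) : ∃ m, PathWitness X Ψ n m :=
  ⟨pair (pair (pair a w₁) (pair w₂ m₁)) (pair (pair m₂ k₁) k₂), by
    simpa [PathWitness] using ⟨ha, hw₁, hw₂, h₁, h₂, hk₁, hk₂⟩⟩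

end Attempts

/-- `N_n` meets `C` if and only if there is a `PathWitness`, for the map `g` from the quasi-metric
space to the UF space of the attempts. -/
theorem hub_of_UF_quasiPolish (h : ∀ P : PosetCode S, P.UF.Nonempty →
    ∃ X : QMetCode S, X.SmythComplete ∧ Homeomorphic S P.UF X.space) : Hub S := by
  intro C
  obtain ⟨X, -, Φ, hΦ, Ψ, hΨ, tΦ, tΨ, e1, e2⟩ := h (attempts C) ⟨_, pt_dummies C 0⟩
  haveI := Fact.mk X.A_mem
  haveI := Fact.mk X.basis_mem
  haveI := Fact.mk hΨ
  have hdec : Dec S fun y : M × M => PathWitness X Ψ y.1 y.2 := by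
    unfold PathWitness attempt
    infer_instance
  have key : ∀ c m, pair c m ∈ codes S (fun y : M × M => PathWitness X Ψ y.1 y.2) ↔
      PathWitness X Ψ c m := fun c m => enc_mem_codes (S := S) (a := (c, m))
  refine ⟨_, hdec.codes_mem, fun n m hm => ?_, fun Z hZ hZC n hn => ?_⟩
  -- If `C` has no point above `n`, then every unbounded filter with goal `n` is the filter of the
  -- dummies. Hence `g` identifies `a` and the center of `w₂`, which contradicts their positive
  -- distance.
  · obtain ⟨ha, hw₁, hw₂, hm₁, hm₂, hk₁, hk₂⟩ := (key _ _).1 hm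
    generalize left (left (left m)) = a at *
    generalize right (left (left m)) = w₁ at *
    generalize left (right (left m)) = w₂ at *
    by_contra hno
    have hb := (QMetCode.basis_eq hw₂).2.1
    have hcol : ∀ x, (attempts C).UF.pt x → (aGoal (x 0) = n) →
        ∀ u, (attempts C).UF.mem x u ↔ aGoal u = n := by
      intro x hx hx0 u
      have : ∃ i, aKind (x i) ≠ 0 := by
        by_contra! h0
        exact hno (hx0 ▸ exists_point_of_path hx h0)
      obtain ⟨i, hi⟩ := this
      rw [mem_iff_of_dummy hx hi, hx0]
    have hgoal : ∀ x f, (attempts C).UF.pt x → (attempts C).UF.mem x (attempt f n 0 0) →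
        aGoal (x 0) = n := by
      intro x f hx hmem
      obtain ⟨i, hi⟩ := attempts_mem.1 hmem
      rw [← goal_eq_of_pt hx i, hi.goal_eq, aGoal_attempt]
    have pa := QMetCode.pt_const ha
    have pb := QMetCode.pt_const hb
    obtain ⟨x, hx, hax⟩ := tΨ _ pa
    obtain ⟨x', hx', hbx⟩ := tΨ _ pb
    have c1 := hcol x hx (hgoal x 0 hx ((hax _ trivial).1
      ⟨_, w₁, hw₁, hm₁, (QMetCode.mem_const_iff hw₁ ha).2 ⟨_, hk₁⟩⟩))
    have c2 := hcol x' hx' (hgoal x' 1 hx' ((hbx _ trivial).1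
      ⟨_, w₂, hw₂, hm₂, (QMetCode.mem_const_iff hw₂ hb).2 (by
        obtain ⟨k, hk⟩ := exists_hp_lt S (QMetCode.basis_eq hw₂).2.2
        exact (QMetCode.dLt_self hb k).mono hk.le)⟩))
    obtain ⟨y, hy, hxy⟩ := tΦ x hx
    have hxy' : MapsTo (attempts C).UF X.space Φ x' y := by
      intro V hV
      rw [← hxy V hV]
      simp only [c1, c2]
    have q1 := e2 _ _ _ pa hx hy hax hxy
    have q2 := e2 _ _ _ pb hx' hy hbx hxy'
    obtain ⟨j, -, hj⟩ := (QMetCode.realEq_dist_iff pb pa).1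
      (QMetCode.eqv_trans_half pb hy pa q2.2 q1.1) (right (right m))
    have := hj.val_lt hb ha (right (right m))
    linarith
  -- The image `y` of a filter `z` without dummies is not in `w₂`, a neighbourhood of the image `yb`
  -- of the filter of the dummies. A term of `y` close enough to its limit is the
  -- required `a`.
  · obtain ⟨z, hz, hz0, hzn⟩ := exists_path hZ hZC hn
    obtain ⟨y, hy, hzy⟩ := tΦ z hz
    have hb := pt_dummies C n
    obtain ⟨yb, hyb, hbyb⟩ := tΦ _ hb
    obtain ⟨x, hx, hyx⟩ := tΨ y hy
    obtain ⟨x', hx', hybx⟩ := tΨ yb hyb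
    have ex := e1 _ _ _ hz hy hx hzy hyx
    have ex' := e1 _ _ _ hb hyb hx' hbyb hybx
    have symm : ∀ {u v : M → M}, (attempts C).UF.eqv u v → (attempts C).UF.eqv v u :=
      fun h => ⟨h.2, h.1⟩
    obtain ⟨m₁, w₁, hw₁, hm₁, hyw₁⟩ := (hyx (attempt 0 n 0 0) trivial).2
      (UF_mem_of_eqv hz hx (symm ex) hzn)
    obtain ⟨m₂, w₂, hw₂, hm₂, hyw₂⟩ := (hybx (attempt 1 n 0 0) trivial).2
      (UF_mem_of_eqv hb hx' (symm ex') (attempts_mem.2 ⟨0, Or.inl rfl⟩))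
    have hyw : ¬ X.space.mem y w₂ := by
      intro hyw
      obtain ⟨i, hi⟩ := attempts_mem.1 (UF_mem_of_eqv hx hz ex
        ((hyx (attempt 1 n 0 0) trivial).1 ⟨m₂, w₂, hw₂, hm₂, hyw⟩))
      rcases hi with hi | ⟨-, ⟨-, hi, -⟩ | ⟨hi, -⟩⟩
      · have := hz0 i
        rw [hi, aKind_attempt] at this
        exact one_ne_zero this
      · rw [aKind_attempt] at hi
        exact one_ne_zero hi
      · exact hi (hz0 i)
    obtain ⟨b1, hA1, hr1⟩ := QMetCode.basis_eq hw₁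
    obtain ⟨b2, hA2, hr2⟩ := QMetCode.basis_eq hw₂
    rw [b1, QMetCode.mem_ball hy] at hyw₁
    rw [b2, QMetCode.mem_ball hy] at hyw
    obtain ⟨-, -, k, hk⟩ := hyw₁
    obtain ⟨l, hl⟩ := exists_hp_lt S hr2
    have hyA := (X.pt_iff.1 hy).2.1
    set j := k + l + 1 with hj
    have hlj : hp S j ≤ hp S l / 2 := by
      rw [← hp_succ]
      exact hp_anti (by rw [hj, add_assoc]; exact le_add_self)
    obtain ⟨k₁, hk₁⟩ := (hk.trans hA1 (hyA k) (hyA j) (QMetCode.dLt_of_le hy (by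
      rw [hj, add_assoc]; exact le_self_add)).1).mono (sub_add_cancel _ _).le
    have hk₂ : 2 * hp S (j + 1 + 1 + 1) < (X.d (left w₂) (y j) (j + 1 + 1 + 1)).val := by
      by_contra! hle
      refine hyw ⟨hA2, hr2, j, (QMetCode.dLt_self_add (j + 1 + 1 + 1)).mono ?_⟩
      simp only [hp_succ] at hle ⊢
      linarith [hp_pos (S := S) j]
    obtain ⟨m, hm⟩ := exists_pathWitness (hyA j) hw₁ hw₂ hm₁ hm₂ hk₁ hk₂
    exact ⟨m, (key _ _).2 hm⟩

end HubUF

section Dense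

variable {M : Type u} [Nums M] {S : Set (Set M)} [hS : Fact (RCA0 S)]
variable {α β γ : Type u} [Cod S α] [Cod S β] [Cod S γ]

/-! ### Comprehension available in models of `Π¹₁-CA₀` -/

theorem val_pairT (s t : NTerm) (e : ℕ → M) :
    (pairT s t).val e = pair (s.val e) (t.val e) := rfl

open NTerm Fml in
theorem Pi11CA0.aca (h : Pi11CA0 S) : ACA S := by
  intro p hp
  have hA := hp.dec.codes_mem
  have := h.pi11_comprehension (allS (exN (mem (pairT (var 1) (var 0)) 1)))
    ⟨_, by simp [exN, Arithmetical], rfl⟩ (fun _ => 0) (fun _ => _) (fun _ => hA)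
  refine (Dec.of_mem this).congr fun n => ?_
  have key : ∀ m, pair n m ∈ codes S (fun y : M × M => p y.1 y.2) ↔ p n m := fun m =>
    enc_mem_codes (S := S) (a := (n, m))
  simp only [← key, Set.mem_ofPred_eq, Sat, sat_exN, val_pairT, push]
  exact ⟨fun h _ _ => h, fun h => h _ hA⟩

/-- `φ → ψ`. -/
def Fml.imp (φ ψ : Fml) : Fml := .neg (.and φ (.neg ψ))

theorem sat_imp (φ ψ : Fml) (e : ℕ → M) (E : ℕ → Set M) :
    Sat S (φ.imp ψ) e E ↔ (Sat S φ e E → Sat S ψ e E) := by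
  simp [Fml.imp, Sat]

open NTerm Fml in
/-- The set of codes `pair k c` of initial segments of elements of `C`: `c` codes the elements below
the length `k`. -/
theorem Pi11CA0.segments_mem (h : Pi11CA0 S) (C : Pi02Code S) :
    Dec S fun u : M => ∃ X ∈ S, InY C X ∧
      ∀ j, FinMem j (right u) ↔ j < left u ∧ j ∈ X := by
  haveI := Fact.mk C.op_mem
  haveI := Fact.mk C.cl_mem
  set A := codes S fun y : M × M => pair y.1 y.2 ∈ C.cl ∧ IsPair y.2
  set B := codes S fun y : M × M => pair y.1 y.2 ∈ C.op ∧ IsPair y.2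
  set G := codes S fun y : M × M => FinMem y.2 (right y.1)
  set K := codes S fun y : M × M => y.2 < left y.1 ∧ ¬ FinMem y.2 (right y.1)
  have hA : A ∈ S := Dec.codes_mem _
  have hB : B ∈ S := Dec.codes_mem _
  have hG : G ∈ S := Dec.codes_mem _
  have hK : K ∈ S := Dec.codes_mem _
  have eA : ∀ i v, pair i v ∈ A ↔ pair i v ∈ C.cl ∧ IsPair v := fun i v =>
    enc_mem_codes (S := S) (a := (i, v))
  have eB : ∀ i v, pair i v ∈ B ↔ pair i v ∈ C.op ∧ IsPair v := fun i v =>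
    enc_mem_codes (S := S) (a := (i, v))
  have eG : ∀ i v, pair i v ∈ G ↔ FinMem v (right i) := fun i v =>
    enc_mem_codes (S := S) (a := (i, v))
  have eK : ∀ i v, pair i v ∈ K ↔ v < left i ∧ ¬ FinMem v (right i) := fun i v =>
    enc_mem_codes (S := S) (a := (i, v))
  -- `sub`: the finite set of the witness is contained in `X`; `f₁`: `X ∈ C`; `f₂`: `u` is an
  -- initial segment of `X`, apart from the bound on its elements
  let sub : Fml := allN (Fml.imp (mem (pairT (var 1) (var 0)) 3) (mem (var 0) 0))
  let f₁ : Fml := allN (Fml.imp (exN (.and (mem (pairT (var 1) (var 0)) 1) sub))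
    (exN (.and (mem (pairT (var 1) (var 0)) 2) sub)))
  let f₂ : Fml := allN (.and (Fml.imp (mem (pairT (var 1) (var 0)) 3) (mem (var 0) 0))
    (Fml.imp (mem (pairT (var 1) (var 0)) 4) (.neg (mem (var 0) 0))))
  have hE : ∀ i, push A (push B (push G fun _ => K)) i ∈ S := by
    rintro (_ | _ | _ | i)
    exacts [hA, hB, hG, hK]
  have := h.pi11_comprehension (allS (.neg (.and f₁ f₂)))
    ⟨_, by simp [f₁, f₂, sub, Fml.imp, exN, Arithmetical], rfl⟩ (fun _ => 0) _ hE
  haveI := Dec.of_mem this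
  refine (inferInstance : Dec S fun u : M => u ∉ {n | Sat S (allS (.neg (.and f₁ f₂)))
    (push n fun _ => 0) (push A (push B (push G fun _ => K)))} ∧
    ∀ j, j < right u → FinMem j (right u) → j < left u).congr fun u => ?_
  have e₁ : ∀ X, Sat S f₁ (push u fun _ => 0) (push X (push A (push B (push G fun _ => K)))) ↔
      InY C X := fun X => by
    simp only [f₁, sub, Sat, sat_imp, sat_exN, val_pairT, push, NTerm.val, inY_iff, CWit, OWit,
      eA, eB, eG, Sub, and_assoc]
  have e₂ : ∀ X, Sat S f₂ (push u fun _ => 0) (push X (push A (push B (push G fun _ => K)))) ↔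
      ∀ j, (FinMem j (right u) → j ∈ X) ∧ (j < left u ∧ ¬ FinMem j (right u) → j ∉ X) := fun X => by
    simp only [f₂, Sat, sat_imp, val_pairT, push, NTerm.val, eG, eK]
  simp only [Set.mem_ofPred_eq, Sat, not_forall, not_not, exists_prop]
  constructor
  · rintro ⟨X, hX, hC, hu⟩
    exact ⟨⟨X, hX, (e₁ X).2 hC, (e₂ X).2 fun j => ⟨fun hj => ((hu j).1 hj).2,
      fun hj hjX => hj.2 ((hu j).2 ⟨hj.1, hjX⟩)⟩⟩, fun j _ hj => ((hu j).1 hj).1⟩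
  · rintro ⟨⟨X, hX, hC, hu⟩, hlt⟩
    refine ⟨X, hX, (e₁ X).1 hC, fun j => ⟨fun hj => ⟨hlt j hj.lt hj, ((e₂ X).1 hu j).1 hj⟩,
      fun hj => ?_⟩⟩
    by_contra hn
    exact ((e₂ X).1 hu j).2 ⟨hj.1, hn⟩ hj.2

/-- A `Π⁰₂`-subspace has a dense sequence of elements `D t`, given by one set of the structure: an
initial segment of an element of `C` can be extended to a longer one satisfying the next clauses of
`C`, and by comprehension the least such extension can be chosen at every step. -/
theorem Pi11CA0.exists_dense (h : Pi11CA0 S) (C : Pi02Code S) :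
    ∃ A ∈ S, ∃ D : M → Set M, (Dec S fun y : M × M => y.2 ∈ D y.1) ∧ (∀ t ∈ A, InY C (D t)) ∧
      ∀ X ∈ S, InY C X → ∀ m, ∃ t ∈ A, ∀ j < m, j ∈ D t ↔ j ∈ X := by
  set Seg : M → Prop := fun u => ∃ X ∈ S, InY C X ∧ ∀ j, FinMem j (right u) ↔ j < left u ∧ j ∈ X
  haveI hSeg : Rel1 S Seg := ⟨h.segments_mem C⟩
  -- `u'` properly extends `u` and satisfies the clauses of `C` below `k`
  obtain ⟨g, hg, hnext⟩ := exists_search S (α := M × M) (p := fun y u' => Seg y.2 → Seg u' ∧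
    left y.2 < left u' ∧ (∀ j, j < left y.2 → (FinMem j (right u') ↔ FinMem j (right y.2))) ∧
    ∀ i, i < y.1 → (∃ v, v < y.1 ∧ CWit C i v (fin (right u'))) →
      ∃ w, w < left u' ∧ OWit C i w (fin (right u'))) inferInstance (by
    rintro ⟨k, u⟩
    by_cases hu : Seg u
    swap
    · exact ⟨0, fun h => (hu h).elim⟩
    obtain ⟨X, hX, hXC, hXu⟩ := hu
    obtain ⟨k', h1, h2, h3⟩ := exists_segment hX hXC k (left u + 1)
    obtain ⟨c, hc⟩ := exists_code S (Dec.of_mem hX) k'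
    have hfin : fin c = {j | j < k' ∧ j ∈ X} := Set.ext hc
    refine ⟨pair k' c, fun _ => ⟨⟨X, hX, hXC, by simpa using hc⟩, ?_, fun j hj => ?_,
      fun i hi ⟨v, hv, hv'⟩ => ?_⟩⟩
    · simpa using add_one_le_iff.1 h2
    · have hj' : j < k' := hj.trans (add_one_le_iff.1 h2)
      simp only [right_pair, hc, hXu]
      exact and_congr_left fun _ => iff_of_true hj' hj
    · simp only [right_pair, left_pair, hfin] at hv' ⊢
      exact h3 i hi ⟨v, hv, hv'.mono fun j hj => hj.2⟩)
  haveI : Rec S fun y : (M × M) × M => g (y.1.2, y.2) :=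
    Rec.comp g fun y : (M × M) × M => (y.1.2, y.2)
  obtain ⟨f, hf, hfeq⟩ := exists_primrec S (fun t : M => t) (fun _ k u => g (k, u))
  haveI : Fn2 S f := ⟨hf⟩
  have hseg : ∀ t, Seg t → ∀ k, Seg (f t k) := fun t ht k => by
    refine ind S (p := fun k => Seg (f t k)) inferInstance ((hfeq t).1.symm ▸ ht) (fun k hk => ?_) k
    rw [(hfeq t).2]
    exact ((hnext (k, f t k)).1 hk).1
  have hstep : ∀ t, Seg t → ∀ k, left (f t k) < left (f t (k + 1)) ∧
      (∀ j, j < left (f t k) → (FinMem j (right (f t (k + 1))) ↔ FinMem j (right (f t k)))) ∧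
      ∀ i, i < k → (∃ v, v < k ∧ CWit C i v (fin (right (f t (k + 1))))) →
        ∃ w, w < left (f t (k + 1)) ∧ OWit C i w (fin (right (f t (k + 1)))) := fun t ht k => by
    rw [(hfeq t).2]
    exact ((hnext (k, f t k)).1 (hseg t ht k)).2
  have hge : ∀ t, Seg t → ∀ k, k ≤ left (f t k) := fun t ht k => by
    refine ind S (p := fun k => k ≤ left (f t k)) inferInstance zero_le (fun k hk => ?_) k
    exact add_one_le_iff.2 (hk.trans_lt (hstep t ht k).1)
  have hstab : ∀ t, Seg t → ∀ k d, left (f t k) ≤ left (f t (k + d)) ∧ ∀ j, j < left (f t k) →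
      (FinMem j (right (f t (k + d))) ↔ FinMem j (right (f t k))) := fun t ht k d => by
    refine ind S (p := fun d => left (f t k) ≤ left (f t (k + d)) ∧ ∀ j, j < left (f t k) →
      (FinMem j (right (f t (k + d))) ↔ FinMem j (right (f t k)))) inferInstance (by simp)
      (fun d hd => ?_) d
    obtain ⟨h1, h2, -⟩ := hstep t ht (k + d)
    rw [← add_assoc]
    exact ⟨hd.1.trans h1.le, fun j hj => (h2 j (hj.trans_le hd.1)).trans (hd.2 j hj)⟩
  have hD : ∀ t, Seg t → ∀ k j, j < left (f t k) →
      (FinMem j (right (f t (j + 1))) ↔ FinMem j (right (f t k))) := fun t ht k j hj => by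
    have hj' : j < left (f t (j + 1)) := add_one_le_iff.1 (hge t ht (j + 1))
    rcases le_total k (j + 1) with hle | hle <;> obtain ⟨d, hd⟩ := exists_add_of_le hle
    · rw [hd]
      exact (hstab t ht k d).2 j hj
    · rw [hd]
      exact ((hstab t ht (j + 1) d).2 j hj').symm
  have hfinD : ∀ t, Seg t → ∀ k, fin (right (f t k)) ⊆ {j | FinMem j (right (f t (j + 1)))} := by
    intro t ht k j hj
    obtain ⟨X, -, -, hX⟩ := hseg t ht k
    exact (hD t ht k j ((hX j).1 hj).1).2 hj
  -- `D t` is the union of the segments `f t k`; the segment `f t (j + 1)` decides whether it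
  -- contains `j`
  refine ⟨{t | Seg t}, Dec.setOf_mem _, fun t => {j | FinMem j (right (f t (j + 1)))},
    (inferInstance : Dec S fun y : M × M => FinMem y.2 (right (f y.1 (y.2 + 1)))), fun t ht => ?_,
    fun X hX hXC m => ?_⟩
  · rw [inY_iff]
    rintro i ⟨v, hv⟩
    obtain ⟨-, -, hk⟩ := hstep t ht (i + v + 1)
    have hlt : ∀ j, FinMem j (right v) → j < left (f t (i + v + 1 + 1)) := fun j hj => by
      refine (hj.lt.trans_le ((right_le v).trans ?_)).trans_le (hge t ht _)
      rw [add_assoc, add_assoc]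
      exact le_add_self.trans' le_self_add
    obtain ⟨w, -, hw⟩ := hk i (lt_add_one_iff.2 le_self_add) ⟨v, lt_add_one_iff.2 le_add_self,
      hv.1, hv.2.1, fun j hj => (hD t ht _ j (hlt j hj)).1 (hv.2.2 j hj)⟩
    exact ⟨w, hw.mono (hfinD t ht _)⟩
  · obtain ⟨c, hc⟩ := exists_code S (Dec.of_mem hX) m
    have ht : Seg (pair m c) := ⟨X, hX, hXC, by simpa using hc⟩
    refine ⟨_, ht, fun j hj => ?_⟩
    have := hD _ ht 0 j (by simpa [(hfeq _).1] using hj)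
    rw [Set.mem_ofPred_eq, this, (hfeq _).1, right_pair, hc]
    exact and_iff_right hj

end Dense

section Presentations

variable {M : Type u} [Nums M] {S : Set (Set M)} [hS : Fact (RCA0 S)]
variable {α β γ : Type u} [Cod S α] [Cod S β] [Cod S γ]

/-! ### Presentations of spaces by `Π⁰₂` codes -/

/-- Codes of continuous maps can be given by a decidable relation. -/
theorem exists_triples (S : Set (Set M)) [Fact (RCA0 S)] {r : M → M → M → Prop}
    (hr : Dec S fun y : M × M × M => r y.1 y.2.1 y.2.2) :
    ∃ P ∈ S, ∀ n V U, pair n (pair V U) ∈ P ↔ r n V U :=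
  ⟨_, hr.codes_mem, fun n V U => enc_mem_codes (S := S) (a := (n, V, U))⟩

/-- The space `X` is presented by the code `C` through the map `l` from the points of `X` onto the
elements of `C` belonging to `S`: `l` is injective up to equality of points, and the topologies of
`X` and of `P(ℕ)` can be computed from each other. -/
structure Presents (C : Pi02Code S) (X : Space M) (l : (M → M) → Set M) : Prop where
  valid : ∀ x, X.pt x → l x ∈ S ∧ InY C (l x)
  surj : ∀ Z ∈ S, InY C Z → ∃ x, X.pt x ∧ l x = Z
  eqv : ∀ x y, X.pt x → X.pt y → l x = l y → X.eqv x y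
  open_fin : ∃ P ∈ S, ∀ x, X.pt x → ∀ c, Sub c (l x) ↔
    ∃ n U, U ∈ X.basis ∧ pair n (pair c U) ∈ P ∧ X.mem x U
  open_basis : ∃ P ∈ S, ∀ x, X.pt x → ∀ V ∈ X.basis, X.mem x V ↔
    ∃ n c, pair n (pair V c) ∈ P ∧ Sub c (l x)

/-- Between two spaces presented by the same code there is a continuous map which identifies the
points presenting the same set. -/
theorem Presents.exists_map {C : Pi02Code S} {X X' : Space M} {l l' : (M → M) → Set M}
    (h : Presents C X l) (h' : Presents C X' l') :
    ∃ Φ ∈ S, ∀ x, X.pt x → ∀ y, X'.pt y → (MapsTo X X' Φ x y ↔ l x = l' y) := by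
  obtain ⟨P, hP, hPx⟩ := h.open_fin
  obtain ⟨Q, hQ, hQy⟩ := h'.open_basis
  obtain ⟨P', -, hPy⟩ := h'.open_fin
  haveI := Fact.mk hP
  haveI := Fact.mk hQ
  obtain ⟨Φ, hΦ, key⟩ := exists_triples S (r := fun n V U =>
    pair (left (left n)) (pair (right n) U) ∈ P ∧
      pair (right (left n)) (pair V (right n)) ∈ Q) inferInstance
  have hΦx : ∀ x, X.pt x → ∀ V, (∃ n U, U ∈ X.basis ∧ pair n (pair V U) ∈ Φ ∧ X.mem x U) ↔
      ∃ n c, pair n (pair V c) ∈ Q ∧ Sub c (l x) := by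
    intro x hx V
    simp only [key]
    constructor
    · rintro ⟨n, U, hU, ⟨h1, h2⟩, hxU⟩
      exact ⟨_, _, h2, (hPx x hx _).2 ⟨_, U, hU, h1, hxU⟩⟩
    · rintro ⟨n, c, hn, hc⟩
      obtain ⟨m, U, hU, hm, hxU⟩ := (hPx x hx c).1 hc
      exact ⟨pair (pair m n) c, U, hU, by simpa using ⟨hm, hn⟩, hxU⟩
  refine ⟨Φ, hΦ, fun x hx y hy => ⟨fun hm => ?_, fun e V hV => ?_⟩⟩
  · obtain ⟨z, hz, hzx⟩ := h'.surj _ (h.valid x hx).1 (h.valid x hx).2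
    have e : ∀ V ∈ X'.basis, (X'.mem z V ↔ X'.mem y V) := fun V hV => by
      rw [← hm V hV, hΦx x hx, hQy z hz V hV, hzx]
    have e' : ∀ c, Sub c (l' z) ↔ Sub c (l' y) := fun c => by
      rw [hPy z hz, hPy y hy]
      exact exists₂_congr fun n U => and_congr_right fun hU => and_congr_right fun _ => e U hU
    obtain ⟨s, -, hs⟩ := exists_singleton_code S fun j : M => j
    have hsub : ∀ j Z, Sub (s j) Z ↔ j ∈ Z := fun j Z =>
      ⟨fun h => h j ((hs j j).2 rfl), fun h i hi => (hs j i).1 hi ▸ h⟩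
    rw [← hzx]
    ext j
    rw [← hsub, ← hsub, e']
  · rw [hΦx x hx, hQy y hy V hV, e]

/-- The maps in both directions identify the points presenting the same set, and so are inverse to
each other. -/
theorem Presents.homeomorphic {C : Pi02Code S} {X X' : Space M} {l l' : (M → M) → Set M}
    (h : Presents C X l) (h' : Presents C X' l') : Homeomorphic S X X' := by
  obtain ⟨Φ, hΦ, hΦx⟩ := h.exists_map h'
  obtain ⟨Ψ, hΨ, hΨy⟩ := h'.exists_map h
  refine ⟨Φ, hΦ, Ψ, hΨ, fun x hx => ?_, fun y hy => ?_, fun x y x' hx hy hx' h1 h2 => ?_,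
    fun y x y' hy hx hy' h1 h2 => ?_⟩
  · obtain ⟨y, hy, e⟩ := h'.surj _ (h.valid x hx).1 (h.valid x hx).2
    exact ⟨y, hy, (hΦx x hx y hy).2 e.symm⟩
  · obtain ⟨x, hx, e⟩ := h.surj _ (h'.valid y hy).1 (h'.valid y hy).2
    exact ⟨x, hx, (hΨy y hy x hx).2 e.symm⟩
  · exact h.eqv _ _ hx' hx (((hΦx x hx y hy).1 h1).trans ((hΨy y hy x' hx').1 h2)).symm
  · exact h'.eqv _ _ hy' hy (((hΨy y hy x hx).1 h1).trans ((hΦx x hx y' hy').1 h2)).symm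

/-- A `Π⁰₂`-subspace is presented by its code; arithmetical comprehension makes the sets represented
by its points elements of `S`. -/
theorem presents_space [Fact (ACA S)] (C : Pi02Code S) : Presents C C.space un where
  valid x hx := ⟨un_mem hx.1.1, ((space_pt_iff C x).1 hx).2⟩
  surj Z hZ hC := by
    obtain ⟨x, hx, rfl⟩ := exists_point_of_mem hZ
    exact ⟨x, (space_pt_iff C x).2 ⟨hx, hC⟩, rfl⟩
  eqv x y _ _ h := (powerSpace_eqv (S := S)).2 h
  open_fin := by
    obtain ⟨P, hP, key⟩ := exists_triples S (r := fun _ c U : M => c = U) inferInstance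
    refine ⟨P, hP, fun x hx c => ?_⟩
    rw [← mem_powerSpace hx.1]
    exact ⟨fun h => ⟨0, c, trivial, (key _ _ _).2 rfl, h⟩,
      fun ⟨n, U, _, hU, h⟩ => (key _ _ _).1 hU ▸ h⟩
  open_basis := by
    obtain ⟨P, hP, key⟩ := exists_triples S (r := fun _ c U : M => c = U) inferInstance
    refine ⟨P, hP, fun x hx V _ => ?_⟩
    refine (mem_powerSpace hx.1 V).trans ⟨fun h => ⟨0, V, (key _ _ _).2 rfl, h⟩, ?_⟩
    rintro ⟨n, c, hc, h⟩
    rwa [(key _ _ _).1 hc]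

end Presentations

section StagePoset1

variable {M : Type u} [Nums M] {S : Set (Set M)} [hS : Fact (RCA0 S)]
variable {α β γ : Type u} [Cod S α] [Cod S β] [Cod S γ]

/-! ### A poset for a `Π⁰₂`-subspace -/

/-- The finite set `fin c` satisfies those of the first `k` clauses of `C` that apply to it because
of a witness below `k`. -/
def Good (C : Pi02Code S) (k c : M) : Prop :=
  ∀ i, i < k → (∃ v, v < k ∧ CWit C i v (fin c)) → ∃ w, OWit C i w (fin c)

/-- The ordering on pairs of a stage and a finite set: smaller pairs have a later stage and a larger
set. -/
def StageLe (u v : M) : Prop := u = v ∨ (left v < left u ∧ FinSub (right v) (right u))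

theorem StageLe.trans {u v w : M} (h : StageLe u v) (h' : StageLe v w) : StageLe u w := by
  rcases h with rfl | h
  · exact h'
  rcases h' with rfl | h'
  · exact Or.inr h
  · exact Or.inr ⟨h'.1.trans h.1, fun j hj => h.2 j (h'.2 j hj)⟩

theorem StageLe.left_le {u v : M} (h : StageLe u v) : left v ≤ left u := by
  rcases h with rfl | h
  exacts [le_rfl, h.1.le]

theorem StageLe.sub {u v : M} (h : StageLe u v) : FinSub (right v) (right u) := by
  rcases h with rfl | h
  exacts [fun _ hj => hj, h.2]

instance rel2_stageLe : Rel2 S (StageLe : M → M → Prop) := ⟨by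
  unfold StageLe
  infer_instance⟩

instance rel2_good [Fact (ACA S)] (C : Pi02Code S) : Rel2 S (Good C) := ⟨by
  unfold Good
  infer_instance⟩

section StagePoset

variable [Fact (ACA S)] (C : Pi02Code S) {D : M → Set M} {A : Set M}

/-- The finite set `fin c` is contained in one of the sets `D t` with `t ∈ A`. -/
def SubSome (A : Set M) (D : M → Set M) (c : M) : Prop := ∃ t, t ∈ A ∧ Sub c (D t)

theorem rel1_subSome (hA : A ∈ S) (hD : Dec S fun y : M × M => y.2 ∈ D y.1) :
    Rel1 S (SubSome A D) := by
  haveI := Fact.mk hA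
  haveI : ∀ {δ : Type u} [Cod S δ] (f g : δ → M) [Rec S f] [Rec S g],
      Dec S fun d => f d ∈ D (g d) := fun f g => Dec.comp (fun y : M × M => y.2 ∈ D y.1)
    fun d => (g d, f d)
  exact ⟨(inferInstance : Dec S fun c => ∃ t, t ∈ A ∧ ∀ j, j < c → FinMem j c → j ∈ D t).congr
    fun c => by simp only [← sub_iff, SubSome]⟩

/-- The poset of pairs of a stage `k` and a finite set which satisfies the clauses of `C` up to `k`
and is contained in one of the sets `D t`. -/
def stagePoset (hA : A ∈ S) (hD : Dec S fun y : M × M => y.2 ∈ D y.1) : PosetCode S :=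
  haveI := rel1_subSome hA hD
  .ofRel S (fun u => SubSome A D (right u) ∧ Good C (left u) (right u)) StageLe
    inferInstance inferInstance (fun _ => Or.inl rfl) fun _ _ _ => StageLe.trans

variable {C} {hA : A ∈ S} {hD : Dec S fun y : M × M => y.2 ∈ D y.1}

theorem mem_stagePoset {u : M} : u ∈ (stagePoset C hA hD).carrier ↔
    SubSome A D (right u) ∧ Good C (left u) (right u) := Iff.rfl

theorem stagePoset_le {u v : M} : (stagePoset C hA hD).Le u v ↔ StageLe u v :=
  PosetCode.ofRel_le

/-- The stages of the elements of an unbounded filter are unbounded: an element of maximal stage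
would be the least element of the filter, and it has a proper extension inside any of the sets `D t`
containing it. -/
theorem exists_stage_ge (hDC : ∀ t ∈ A, InY C (D t)) {y : M → M}
    (hy : (stagePoset C hA hD).UF.pt y) (k : M) : ∃ j, k ≤ left (y j) := by
  by_contra! hk
  haveI := fn1_of_isFun hy.1
  obtain ⟨m, ⟨j₀, rfl⟩, hmax⟩ := exists_greatest S (p := fun m => ∃ j, m = left (y j)) inferInstance
    ⟨_, 0, rfl⟩ k (by
      rintro _ ⟨j, rfl⟩
      exact (hk j).le)
  have hmin : ∀ p, (stagePoset C hA hD).InFilter y p → StageLe (y j₀) p := by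
    rintro p ⟨-, i, hi⟩
    refine StageLe.trans ?_ (stagePoset_le.1 hi)
    have h1 := stagePoset_le.1 (PosetCode.anti hy (le_add_self : i ≤ j₀ + i))
    rcases stagePoset_le.1 (PosetCode.anti hy (le_self_add : j₀ ≤ j₀ + i)) with h2 | h2
    · exact h2 ▸ h1
    · exact absurd h2.1 (not_lt.2 (hmax _ ⟨_, rfl⟩))
  obtain ⟨⟨t, htA, ht⟩, -⟩ := mem_stagePoset.1 (hy.2.1 j₀)
  have hDS : D t ∈ S := (Dec.comp (fun y : M × M => y.2 ∈ D y.1) fun j => (t, j)).setOf_mem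
  obtain ⟨k', -, hb, hk'⟩ := exists_segment hDS (hDC t htA) (left (y j₀) + 1) (right (y j₀))
  obtain ⟨c, hc⟩ := exists_code S (Dec.of_mem hDS) k'
  have hfin : fin c = {j | j < k' ∧ j ∈ D t} := Set.ext hc
  have hr : StageLe (pair (left (y j₀) + 1) c) (y j₀) := Or.inr ⟨by simp, fun j hj => by
    rw [right_pair, hc]
    exact ⟨hj.lt.trans_le hb, ht j hj⟩⟩
  refine hy.2.2.2 ⟨_, mem_stagePoset.2 ⟨⟨t, htA, ?_⟩, ?_⟩, fun p hp => ⟨stagePoset_le.2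
    (hr.trans (hmin p hp)), fun hle => ?_⟩⟩
  · rw [right_pair]
    exact fun j hj => ((hc j).1 hj).2
  · simp only [Good, left_pair, right_pair]
    rintro i hi ⟨v, hv, hv'⟩
    rw [hfin] at hv' ⊢
    obtain ⟨w, -, hw⟩ := hk' i hi ⟨v, hv, hv'.mono fun j hj => hj.2⟩
    exact ⟨w, hw⟩
  · have := ((hmin p hp).trans (stagePoset_le.1 hle)).left_le
    rw [left_pair] at this
    exact absurd (add_one_le_iff.1 this) (lt_irrefl _)

/-- The union of the finite sets occurring in a filter. -/
def stageUnion (y : M → M) : Set M := un fun i => right (y i)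

theorem exists_sub_stage {y : M → M} (hy : (stagePoset C hA hD).UF.pt y) {c : M}
    (hc : Sub c (stageUnion y)) : ∃ i, ∀ j, i ≤ j → Sub c (fin (right (y j))) := by
  haveI := fn1_of_isFun hy.1
  have hmono : ∀ i j, i ≤ j → FinSub (right (y i)) (right (y j)) := fun i j hij =>
    (stagePoset_le.1 (PosetCode.anti hy hij)).sub
  haveI : Fn1 S fun i => right (y i) := ⟨inferInstance⟩
  obtain ⟨i, hi⟩ := exists_sub_of_mono S hmono hc
  exact ⟨i, fun j hij n hn => hmono i j hij n (hi n hn)⟩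

/-- As the stages in an unbounded filter are unbounded, membership in the filter depends on the
finite set only. -/
theorem mem_stagePoset_UF (hDC : ∀ t ∈ A, InY C (D t)) {y : M → M}
    (hy : (stagePoset C hA hD).UF.pt y) {u : M} (hu : u ∈ (stagePoset C hA hD).carrier) :
    (stagePoset C hA hD).UF.mem y u ↔ Sub (right u) (stageUnion y) := by
  constructor
  · rintro ⟨-, i, hi⟩ j hj
    exact ⟨i, (stagePoset_le.1 hi).sub j hj⟩
  · intro h
    obtain ⟨i, hi⟩ := exists_sub_stage hy h
    obtain ⟨j, hj⟩ := exists_stage_ge hDC hy (left u + 1)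
    refine ⟨hu, i + j, stagePoset_le.2 (Or.inr ⟨?_, hi _ le_self_add⟩)⟩
    exact (add_one_le_iff.1 hj).trans_le (stagePoset_le.1 (PosetCode.anti hy le_add_self)).left_le

/-- The stage poset presents `C`: the union of an unbounded filter satisfies every clause of `C`,
and the initial segments of an element of `C` are the finite sets of such a filter. -/
theorem presents_stagePoset (hDC : ∀ t ∈ A, InY C (D t))
    (hdense : ∀ X ∈ S, InY C X → ∀ m, ∃ t ∈ A, ∀ j < m, j ∈ D t ↔ j ∈ X) :
    Presents C (stagePoset C hA hD).UF stageUnion where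
  valid y hy := by
    haveI := fn1_of_isFun hy.1
    refine ⟨Dec.setOf_mem (S := S) fun n : M => ∃ i, FinMem n (right (y i)), ?_⟩
    rw [inY_iff]
    rintro i ⟨v, hv⟩
    obtain ⟨a, ha⟩ := exists_sub_stage hy hv.2.2
    obtain ⟨b, hb⟩ := exists_stage_ge hDC hy (i + v + 1)
    have hb' : i + v < left (y (a + b)) := (add_one_le_iff.1 hb).trans_le
      (stagePoset_le.1 (PosetCode.anti hy le_add_self)).left_le
    obtain ⟨w, hw⟩ := (mem_stagePoset.1 (hy.2.1 (a + b))).2 i (le_self_add.trans_lt hb')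
      ⟨v, le_add_self.trans_lt hb', hv.1, hv.2.1, ha _ le_self_add⟩
    exact ⟨w, hw.mono fun j hj => ⟨_, hj⟩⟩
  surj Z hZ hC := by
    obtain ⟨t, L, ht, hL, hfin, -, hge, hgood⟩ := exists_segments hZ hC 0
    have hsub : ∀ k, fin (t k) ⊆ Z := fun k j hj => by
      rw [hfin] at hj
      exact hj.2
    have hcar : ∀ j, pair (L j) (t (L (j + 1))) ∈ (stagePoset C hA hD).carrier := fun j => by
      refine mem_stagePoset.2 ⟨?_, ?_⟩
      · obtain ⟨a, ha, ha'⟩ := hdense Z hZ hC (L (j + 1))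
        refine ⟨a, ha, fun i hi => ?_⟩
        rw [right_pair, ← mem_fin, hfin] at hi
        exact (ha' i hi.1).2 hi.2
      · simp only [Good, left_pair, right_pair]
        rintro i hi ⟨v, hv, hv'⟩
        obtain ⟨w, -, hw⟩ := (hgood j).2.2 i hi ⟨v, hv, hv'.mono (hsub _)⟩
        exact ⟨w, hw⟩
    refine ⟨fun j => pair (L j) (t (L (j + 1))), ⟨(isFun_iff _).2 (by infer_instance), hcar,
      fun j => stagePoset_le.2 (Or.inr ⟨?_, ?_⟩), ?_⟩, ?_⟩
    · simpa using (hgood j).1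
    · intro i hi
      rw [right_pair, ← mem_fin, hfin] at hi ⊢
      exact ⟨hi.1.trans (hgood (j + 1)).1, hi.2⟩
    · rintro ⟨r, hr, hlt⟩
      have h := hlt _ ⟨hcar (left r + 1), left r + 1, stagePoset_le.2 (Or.inl rfl)⟩
      have := (stagePoset_le.1 h.1).left_le
      rw [left_pair] at this
      exact absurd (((hge _).trans_lt (hgood _).1).trans_le this) (lt_irrefl _)
    · ext j
      constructor
      · rintro ⟨i, hi⟩
        simp only [right_pair] at hi
        exact hsub _ hi
      · intro hj
        refine ⟨j, ?_⟩
        simp only [right_pair]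
        rw [← mem_fin, hfin]
        exact ⟨(hge j).trans_lt (hgood j).1, hj⟩
  eqv x y hx hy h := by
    constructor
    · intro i
      refine ((mem_stagePoset_UF hDC hy (hx.2.1 i)).2 ?_).2
      rw [← h, ← mem_stagePoset_UF hDC hx (hx.2.1 i)]
      exact ⟨hx.2.1 i, i, stagePoset_le.2 (Or.inl rfl)⟩
    · intro i
      refine ((mem_stagePoset_UF hDC hx (hy.2.1 i)).2 ?_).2
      rw [h, ← mem_stagePoset_UF hDC hy (hy.2.1 i)]
      exact ⟨hy.2.1 i, i, stagePoset_le.2 (Or.inl rfl)⟩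
  open_fin := by
    obtain ⟨P, hP, key⟩ := exists_triples S (r := fun _ c U : M => FinSub c (right U)) inferInstance
    refine ⟨P, hP, fun y hy c => ⟨fun hc => ?_, ?_⟩⟩
    · obtain ⟨i, hi⟩ := exists_sub_stage hy hc
      exact ⟨0, y i, hy.2.1 i, (key _ _ _).2 (hi i le_rfl), hy.2.1 i, i,
        stagePoset_le.2 (Or.inl rfl)⟩
    · rintro ⟨n, U, hU, hn, h⟩
      exact fun j hj => (mem_stagePoset_UF hDC hy hU).1 h j ((key _ _ _).1 hn j hj)
  open_basis := by
    obtain ⟨P, hP, key⟩ := exists_triples S (r := fun _ V c : M => c = right V) inferInstance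
    refine ⟨P, hP, fun y hy V hV => (mem_stagePoset_UF hDC hy hV).trans
      ⟨fun h => ⟨0, _, (key _ _ _).2 rfl, h⟩, ?_⟩⟩
    rintro ⟨n, c, hn, hc⟩
    rwa [(key _ _ _).1 hn] at hc

end StagePoset

/-- In `Π¹₁-CA₀`, every `Π⁰₂`-subspace of `P(ℕ)` is homeomorphic to a UF space. -/
theorem Pi11CA0.homeomorphic_UF (h : Pi11CA0 S) (C : Pi02Code S) :
    ∃ P : PosetCode S, Homeomorphic S C.space P.UF := by
  haveI := Fact.mk h.aca
  obtain ⟨A, hA, D, hD, hDC, hdense⟩ := h.exists_dense C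
  exact ⟨stagePoset C hA hD, (presents_space C).homeomorphic (presents_stagePoset hDC hdense)⟩

end StagePoset1

section QuasiMetrics

variable {M : Type u} [Nums M] {S : Set (Set M)} [hS : Fact (RCA0 S)]
variable {α β γ : Type u} [Cod S α] [Cod S β] [Cod S γ]

/-! ### Quasi-metrics from sequences of preorders -/

/-- A sequence of preorders `R n` determines a quasi-metric with `d(a, b) = 2 ^ (-N)` for
the least `N` such that `R N a b` fails, and `d(a, b) = 0` if there is no such `N`. -/
theorem exists_qMetCode [Fact (ACA S)] {A : Set M} (hA : A ∈ S) (hne : A.Nonempty)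
    {R : M → M → M → Prop} (hR : Rel3 S R) (refl : ∀ n a, R n a a)
    (trans : ∀ n a b c, R n a b → R n b c → R n a c) :
    ∃ X : QMetCode S, X.A = A ∧ ∀ a b r, 0 < r →
      (X.DLt a b r ↔ ∃ N, hp S N < r ∧ ∀ n < N, R n a b) := by
  classical
  obtain ⟨f, hf, hfR⟩ := exists_search S (α := M × M)
    (p := fun y z => (∀ n, R n y.1 y.2) ∨ ¬ R z y.1 y.2) inferInstance (fun y => by
      by_cases h : ∀ n, R n y.1 y.2
      · exact ⟨0, Or.inl h⟩
      · obtain ⟨n, hn⟩ := not_forall.1 h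
        exact ⟨n, Or.inr hn⟩)
  set d : M → M → M → Rat0 M := fun a b _ =>
    if ∀ n, R n a b then Rat0.zero else halfPow S (f (a, b))
  have hd0 : ∀ a b k, 0 ≤ (d a b k).val := fun a b k => by
    by_cases h : ∀ n, R n a b
    · simp [d, h]
    · simpa [d, h] using (hp_pos _).le
  have hd : ∀ a b k r, 0 < r → ((d a b k).val < r ↔ ∃ N, hp S N < r ∧ ∀ n < N, R n a b) := by
    intro a b k r hr
    by_cases h : ∀ n, R n a b
    · obtain ⟨N, hN⟩ := exists_hp_lt S hr
      simp only [d, if_pos h, Rat0.val_zero, hr, true_iff]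
      exact ⟨N, hN, fun n _ => h n⟩
    · simp only [d, if_neg h, val_halfPow]
      obtain ⟨h1, h2⟩ := hfR (a, b)
      refine ⟨fun h' => ⟨_, h', fun n hn => not_not.1 (not_or.1 (h2 n hn)).2⟩, ?_⟩
      rintro ⟨N, hN, hNR⟩
      exact (hp_anti (not_lt.1 fun hlt => h1.resolve_left h (hNR _ hlt))).trans_lt hN
  refine ⟨⟨A, d, hA, ?_, hne, fun a _ b _ => ?_, fun a _ b _ => ?_, fun a _ => ?_,
    fun a _ b _ c _ => ?_⟩, rfl, fun a b r hr => ?_⟩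
  · have hrec : Rec S fun y : (M × M) × M => (d y.1.1 y.1.2 y.2).code := by
      have e : (fun y : (M × M) × M => (d y.1.1 y.1.2 y.2).code) = fun y =>
          if ∀ n, R n y.1.1 y.1.2 then Rat0.zero.code
          else pair (pair 1 0) (pwPred S (f (y.1.1, y.1.2))) := by
        funext y
        exact apply_ite _ _ _ _
      rw [e]
      haveI : Rec S fun y : (M × M) × M => f (y.1.1, y.1.2) :=
        Rec.comp f fun y : (M × M) × M => (y.1.1, y.1.2)
      infer_instance
    convert hrec.mem using 1
    ext z
    constructor
    · rintro ⟨a, b, k, rfl⟩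
      exact ⟨((a, b), k), rfl⟩
    · rintro ⟨⟨⟨a, b⟩, k⟩, rfl⟩
      exact ⟨a, b, k, rfl⟩
  · rw [isReal_iff]
    intro k i
    have := hp_pos (S := S) k
    constructor <;> simp only [d] <;> linarith
  · rw [realLe_iff]
    intro k
    have := hp_pos (S := S) k
    have := hd0 a b k
    simp only [realConst, Rat0.val_zero]
    linarith
  · have h : ∀ k, (d a a k).val = 0 := fun k => by simp [d, refl]
    constructor <;> rw [realLe_iff] <;> intro k <;> have := hp_pos (S := S) k <;>
      simp only [realConst, Rat0.val_zero, h] <;> linarith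
  · rw [realLe_iff]
    intro k
    simp only [realAdd, Rat0.val_add]
    by_contra! hcon
    have h1 := hd0 a b (k + 1)
    have h2 := hd0 b c (k + 1)
    have h3 := hp_pos (S := S) k
    have h4 : 0 < (d a c k).val := by linarith
    obtain ⟨N, hN, hNR⟩ := (hd a b (k + 1) _ h4).1 (by linarith)
    obtain ⟨N', hN', hNR'⟩ := (hd b c (k + 1) _ h4).1 (by linarith)
    refine lt_irrefl _ ((hd a c k _ h4).2 ⟨min N N', ?_, fun n hn => trans n a b c
      (hNR n (hn.trans_le (min_le_left _ _))) (hNR' n (hn.trans_le (min_le_right _ _)))⟩)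
    rcases min_choice N N' with h | h <;> rwa [h]
  · rw [← hd a b 0 r hr]
    constructor
    · rintro ⟨k, hk⟩
      have := hp_pos (S := S) k
      have h : (d a b k).val + 2 * hp S k < r := hk
      have e : (d a b k).val = (d a b 0).val := rfl
      linarith
    · intro h
      obtain ⟨k, hk⟩ := exists_hp_lt S (half_pos (sub_pos.2 h))
      refine ⟨k, ?_⟩
      change (d a b 0).val + 2 * hp S k < r
      linarith

end QuasiMetrics

section Limits1

variable {M : Type u} [Nums M] {S : Set (Set M)} [hS : Fact (RCA0 S)]
variable {α β γ : Type u} [Cod S α] [Cod S β] [Cod S γ]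

/-! ### A quasi-metric for a `Π⁰₂`-subspace -/

/-- Agreement of sets up to `N`, in the sense suitable for a quasi-metric: below `N`, the set `Z`
contains the elements of `X`, and it satisfies the clauses of `C` which apply to `X` with witnesses
at most as large as those for `X`. The last condition ensures that limits of elements of `C` belong
to `C`. -/
def Match (C : Pi02Code S) (N : M) (X Z : Set M) : Prop :=
  (∀ j, j < N → j ∈ X → j ∈ Z) ∧ ∀ i, i < N → (∃ v, v < N ∧ CWit C i v X) →
    ∀ w, OWit C i w X → ∃ w', w' ≤ w ∧ OWit C i w' Z

namespace Match

variable {C : Pi02Code S} {N N' : M} {X Y Z : Set M}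

theorem of_subset (h : X ⊆ Z) : Match C N X Z :=
  ⟨fun _ _ hj => h hj, fun _ _ _ w hw => ⟨w, le_rfl, hw.mono h⟩⟩

theorem trans (h : Match C N X Y) (h' : Match C N Y Z) : Match C N X Z := by
  refine ⟨fun j hj hX => h'.1 j hj (h.1 j hj hX), fun i hi ⟨v, hv, hvX⟩ w hw => ?_⟩
  obtain ⟨w', hw', hwY⟩ := h.2 i hi ⟨v, hv, hvX⟩ w hw
  obtain ⟨w'', hw'', hwZ⟩ := h'.2 i hi ⟨v, hv, hvX.1, hvX.2.1, fun j hj =>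
    h.1 j (hj.lt.trans_le ((right_le v).trans hv.le)) (hvX.2.2 j hj)⟩ w' hwY
  exact ⟨w'', hw''.trans hw', hwZ⟩

theorem anti (h : Match C N X Z) (hN : N' ≤ N) : Match C N' X Z :=
  ⟨fun j hj => h.1 j (hj.trans_le hN), fun i hi ⟨v, hv, hvX⟩ =>
    h.2 i (hi.trans_le hN) ⟨v, hv.trans_le hN, hvX⟩⟩

end Match

theorem dec_match [Fact (ACA S)] (C : Pi02Code S) (N : α → M) (X Z : α → Set M) [Rec S N]
    (hX : Dec S fun y : α × M => y.2 ∈ X y.1) (hZ : Dec S fun y : α × M => y.2 ∈ Z y.1) :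
    Dec S fun a => Match C (N a) (X a) (Z a) := by
  haveI := Fact.mk C.op_mem
  haveI := Fact.mk C.cl_mem
  haveI : ∀ {δ : Type u} [Cod S δ] (u : δ → α) [Rec S u], Rec S (fun d => N (u d)) :=
    fun u => Rec.comp N u
  haveI : ∀ {δ : Type u} [Cod S δ] (u : δ → α) (v : δ → M) [Rec S u] [Rec S v],
      Dec S (fun d => v d ∈ X (u d)) := fun u v =>
    Dec.comp (fun y : α × M => y.2 ∈ X y.1) fun d => (u d, v d)
  haveI : ∀ {δ : Type u} [Cod S δ] (u : δ → α) (v : δ → M) [Rec S u] [Rec S v],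
      Dec S (fun d => v d ∈ Z (u d)) := fun u v =>
    Dec.comp (fun y : α × M => y.2 ∈ Z y.1) fun d => (u d, v d)
  simp only [Match, CWit, OWit, Sub]
  infer_instance

/-- An element of `C` matches all sets containing a sufficiently long initial segment of it, and is
matched by all sets sharing one with it. -/
theorem exists_match {C : Pi02Code S} {L : Set M} (hL : L ∈ S) (hLC : InY C L) (N : M) :
    ∃ K, ∀ Z, (∀ j < K, j ∈ L → j ∈ Z) →
      Match C N L Z ∧ ((∀ j < K, j ∈ Z → j ∈ L) → Match C N Z L) := by
  haveI := Fact.mk hL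
  obtain ⟨B, hB⟩ := bounding S (p := fun i w => (∃ v, v < N ∧ CWit C i v L) →
    OWit C i w L ∧ ∀ w', w' < w → ¬ OWit C i w' L) inferInstance N (fun i _ => by
      by_cases h : ∃ v, v < N ∧ CWit C i v L
      · obtain ⟨v, -, hv⟩ := h
        obtain ⟨w, hw, hw'⟩ := exists_least S (p := fun w => OWit C i w L) inferInstance
          (inY_iff.1 hLC i ⟨v, hv⟩)
        exact ⟨w, fun _ => ⟨hw, hw'⟩⟩
      · exact ⟨0, fun h' => (h h').elim⟩)
  refine ⟨N + B, fun Z hLZ => ⟨⟨fun j hj => hLZ j (hj.trans_le le_self_add),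
    fun i hi h w hw => ?_⟩, fun hZL => ⟨fun j hj => hZL j (hj.trans_le le_self_add),
    fun i hi ⟨v, hv, hvZ⟩ w hw => ?_⟩⟩⟩
  · obtain ⟨w₀, hw₀, h₀⟩ := hB i hi
    refine ⟨w₀, not_lt.1 fun hlt => (h₀ h).2 w hlt hw, (h₀ h).1.1, (h₀ h).1.2.1, fun j hj => ?_⟩
    exact hLZ j (((hj.lt.trans_le (right_le _)).trans hw₀).trans_le le_add_self)
      ((h₀ h).1.2.2 j hj)
  · obtain ⟨w₀, hw₀, h₀⟩ := hB i hi
    have h := h₀ ⟨v, hv, hvZ.1, hvZ.2.1, fun j hj => hZL j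
      (((hj.lt.trans_le (right_le _)).trans hv).trans_le le_self_add) (hvZ.2.2 j hj)⟩
    rcases le_or_gt w₀ w with hle | hlt
    · exact ⟨w₀, hle, h.1⟩
    · exact ⟨w, le_rfl, hw.1, hw.2.1, fun j hj => hZL j
        (((hj.lt.trans_le (right_le _)).trans (hlt.trans hw₀)).trans_le le_add_self) (hw.2.2 j hj)⟩

section Limits

variable [hACA : Fact (ACA S)] {C : Pi02Code S} {D : M → Set M} {A : Set M}

/-- The limit of the sets `D (a n)`, if each of them matches the later ones. The index `0` is
omitted because the condition in Smyth-completeness concerns positive indices only. -/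
def limSet (D : M → Set M) (a : M → M) : Set M := {j | ∃ n, j ≤ n ∧ 0 < n ∧ j ∈ D (a n)}

theorem limSet_mem (hD : Dec S fun y : M × M => y.2 ∈ D y.1) {a : M → M} (ha : IsFun S a) :
    limSet D a ∈ S := by
  haveI := fn1_of_isFun ha
  haveI : ∀ {δ : Type u} [Cod S δ] (f g : δ → M) [Rec S f] [Rec S g],
      Dec S fun d => f d ∈ D (g d) := fun f g => Dec.comp (fun y : M × M => y.2 ∈ D y.1)
    fun d => (g d, f d)
  exact Dec.setOf_mem (S := S) fun j : M => ∃ n, j ≤ n ∧ 0 < n ∧ j ∈ D (a n)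

variable {a : M → M} (ha : IsFun S a)
  (hCauchy : ∀ n m, 0 < n → n < m → Match C (n + 1) (D (a n)) (D (a m)))

include hCauchy in
theorem mem_of_mem_limSet {j n m : M} (hj : j ≤ n) (hn : 0 < n) (h : j ∈ D (a n)) (hm : n ≤ m) :
    j ∈ D (a m) := by
  rcases hm.lt_or_eq with hm | rfl
  · exact (hCauchy n m hn hm).1 j (lt_add_one_iff.2 hj) h
  · exact h

include ha hCauchy in
theorem eventually_sub (hD : Dec S fun y : M × M => y.2 ∈ D y.1) {c : M}
    (hc : Sub c (limSet D a)) : ∃ n, ∀ m, n ≤ m → Sub c (D (a m)) := by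
  haveI := fn1_of_isFun ha
  haveI : ∀ {δ : Type u} [Cod S δ] (f g : δ → M) [Rec S f] [Rec S g],
      Dec S fun d => f d ∈ D (g d) := fun f g => Dec.comp (fun y : M × M => y.2 ∈ D y.1)
    fun d => (g d, f d)
  obtain ⟨b, hb⟩ := bounding_mono S (p := fun j n => FinMem j c → ∃ n', n' ≤ n ∧
      j ≤ n' ∧ 0 < n' ∧ j ∈ D (a n')) inferInstance
    (fun j m m' hm h hj => by
      obtain ⟨n', h1, h2⟩ := h hj
      exact ⟨n', h1.trans hm, h2⟩) c (fun j _ => by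
      by_cases hj : FinMem j c
      · obtain ⟨n, hn⟩ := hc j hj
        exact ⟨n, fun _ => ⟨n, le_rfl, hn⟩⟩
      · exact ⟨0, fun h => (hj h).elim⟩)
  refine ⟨b, fun m hm j hj => ?_⟩
  obtain ⟨n, h1, h2, h3, h4⟩ := hb j hj.lt hj
  exact mem_of_mem_limSet hCauchy h2 h3 h4 (h1.trans hm)

include hCauchy in
theorem match_limSet {n : M} (hn : 0 < n) : Match C (n + 1) (D (a n)) (limSet D a) := by
  refine ⟨fun j hj h => ⟨n, lt_add_one_iff.1 hj, hn, h⟩, fun i hi h w hw => ?_⟩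
  -- at a stage beyond `w`, the elements coded by a witness `w' ≤ w` are in the limit
  obtain ⟨w', hw', h'⟩ := (hCauchy n (n + w + 1) hn
    (lt_add_one_iff.2 le_self_add)).2 i hi h w hw
  refine ⟨w', hw', h'.1, h'.2.1, fun j hj => ⟨n + w + 1, ?_, ?_, h'.2.2 j hj⟩⟩
  · refine (hj.lt.le.trans ((right_le w').trans hw')).trans ?_
    exact le_add_self.trans le_self_add
  · exact hn.trans (lt_add_one_iff.2 le_self_add)

include ha hCauchy in
/-- Limits of elements of `C` belong to `C`: a clause which applies to the limit applies to the
terms from some stage on, and the bound on witnesses lets one of them survive in the limit. -/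
theorem inY_limSet (hD : Dec S fun y : M × M => y.2 ∈ D y.1) (haC : ∀ n, InY C (D (a n))) :
    InY C (limSet D a) := by
  rw [inY_iff]
  rintro i ⟨v, hv⟩
  obtain ⟨b, hb⟩ := eventually_sub ha hCauchy hD hv.2.2
  have h1 : 0 < b + (i + v) + 1 := lt_add_one_iff.2 zero_le
  have h2 : i + v < b + (i + v) + 1 + 1 :=
    lt_add_one_iff.2 (le_add_self.trans le_self_add)
  have hv' : CWit C i v (D (a (b + (i + v) + 1))) :=
    ⟨hv.1, hv.2.1, hb _ (by rw [add_assoc]; exact le_self_add)⟩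
  obtain ⟨w, hw⟩ := inY_iff.1 (haC _) i ⟨v, hv'⟩
  obtain ⟨w', -, hw'⟩ := (match_limSet hCauchy h1).2 i (le_self_add.trans_lt h2)
    ⟨v, le_add_self.trans_lt h2, hv'⟩ w hw
  exact ⟨w', hw'⟩

include ha in
/-- For a sequence which is Cauchy in both directions, the limit matches the terms of the
sequence. -/
theorem limSet_match (hD : Dec S fun y : M × M => y.2 ∈ D y.1)
    (h : ∀ n m, n < m → Match C (n + 1) (D (a n)) (D (a m)) ∧ Match C (n + 1) (D (a m)) (D (a n)))
    (n : M) : Match C (n + 1) (limSet D a) (D (a n)) := by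
  have hCauchy : ∀ n m, 0 < n → n < m → Match C (n + 1) (D (a n)) (D (a m)) :=
    fun n m _ hm => (h n m hm).1
  refine ⟨fun j hj ⟨m, hjm, hm, hjD⟩ => ?_, fun i hi ⟨v, hv, hvL⟩ w hw => ?_⟩
  · exact (h n (m + n + 1) (lt_add_one_iff.2 le_add_self)).2.1 j hj
      (mem_of_mem_limSet hCauchy hjm hm hjD (by rw [add_assoc]; exact le_self_add))
  · obtain ⟨b, hb⟩ := eventually_sub ha hCauchy hD hvL.2.2
    obtain ⟨b', hb'⟩ := eventually_sub ha hCauchy hD hw.2.2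
    refine (h n (b + b' + n + 1) (lt_add_one_iff.2 le_add_self)).2.2 i hi
      ⟨v, hv, hvL.1, hvL.2.1, hb _ ?_⟩ w ⟨hw.1, hw.2.1, hb' _ ?_⟩
    · rw [add_assoc, add_assoc]
      exact le_self_add
    · rw [add_assoc, add_assoc]
      exact le_self_add.trans le_add_self

/-- Every element of `C` is the limit of a sequence in a dense set, with matching in both
directions. -/
theorem exists_match_seq (hA : A ∈ S) (hD : Dec S fun y : M × M => y.2 ∈ D y.1)
    (hdense : ∀ X ∈ S, InY C X → ∀ m, ∃ t ∈ A, ∀ j < m, j ∈ D t ↔ j ∈ X) {L : Set M} (hL : L ∈ S)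
    (hLC : InY C L) : ∃ b, IsFun S b ∧ ∀ n, b n ∈ A ∧ Match C (n + 1) (D (b n)) L ∧
      Match C (n + 1) L (D (b n)) := by
  haveI := Fact.mk hA
  haveI := Fact.mk hL
  have h1 : Dec S fun y : M × M => Match C (y.1 + 1) (D y.2) L := dec_match C _ _ _
    (Dec.comp (fun y : M × M => y.2 ∈ D y.1) fun y : (M × M) × M => (y.1.2, y.2))
    (by infer_instance)
  have h2 : Dec S fun y : M × M => Match C (y.1 + 1) L (D y.2) := dec_match C _ _ _
    (by infer_instance)
    (Dec.comp (fun y : M × M => y.2 ∈ D y.1) fun y : (M × M) × M => (y.1.2, y.2))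
  obtain ⟨b, hb, hb'⟩ := exists_search S (p := fun n t => t ∈ A ∧ Match C (n + 1) (D t) L ∧
    Match C (n + 1) L (D t)) (by infer_instance) (fun n => by
      obtain ⟨K, hK⟩ := exists_match hL hLC (n + 1)
      obtain ⟨t, ht, htL⟩ := hdense L hL hLC K
      obtain ⟨h3, h4⟩ := hK (D t) fun j hj => (htL j hj).2
      exact ⟨t, ht, h4 fun j hj => (htL j hj).1, h3⟩)
  exact ⟨b, (isFun_iff _).2 hb, fun n => (hb' n).1⟩

end Limits

end Limits1

section QuasiPolish1

variable {M : Type u} [Nums M] {S : Set (Set M)} [hS : Fact (RCA0 S)]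
variable {α β γ : Type u} [Cod S α] [Cod S β] [Cod S γ]

/-! ### Quasi-Polish presentations -/

section QuasiPolish

variable [hACA : Fact (ACA S)] {C : Pi02Code S} {D : M → Set M} {A : Set M} {X : QMetCode S}

/-- The quasi-metric of `X` is given by matching of the sets `D a`. -/
def IsMatchMetric (C : Pi02Code S) (D : M → Set M) (X : QMetCode S) : Prop :=
  ∀ a b r, 0 < r → (X.DLt a b r ↔ ∃ N, hp S N < r ∧ Match C N (D a) (D b))

/-- Matching defines a quasi-metric on the indices of the sets `D a`. -/
theorem exists_matchMetric (hA : A ∈ S) (hne : A.Nonempty)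
    (hD : Dec S fun y : M × M => y.2 ∈ D y.1) :
    ∃ X : QMetCode S, X.A = A ∧ IsMatchMetric C D X := by
  have hR : Dec S fun y : M × M × M => Match C (y.1 + 1) (D y.2.1) (D y.2.2) := dec_match C _ _ _
    (Dec.comp (fun y : M × M => y.2 ∈ D y.1) fun y : (M × M × M) × M => (y.1.2.1, y.2))
    (Dec.comp (fun y : M × M => y.2 ∈ D y.1) fun y : (M × M × M) × M => (y.1.2.2, y.2))
  obtain ⟨X, hXA, hX⟩ := exists_qMetCode (S := S) hA hne (R := fun n a b =>
    Match C (n + 1) (D a) (D b)) ⟨hR⟩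
    (fun _ _ => .of_subset le_rfl) (fun _ _ _ _ => Match.trans)
  refine ⟨X, hXA, fun a b r hr => (hX a b r hr).trans (exists_congr fun N =>
    and_congr_right fun _ => ⟨fun h => ?_, fun h n hn => h.anti (add_one_le_iff.2 hn)⟩)⟩
  rcases eq_zero_or_succ N with rfl | ⟨n, rfl⟩
  · exact ⟨fun j hj => absurd hj not_lt_zero, fun i hi => absurd hi not_lt_zero⟩
  · exact h n (lt_add_one_iff.2 le_rfl)

theorem IsMatchMetric.dLt_iff (hX : IsMatchMetric C D X) {a b k : M} :
    X.DLt a b (hp S k) ↔ Match C (k + 1) (D a) (D b) := by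
  rw [hX a b _ (hp_pos k)]
  constructor
  · rintro ⟨N, hN, h⟩
    exact h.anti (add_one_le_iff.2 (lt_of_hp_lt hN))
  · intro h
    exact ⟨k + 1, by linarith [hp_succ (S := S) k, hp_pos (S := S) k], h⟩

theorem IsMatchMetric.pt_iff (hX : IsMatchMetric C D X) {x : M → M} : X.space.pt x ↔
    IsFun S x ∧ (∀ n, x n ∈ X.A) ∧ ∀ n m, n < m →
      Match C (n + 1) (D (x n)) (D (x m)) ∧ Match C (n + 1) (D (x m)) (D (x n)) := by
  simp only [X.pt_iff, hX.dLt_iff]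

/-- A point matches the set it represents. -/
theorem IsMatchMetric.match_pt (hX : IsMatchMetric C D X)
    (hD : Dec S fun y : M × M => y.2 ∈ D y.1) {x : M → M} (hx : X.space.pt x) (n : M) :
    Match C (n + 1) (D (x n)) (limSet D x) ∧ Match C (n + 1) (limSet D x) (D (x n)) := by
  obtain ⟨h1, -, h2⟩ := hX.pt_iff.1 hx
  refine ⟨?_, limSet_match h1 hD h2 n⟩
  have hlt : n < n + 1 := lt_add_one_iff.2 le_rfl
  exact (h2 n (n + 1) hlt).1.trans ((match_limSet (fun n m _ hm => (h2 n m hm).1)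
    (lt_add_one_iff.2 zero_le)).anti (add_one_le_iff.2 (hlt.trans (lt_add_one_iff.2 le_rfl))))

/-- A sequence matching `L` in both directions is a point representing `L`. -/
theorem IsMatchMetric.pt_of_match (hX : IsMatchMetric C D X) {b : M → M} {L : Set M}
    (hb : IsFun S b) (h : ∀ n, b n ∈ X.A ∧ Match C (n + 1) (D (b n)) L ∧
      Match C (n + 1) L (D (b n))) : X.space.pt b ∧ limSet D b = L := by
  refine ⟨hX.pt_iff.2 ⟨hb, fun n => (h n).1, fun n m hm => ?_⟩, ?_⟩
  · have hm' : n + 1 ≤ m + 1 := add_one_le_iff.2 (hm.trans (lt_add_one_iff.2 le_rfl))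
    exact ⟨(h n).2.1.trans ((h m).2.2.anti hm'), ((h m).2.1.anti hm').trans (h n).2.2⟩
  · ext j
    constructor
    · rintro ⟨n, hj, -, hn⟩
      exact (h n).2.1.1 j (lt_add_one_iff.2 hj) hn
    · intro hj
      exact ⟨j + 1, le_self_add, lt_add_one_iff.2 zero_le, (h (j + 1)).2.2.1 j
        (lt_add_one_iff.2 le_self_add) hj⟩

/-- The limit of a sequence which is Cauchy in the forward direction belongs to `C`, and a point
representing it is a limit in the sense of Smyth-completeness. -/
theorem IsMatchMetric.smythComplete (hX : IsMatchMetric C D X)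
    (hD : Dec S fun y : M × M => y.2 ∈ D y.1) (hDC : ∀ t ∈ X.A, InY C (D t))
    (hdense : ∀ Z ∈ S, InY C Z → ∀ m, ∃ t ∈ X.A, ∀ j < m, j ∈ D t ↔ j ∈ Z) :
    X.SmythComplete := by
  intro a ha haA hCauchy
  have hCauchy' : ∀ n m, 0 < n → n < m → Match C (n + 1) (D (a n)) (D (a m)) := fun n m hn hm => by
    rw [← hX.dLt_iff]
    have := realLt_iff.1 (hCauchy n m _ hn hm (isHalfPow_iff.2 rfl))
    simpa only [realConst, val_halfPow, QMetCode.DLt] using this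
  have hL := limSet_mem hD ha
  have hLC := inY_limSet ha hCauchy' hD fun n => hDC _ (haA n)
  obtain ⟨b, hb, hbL⟩ := exists_match_seq X.A_mem hD hdense hL hLC
  refine ⟨b, (hX.pt_of_match hb hbL).1, fun n q hq => ?_, fun ε hε => ?_⟩
  · rw [isHalfPow_iff.1 hq, realLt_iff]
    simp only [realConst, val_halfPow]
    exact hX.dLt_iff.2 (((match_limSet hCauchy' (lt_add_one_iff.2 zero_le)).trans
      (hbL (n + 1)).2.2).anti le_self_add)
  · rw [Rat0.lt_iff, Rat0.val_zero] at hε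
    obtain ⟨k, hk⟩ := exists_hp_lt S hε
    obtain ⟨K, hK⟩ := exists_match hL hLC (k + 1)
    obtain ⟨c, hc⟩ := exists_code S (Dec.of_mem hL) K
    obtain ⟨n₀, hn₀⟩ := eventually_sub ha hCauchy' hD (c := c) fun j hj => ((hc j).1 hj).2
    refine ⟨k + n₀, fun n hn => ?_⟩
    rw [realLt_iff]
    refine QMetCode.DLt.mono (hX.dLt_iff.2 ?_) hk.le
    refine ((hbL n).2.1.anti ?_).trans (hK _ fun j hj hjL => ?_).1
    · exact add_one_le_iff.2 (lt_add_one_iff.2 ((le_self_add.trans_lt hn).le))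
    · exact hn₀ n ((le_add_self.trans_lt hn).le) j ((hc j).2 ⟨hj, hjL⟩)

/-- Membership of a point in a ball depends on the set represented by the point only. -/
theorem IsMatchMetric.mem_iff (hX : IsMatchMetric C D X)
    (hD : Dec S fun y : M × M => y.2 ∈ D y.1) {x : M → M} (hx : X.space.pt x) {a : M} {q : Rat0 M} :
    X.space.mem x (pair a q.code) ↔
      a ∈ X.A ∧ 0 < q.val ∧ ∃ N, hp S N < q.val ∧ Match C N (D a) (limSet D x) := by
  rw [QMetCode.mem_ball hx]
  refine and_congr_right fun ha => and_congr_right fun hq => ⟨?_, ?_⟩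
  · rintro ⟨k, hk⟩
    have hpk := hp_pos (S := S) k
    obtain ⟨N, hN, h⟩ := (hX _ _ _ (hk.pos ha ((hX.pt_iff.1 hx).2.1 k))).1 hk
    have h' := (hX.match_pt hD hx k).1
    rcases le_total N (k + 1) with hle | hle
    · exact ⟨N, by linarith, h.trans (h'.anti hle)⟩
    · refine ⟨k + 1, ?_, (h.anti hle).trans h'⟩
      have := hp_pos (S := S) N
      have := hp_succ (S := S) k
      linarith
  · rintro ⟨N, hN, h⟩
    obtain ⟨k, hk⟩ := exists_hp_lt S (sub_pos.2 hN)
    have hk' := hp_anti (S := S) (le_add_self : k ≤ N + k)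
    refine ⟨N + k, (hX _ _ _ ?_).2 ⟨N, ?_, h.trans ((hX.match_pt hD hx (N + k)).2.anti ?_)⟩⟩
    · have := hp_pos (S := S) N
      linarith
    · linarith
    · rw [add_assoc]
      exact le_self_add

/-- The space of the matching quasi-metric presents `C`, each point representing the limit of its
terms. -/
theorem IsMatchMetric.presents (hX : IsMatchMetric C D X)
    (hD : Dec S fun y : M × M => y.2 ∈ D y.1) (hDC : ∀ t ∈ X.A, InY C (D t))
    (hdense : ∀ Z ∈ S, InY C Z → ∀ m, ∃ t ∈ X.A, ∀ j < m, j ∈ D t ↔ j ∈ Z) :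
    Presents C X.space (limSet D) where
  valid x hx := by
    obtain ⟨h1, h2, h3⟩ := hX.pt_iff.1 hx
    exact ⟨limSet_mem hD h1, inY_limSet h1 (fun n m _ hm => (h3 n m hm).1) hD fun n => hDC _ (h2 n)⟩
  surj Z hZ hZC := by
    obtain ⟨b, hb, hbZ⟩ := exists_match_seq X.A_mem hD hdense hZ hZC
    exact ⟨b, hX.pt_of_match hb hbZ⟩
  eqv x y hx hy e := by
    constructor
    · rw [QMetCode.realEq_dist_iff hx hy]
      exact fun k => ⟨k, le_rfl, hX.dLt_iff.2 ((hX.match_pt hD hx k).1.trans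
        (e ▸ (hX.match_pt hD hy k).2))⟩
    · rw [QMetCode.realEq_dist_iff hy hx]
      exact fun k => ⟨k, le_rfl, hX.dLt_iff.2 ((hX.match_pt hD hy k).1.trans
        (e ▸ (hX.match_pt hD hx k).2))⟩
  open_fin := by
    haveI := Fact.mk X.A_mem
    haveI : ∀ {δ : Type u} [Cod S δ] (f g : δ → M) [Rec S f] [Rec S g],
        Dec S fun d => f d ∈ D (g d) := fun f g => Dec.comp (fun y : M × M => y.2 ∈ D y.1)
      fun d => (g d, f d)
    obtain ⟨P, hP, key⟩ := exists_triples S (r := fun _ c U : M => U = pair (left U)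
      (pair (pair 1 0) (pwPred S c)) ∧ ∀ j, j < c → FinMem j c → j ∈ D (left U)) (by infer_instance)
    have key' : ∀ n c U, pair n (pair c U) ∈ P ↔ U = pair (left U) (halfPow S c).code ∧
        Sub c (D (left U)) := fun n c U => by
      rw [key, sub_iff]
      rfl
    refine ⟨P, hP, fun x hx c => ⟨fun hc => ?_, ?_⟩⟩
    · have hmatch := hX.match_pt hD hx c
      have hA := (hX.pt_iff.1 hx).2.1 c
      have hpos : 0 < (halfPow S c).val := by simpa using hp_pos c
      refine ⟨0, pair (x c) (halfPow S c).code, ⟨_, _, rfl, hA, ?_⟩, (key' _ _ _).2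
        ⟨by simp, fun j hj => ?_⟩, (hX.mem_iff hD hx).2 ⟨hA, hpos, c + 1, ?_, hmatch.1⟩⟩
      · rwa [Rat0.lt_iff, Rat0.val_zero]
      · rw [left_pair]
        exact hmatch.2.1 j (hj.lt.trans (lt_add_one_iff.2 le_rfl)) (hc j hj)
      · rw [val_halfPow]
        linarith [hp_succ (S := S) c, hp_pos (S := S) c]
    · rintro ⟨n, U, -, hU, h⟩ j hj
      obtain ⟨e, hsub⟩ := (key' _ _ _).1 hU
      rw [e, hX.mem_iff hD hx, val_halfPow] at h
      obtain ⟨-, -, N, hN, hmatch⟩ := h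
      exact hmatch.1 j (hj.lt.trans (lt_of_hp_lt hN)) (hsub j hj)
  open_basis := by
    have h1 : Dec S fun y : M × M × M => Match C y.1 (D (left y.2.1)) (fin y.2.2) :=
      dec_match C _ _ _ (Dec.comp (fun y : M × M => y.2 ∈ D y.1)
        fun y : (M × M × M) × M => (left y.1.2.1, y.2))
        (inferInstance : Dec S fun y : (M × M × M) × M => FinMem y.2 y.1.2.2)
    have h2 : Dec S fun y : M × M × M => hp S y.1 < (ratOf (right y.2.1)).val := by
      have : Dec S fun y : M × M × M => Rat0.Lt (halfPow S y.1) (ratOf (right y.2.1)) := by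
        simp only [Rat0.Lt, ratOf, halfPow]
        infer_instance
      refine this.congr fun y => ?_
      rw [Rat0.lt_iff, val_halfPow]
    obtain ⟨P, hP, key⟩ := exists_triples S (r := fun n V c => hp S n < (ratOf (right V)).val ∧
      Match C n (D (left V)) (fin c)) (by infer_instance)
    refine ⟨P, hP, fun x hx V hV => ?_⟩
    obtain ⟨e, hA, hpos⟩ := QMetCode.basis_eq hV
    have hLx := limSet_mem hD (hX.pt_iff.1 hx).1
    have hLC : InY C (limSet D x) := inY_limSet (hX.pt_iff.1 hx).1
      (fun n m _ hm => ((hX.pt_iff.1 hx).2.2 n m hm).1) hD fun n => hDC _ ((hX.pt_iff.1 hx).2.1 n)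
    simp only [key]
    rw [e, hX.mem_iff hD hx, ← e]
    constructor
    · rintro ⟨-, -, N, hN, hmatch⟩
      obtain ⟨K, hK⟩ := exists_match hLx hLC N
      obtain ⟨c, hc⟩ := exists_code S (Dec.of_mem hLx) K
      exact ⟨N, c, ⟨hN, hmatch.trans (hK _ fun j hj hjL => (hc j).2 ⟨hj, hjL⟩).1⟩,
        fun j hj => ((hc j).1 hj).2⟩
    · rintro ⟨n, c, ⟨hn, hmatch⟩, hc⟩
      exact ⟨hA, hpos, n, hn, hmatch.trans (.of_subset hc)⟩

end QuasiPolish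

/-- In `Π¹₁-CA₀`, every nonempty `Π⁰₂`-subspace has a quasi-Polish presentation. -/
theorem Pi11CA0.exists_quasiPolish (h : Pi11CA0 S) {C : Pi02Code S} (hC : ∃ Z ∈ S, InY C Z) :
    ∃ (X : QMetCode S) (l : (M → M) → Set M), X.SmythComplete ∧ Presents C X.space l := by
  haveI := Fact.mk h.aca
  obtain ⟨A, hA, D, hD, hDC, hdense⟩ := h.exists_dense C
  obtain ⟨Z, hZ, hZC⟩ := hC
  obtain ⟨t, ht, -⟩ := hdense Z hZ hZC 0
  obtain ⟨X, rfl, hX⟩ := exists_matchMetric (C := C) hA ⟨t, ht⟩ hD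
  exact ⟨X, _, hX.smythComplete hD hDC hdense, hX.presents hD hDC hdense⟩

theorem Pi11CA0.homeomorphic_quasiPolish (h : Pi11CA0 S) {C : Pi02Code S} {Y : Space M}
    {l : (M → M) → Set M} (hY : Presents C Y l) (hne : Y.Nonempty) :
    ∃ X : QMetCode S, X.SmythComplete ∧ Homeomorphic S Y X.space := by
  obtain ⟨y, hy⟩ := hne
  obtain ⟨X, l', hX, hX'⟩ := h.exists_quasiPolish ⟨l y, hY.valid y hy⟩
  exact ⟨X, hX, hY.homeomorphic hX'⟩

end QuasiPolish1

section FilterCode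

variable {M : Type u} [Nums M] {S : Set (Set M)} [hS : Fact (RCA0 S)]
variable {α β γ : Type u} [Cod S α] [Cod S β] [Cod S γ]

/-! ### A `Π⁰₂` code for a UF space -/

namespace PosetCode

/-- `Z` is an unbounded filter on `P`. The last condition combines that `Z` is contained in `P`, is
downward directed and has no strict lower bound. -/
def IsFilter (P : PosetCode S) (Z : Set M) : Prop :=
  Z.Nonempty ∧ (∀ p q, p ∈ Z → q ∈ P.carrier → P.Le p q → q ∈ Z) ∧
    ∀ p q r, p ∈ Z → q ∈ Z →
      ∃ w, (p ∈ P.carrier ∧ P.Le w p ∧ P.Le w q ∧ ¬ (r ∈ P.carrier ∧ P.Lt r w)) ∧ w ∈ Z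

instance dec_le (P : PosetCode S) (f g : α → M) [Rec S f] [Rec S g] :
    Dec S fun a => P.Le (f a) (g a) :=
  haveI := Fact.mk P.rel_mem
  (inferInstance : Dec S fun a => pair (f a) (g a) ∈ P.rel)

instance (P : PosetCode S) : Fact (P.carrier ∈ S) := ⟨P.carrier_mem⟩

/-- The clauses saying that a set is an unbounded filter on `P`: the tags `0`, `1` and `1 + 1` mark
the clauses for the three conditions in `IsFilter`. -/
theorem exists_filterCode (P : PosetCode S) :
    ∃ C : Pi02Code S, ∀ Z, InY C Z ↔ P.IsFilter Z := by
  refine ⟨ruleCode S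
    (fun i c => left i = 0 ∨
      (left i = 1 ∧ FinMem (left (right i)) c ∧ right (right i) ∈ P.carrier ∧
        P.Le (left (right i)) (right (right i))) ∨
      (left i = 1 + 1 ∧ FinMem (left (left (right i))) c ∧ FinMem (right (left (right i))) c))
    (fun i w => left i = 0 ∨ (left i = 1 ∧ w = right (right i)) ∨
      (left i = 1 + 1 ∧ left (left (right i)) ∈ P.carrier ∧ P.Le w (left (left (right i))) ∧
        P.Le w (right (left (right i))) ∧
        ¬ (right (right i) ∈ P.carrier ∧ P.Le (right (right i)) w ∧ ¬ P.Le w (right (right i)))))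
    ⟨by infer_instance⟩ ⟨by infer_instance⟩, fun Z => ?_⟩
  have h10 : (1 + 1 : M) ≠ 0 := (lt_add_one_iff.2 zero_le).ne'
  have h11 : (1 + 1 : M) ≠ 1 := (lt_add_one_iff.2 le_rfl).ne'
  rw [inY_ruleCode]
  constructor
  · intro h
    refine ⟨?_, fun p q hp hq hpq => ?_, fun p q r hp hq => ?_⟩
    · obtain ⟨c, hc⟩ := exists_code S (p := fun _ : M => False) inferInstance 0
      obtain ⟨w, -, hw⟩ := h (pair 0 0) ⟨c, Or.inl (by simp), fun j hj => ((hc j).1 hj).2.elim⟩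
      exact ⟨w, hw⟩
    · obtain ⟨c, hc⟩ := exists_code S (p := fun j => j = p) inferInstance (p + 1)
      obtain ⟨w, hw, hwZ⟩ := h (pair 1 (pair p q)) ⟨c, Or.inr (Or.inl ⟨by simp,
        (hc _).2 (by simp), by simpa using hq, by simpa using hpq⟩), fun j hj =>
          ((hc j).1 hj).2 ▸ hp⟩
      simp only [left_pair, right_pair, one_ne_zero, false_or, true_and, h11.symm, false_and,
        or_false] at hw
      exact hw ▸ hwZ
    · obtain ⟨c, hc⟩ := exists_code S (p := fun j => j = p ∨ j = q) inferInstance (p + q + 1)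
      obtain ⟨w, hw, hwZ⟩ := h (pair (1 + 1) (pair (pair p q) r)) ⟨c, Or.inr (Or.inr ⟨by simp,
        (hc _).2 ⟨lt_add_one_iff.2 (by simp), by simp⟩,
        (hc _).2 ⟨lt_add_one_iff.2 (by simp), by simp⟩⟩), fun j hj => by
          rcases ((hc j).1 hj).2 with rfl | rfl
          exacts [hp, hq]⟩
      simp only [left_pair, right_pair, h10, h11, false_or, false_and, true_and] at hw
      exact ⟨w, hw, hwZ⟩
  · rintro ⟨⟨z, hz⟩, h1, h2⟩ i ⟨c, hc, hcZ⟩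
    rcases hc with h0 | ⟨hi, hp, hq, hpq⟩ | ⟨hi, hp, hq⟩
    · exact ⟨z, Or.inl h0, hz⟩
    · exact ⟨_, Or.inr (Or.inl ⟨hi, rfl⟩), h1 _ _ (hcZ _ hp) hq hpq⟩
    · obtain ⟨w, hw, hwZ⟩ := h2 _ _ (right (right i)) (hcZ _ hp) (hcZ _ hq)
      exact ⟨w, Or.inr (Or.inr ⟨hi, hw⟩), hwZ⟩

variable {P : PosetCode S}

theorem IsFilter.subset {Z : Set M} (h : P.IsFilter Z) {p : M} (hp : p ∈ Z) : p ∈ P.carrier := by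
  obtain ⟨w, hw, -⟩ := h.2.2 p p p hp hp
  exact hw.1

/-- The filter generated by a sequence. -/
def filterSet (P : PosetCode S) (y : M → M) : Set M := {p | P.InFilter y p}

theorem isFilter_filterSet {y : M → M} (hy : P.UF.pt y) : P.IsFilter (P.filterSet y) := by
  have hP := hy.2.1
  have hself : ∀ i, P.InFilter y (y i) := fun i => ⟨hP i, i, P.refl _ (hP i)⟩
  refine ⟨⟨y 0, hself 0⟩, ?_, ?_⟩
  · rintro p q ⟨hp, i, hi⟩ hq hpq
    exact ⟨hq, i, P.trans _ (hP i) _ hp _ hq hi hpq⟩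
  · rintro p q r ⟨hp, i, hi⟩ ⟨hq, j, hj⟩
    have hk : ∃ k, r ∈ P.carrier → ¬ P.Lt r (y k) := by
      by_cases hr : r ∈ P.carrier
      · by_contra! h
        refine hy.2.2.2 ⟨r, hr, fun p₀ ⟨hp₀, k, hk⟩ => ?_⟩
        obtain ⟨-, h1, h2⟩ := h k
        exact ⟨P.trans _ hr _ (hP k) _ hp₀ h1 hk,
          fun h3 => h2 (P.trans _ (hP k) _ hp₀ _ hr hk h3)⟩
      · exact ⟨0, fun h => (hr h).elim⟩
    obtain ⟨k, hk⟩ := hk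
    have hi' : P.Le (y (i + j + k)) (y i) := anti hy (by rw [add_assoc]; exact le_self_add)
    have hj' : P.Le (y (i + j + k)) (y j) := anti hy (le_add_self.trans le_self_add)
    have hk' : P.Le (y (i + j + k)) (y k) := anti hy le_add_self
    refine ⟨y (i + j + k), ⟨hp, P.trans _ (hP _) _ (hP _) _ hp hi' hi,
      P.trans _ (hP _) _ (hP _) _ hq hj' hj, fun ⟨hr, h1, h2⟩ => hk hr ⟨?_, fun h3 => h2 ?_⟩⟩,
      hself _⟩
    · exact P.trans _ hr _ (hP _) _ (hP k) h1 hk'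
    · exact P.trans _ (hP _) _ (hP k) _ hr hk' h3

/-- The sequence generating a filter moves, at stage `n`, below `n` if this belongs to the
filter. -/
theorem IsFilter.exists_pt {Z : Set M} (hZ : Z ∈ S) (h : P.IsFilter Z) :
    ∃ y, P.UF.pt y ∧ P.filterSet y = Z := by
  haveI := Fact.mk hZ
  obtain ⟨⟨z, hz⟩, h1, h2⟩ := id h
  obtain ⟨g, hg, hg'⟩ := exists_search S (α := M × M) (p := fun u w => u.2 ∈ Z →
    w ∈ Z ∧ P.Le w u.2 ∧ (u.1 ∈ Z → P.Le w u.1)) (by infer_instance) (by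
    rintro ⟨n, x⟩
    by_cases hx : x ∈ Z
    swap
    · exact ⟨0, fun h => (hx h).elim⟩
    by_cases hn : n ∈ Z
    · obtain ⟨w, ⟨-, hwx, hwn, -⟩, hw⟩ := h2 x n x hx hn
      exact ⟨w, fun _ => ⟨hw, hwx, fun _ => hwn⟩⟩
    · exact ⟨x, fun _ => ⟨hx, P.refl _ (h.subset hx), fun h => (hn h).elim⟩⟩)
  haveI : Rec S fun y : (M × M) × M => g (y.1.2, y.2) :=
    Rec.comp g fun y : (M × M) × M => (y.1.2, y.2)
  obtain ⟨f, hf, hfg⟩ := exists_primrec S (fun a : M => a) (fun _ n x => g (n, x))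
  obtain ⟨h0, hs⟩ := hfg z
  haveI : Fn1 S (f z) := ⟨Rec.comp (fun y : M × M => f y.1 y.2) fun n => (z, n)⟩
  have hfZ : ∀ n, f z n ∈ Z := fun n => by
    refine ind S (p := fun n => f z n ∈ Z) inferInstance (h0.symm ▸ hz) (fun n hn => ?_) n
    rw [hs]
    exact ((hg' (n, f z n)).1 hn).1
  have hstep : ∀ n, P.Le (f z (n + 1)) (f z n) ∧ (n ∈ Z → P.Le (f z (n + 1)) n) := fun n => by
    rw [hs]
    exact ((hg' (n, f z n)).1 (hfZ n)).2
  have hmem : ∀ p ∈ Z, P.InFilter (f z) p := fun p hp => ⟨h.subset hp, p + 1, (hstep p).2 hp⟩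
  refine ⟨f z, ⟨(isFun_iff _).2 inferInstance, fun n => h.subset (hfZ n), fun n => (hstep n).1, ?_⟩,
    ?_⟩
  · rintro ⟨r, hr, hlt⟩
    obtain ⟨w, ⟨-, -, -, hw⟩, hwZ⟩ := h2 z z r hz hz
    exact hw ⟨hr, hlt w (hmem w hwZ)⟩
  · ext p
    exact ⟨fun ⟨hp, i, hi⟩ => h1 _ _ (hfZ i) hp hi, hmem p⟩

/-- A UF space is presented by any code of the class of unbounded filters. -/
theorem presents_filterSet [Fact (ACA S)] {C : Pi02Code S} (hC : ∀ Z, InY C Z ↔ P.IsFilter Z) :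
    Presents C P.UF P.filterSet where
  valid y hy := by
    haveI := fn1_of_isFun hy.1
    exact ⟨Dec.setOf_mem (S := S) fun p : M => p ∈ P.carrier ∧ ∃ i, P.Le (y i) p,
      (hC _).2 (isFilter_filterSet hy)⟩
  surj Z hZ h := ((hC Z).1 h).exists_pt hZ
  eqv x y hx hy e := by
    constructor
    · intro i
      have h : x i ∈ P.filterSet x := ⟨hx.2.1 i, i, P.refl _ (hx.2.1 i)⟩
      exact (e ▸ h).2
    · intro i
      have h : y i ∈ P.filterSet y := ⟨hy.2.1 i, i, P.refl _ (hy.2.1 i)⟩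
      exact (e ▸ h).2
  open_fin := by
    obtain ⟨R, hR, key⟩ := exists_triples S (r := fun _ c U : M => ∀ j, j < c → FinMem j c →
      j ∈ P.carrier ∧ P.Le U j) (by infer_instance)
    refine ⟨R, hR, fun y hy c => ⟨fun hc => ?_, ?_⟩⟩
    · haveI := fn1_of_isFun hy.1
      obtain ⟨b, hb⟩ := bounding_mono S (p := fun j i => FinMem j c → P.Le (y i) j) inferInstance
        (fun j m m' hm h hj => P.trans _ (hy.2.1 _) _ (hy.2.1 _) _ (hc j hj).1 (anti hy hm) (h hj))
        c (fun j _ => by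
          by_cases hj : FinMem j c
          · obtain ⟨-, i, hi⟩ := hc j hj
            exact ⟨i, fun _ => hi⟩
          · exact ⟨0, fun h => (hj h).elim⟩)
      exact ⟨0, y b, hy.2.1 b, (key _ _ _).2 fun j hj hjc => ⟨(hc j hjc).1, hb j hj hjc⟩,
        hy.2.1 b, b, P.refl _ (hy.2.1 b)⟩
    · rintro ⟨n, U, hU, hn, -, i, hi⟩ j hj
      obtain ⟨hjP, hUj⟩ := (key _ _ _).1 hn j hj.lt hj
      exact ⟨hjP, i, P.trans _ (hy.2.1 i) _ hU _ hjP hi hUj⟩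
  open_basis := by
    obtain ⟨R, hR, key⟩ := exists_triples S (r := fun _ V c : M => FinMem V c) (by infer_instance)
    refine ⟨R, hR, fun y _ V _ => ⟨fun h => ?_, ?_⟩⟩
    · obtain ⟨c, hc⟩ := exists_code S (p := fun j => j = V) inferInstance (V + 1)
      exact ⟨0, c, (key _ _ _).2 ((hc V).2 ⟨lt_add_one_iff.2 le_rfl, rfl⟩),
        fun j hj => ((hc j).1 hj).2 ▸ h⟩
    · rintro ⟨n, c, hn, hc⟩
      exact hc V ((key _ _ _).1 hn)

end PosetCode

/-! ### The equivalences -/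

theorem Pi11CA0.tfae : List.TFAE [
    Pi11CA0 S,
    ∀ Y : Pi02Code S, ∃ P : PosetCode S, Homeomorphic S Y.space P.UF,
    ∀ P : PosetCode S, P.UF.Nonempty →
      ∃ X : QMetCode S, X.SmythComplete ∧ Homeomorphic S P.UF X.space,
    ∀ Y : Pi02Code S, Y.space.Nonempty →
      ∃ X : QMetCode S, X.SmythComplete ∧ Homeomorphic S Y.space X.space] := by
  tfae_have 1 → 2 := fun h => h.homeomorphic_UF
  tfae_have 1 → 3 := fun h P hP => by
    haveI := Fact.mk h.aca
    obtain ⟨C, hC⟩ := P.exists_filterCode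
    exact h.homeomorphic_quasiPolish (PosetCode.presents_filterSet hC) hP
  tfae_have 1 → 4 := fun h Y hY => by
    haveI := Fact.mk h.aca
    exact h.homeomorphic_quasiPolish (presents_space Y) hY
  tfae_have 2 → 1 := fun h => (hub_of_UF h).pi11CA0
  tfae_have 3 → 1 := fun h => (hub_of_UF_quasiPolish h).pi11CA0
  tfae_have 4 → 1 := fun h => (hub_of_quasiPolish h).pi11CA0
  tfae_finish

end FilterCode

end SOA

theorem mainTheorem2 {M : Type*} [Zero M] [One M] [Add M] [Mul M] [LT M]
    (S : Set (Set M)) (hS : SOA.RCA0 S) :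
    List.TFAE [
      SOA.Pi11CA0 S,
      ∀ Y : SOA.Pi02Code S, ∃ P : SOA.PosetCode S, SOA.Homeomorphic S Y.space P.UF,
      ∀ P : SOA.PosetCode S, P.UF.Nonempty →
        ∃ X : SOA.QMetCode S, X.SmythComplete ∧ SOA.Homeomorphic S P.UF X.space,
      ∀ Y : SOA.Pi02Code S, Y.space.Nonempty →
        ∃ X : SOA.QMetCode S, X.SmythComplete ∧ SOA.Homeomorphic S Y.space X.space] := by
  letI := hS.nums
  haveI : Fact (SOA.RCA0 S) := ⟨hS⟩
  exact SOA.Pi11CA0.tfae (S := S)
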